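/- **Graphs.** A Kontsevich graph on two sinks $0,1$ and $n$ aerial vertices $2,\dots,n+1$ is a directed graph, without tadpoles and multiple edges, in which exactly two edges, ordered Left $\prec$ Right, are issued from every aerial vertex and none from the sinks. It is *affine* if every aerial vertex has in-degree $\leqslant 1$. Let $V_n$ be the $\mathbb{Q}$-vector space spanned by such graphs modulo: relabeling of aerial vertices acts trivially; a swap Left $\rightleftarrows$ Right at one aerial vertex changes the sign; non-affine graphs are discarded. A *Leibniz graph* (of order $k+2$) on the sinks $0,1$ is built, again without tadpoles and multiple edges, of $k$ wedges as above and one trident vertex with three ordered outgoing edges; it is *affine* if wedge tops have in-degree $\leqslant 1$ and the trident vertex has in-degree $\leqslant 2$. Its graph expansion in $V_{k+2}$ is obtained by replacing the trident with targets $(t_0,t_1,t_2)$ by the sum over the three cyclic permutations of two wedges $a\to(t_0,b)$, $b\to(t_1,t_2)$ and by distributing, by the Leibniz rule, the arrows that came to the trident over $a$ and $b$. **Analytic formulae.** Let $P=(P^{ij})$ be a skew-symmetric bi-vector with (locally) affine coefficients on an open set $U\subseteq\mathbb{R}^d$, with Jacobiator $J^{ijk}=\sum_l (P^{il}\partial_l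 P^{jk}+P^{jl}\partial_l P^{ki}+P^{kl}\partial_l P^{ij})$. A graph $\Gamma$ encodes an operator $\Gamma(P)(f,g)$: each edge carries a summation index $1,\dots,d$; aerial vertices carry copies of $P^{ij}$ ($i$ on Left, $j$ on Right), the trident (if any) carries a tri-vector $J$, the sinks $0,1$ carry $f,g$; the content of each vertex is differentiated along its incoming edges, and one takes the product and sums over all indices. The operator of a Leibniz graph $L$ is denoted $L(P,J)(f,g)$; it is a linear differential operator in $J$. All operators are extended $\hbar$-bilinearly to $f,g\in C^\infty(U)[[\hbar]]$. **The expansions.** Let $\star_{\mathrm{aff}} \bmod \bar o(\hbar^7)=\sum_{n\leqslant7}\hbar^n\sum_\Gamma (r_\Gamma+q_\Gamma\,\zeta(3)^2/\pi^6)\,\Gamma$, with $r_\Gamma,q_\Gamma\in\mathbb{Q}$, be the graph expansion of Kontsevich's star-product with harmonic propagators for affine Poisson brackets, as computed by Buring and Kiselev; it is listed in full in the formal statement. Its rational part is $\sum \hbar^n r_\Gamma\Gamma$ and its $\zeta(3)^2/\pi^6$-part is $\sum\hbar^n q_\Gamma\Gamma$. Let $\star_{\mathrm{aff}}^{\mathrm{red}}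 \bmod \bar o(\hbar^7)=\sum_{n\leqslant 7}\hbar^n\sum_\Gamma \rho_\Gamma\,\Gamma$, $\rho_\Gamma\in\mathbb{Q}$, be the reduced expansion, also listed in full there. **Claim.** 1. The list of $\star_{\mathrm{aff}}$ has exactly $1423$ graphs and that of $\star_{\mathrm{aff}}^{\mathrm{red}}$ exactly $326$; all of them are affine Kontsevich graphs, in either list the coefficients are nonzero (that is, $(r_\Gamma,q_\Gamma)\neq(0,0)$, respectively $\rho_\Gamma\neq0$), and the graphs of each order $n$ are linearly independent in $V_n$ (so that they are nonzero and pairwise different). 2. There are $\mathbb{Q}$-linear combinations $c_0,c_1$ of affine Leibniz graphs such that, at all orders $\hbar^n$, $n\leqslant 7$: the $\zeta(3)^2/\pi^6$-part of $\star_{\mathrm{aff}}$ equals in $V_n$ the graph expansion of $c_1$; and the rational part of $\star_{\mathrm{aff}}$ equals in $V_n$ the sum of $\star_{\mathrm{aff}}^{\mathrm{red}}$ and the graph expansion of $c_0$. Moreover, for every $d$, every open $U\subseteq\mathbb{R}^d$, every affine bi-vector $P$ on $U$ (Poisson or not) and all $f,g\in C^\infty(U)[[\hbar]]$, on $U$ and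 modulo $\bar o(\hbar^7)$: the $\zeta(3)^2/\pi^6$-part of $\star_{\mathrm{aff}}$ acts on $(f,g)$ as $c_1(P,J)$ with $J$ the Jacobiator of $P$, and $$f\star_{\mathrm{aff}}g-f\star_{\mathrm{aff}}^{\mathrm{red}}g=c_0(P,J)(f,g)+\frac{\zeta(3)^2}{\pi^6}\,c_1(P,J)(f,g),$$ a linear differential operator acting on the Jacobiator. 3. Consequently, for every affine Poisson structure $P$ on $U$ (that is, $J=0$) the operator $L(P,J)$ of every Leibniz graph $L$ vanishes on $U$ for all smooth arguments, the $\zeta(3)^2/\pi^6$-part of $\star_{\mathrm{aff}} \bmod \bar o(\hbar^7)$ vanishes, and $f\star_{\mathrm{aff}}g=f\star^{\mathrm{red}}_{\mathrm{aff}}g \bmod \bar o(\hbar^7)$ for all $f,g\in C^\infty(U)[[\hbar]]$. -/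

import Mathlib

open scoped ContDiff Topology

namespace AffStar

/-! ### Kontsevich graphs on two sinks -/

/-- Encoding of a graph built of `n` wedges over two sinks. The vertices are `0, 1` (sinks) and
`2, …, n + 1` (aerial vertices); `Γ v 0` and `Γ v 1` are the targets of the Left and the Right
edge issued from the aerial vertex `v + 2`. -/
abbrev KGraph (n : ℕ) : Type := Fin n → Fin 2 → Fin (n + 2)

namespace KGraph

variable {n : ℕ}

/-- The aerial vertex with number `v` among the `n` wedge tops. -/
def aerial (v : Fin n) : Fin (n + 2) := v.natAdd 2 |>.cast (Nat.add_comm 2 n)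

/-- The edges `(v, 0)` and `(v, 1)` that arrive at the vertex `t`. -/
def inEdges (Γ : KGraph n) (t : Fin (n + 2)) : List (Fin n × Fin 2) :=
  (List.finRange n ×ˢ List.finRange 2).filter fun e => Γ e.1 e.2 = t

/-- The number of edges arriving at `t`. -/
def inDegree (Γ : KGraph n) (t : Fin (n + 2)) : ℕ := (Γ.inEdges t).length

/-- A Kontsevich graph has neither tadpoles nor multiple edges. -/
def IsKontsevich (Γ : KGraph n) : Prop :=
  ∀ v, Γ v 0 ≠ Γ v 1 ∧ Γ v 0 ≠ aerial v ∧ Γ v 1 ≠ aerial v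

/-- Affine graphs: the in-degree of every aerial vertex is at most one. -/
def IsAffine (Γ : KGraph n) : Prop := ∀ v : Fin n, Γ.inDegree (aerial v) ≤ 1

/-- The action of a permutation of the aerial vertices on the set of all vertices. -/
def vertexPerm (σ : Equiv.Perm (Fin n)) (t : Fin (n + 2)) : Fin (n + 2) :=
  if h : 2 ≤ t.val then aerial (σ ⟨t.val - 2, by omega⟩) else t

/-- Relabeling of the aerial vertices: `v` becomes `σ v`. -/
def relabel (σ : Equiv.Perm (Fin n)) (Γ : KGraph n) : KGraph n :=
  fun v s => vertexPerm σ (Γ (σ.symm v) s)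

/-- Swap of the two outgoing edges at the aerial vertex `v`. -/
def swap (v : Fin n) (Γ : KGraph n) : KGraph n :=
  Function.update Γ v fun s => Γ v (1 - s)

end KGraph

/-- The relations between graph encodings: relabeling the aerial vertices does nothing, the swap
Left/Right at an aerial vertex changes the sign, and a graph that is not affine is discarded. -/
noncomputable def graphRelations (n : ℕ) : Submodule ℚ (KGraph n →₀ ℚ) :=
  Submodule.span ℚ
    ({r | ∃ (Γ : KGraph n) (σ : Equiv.Perm (Fin n)),
        r = Finsupp.single (Γ.relabel σ) 1 - Finsupp.single Γ 1} ∪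
     {r | ∃ (Γ : KGraph n) (v : Fin n),
        r = Finsupp.single (Γ.swap v) 1 + Finsupp.single Γ 1} ∪
     {r | ∃ Γ : KGraph n, ¬ Γ.IsAffine ∧ r = Finsupp.single Γ 1})

/-- The rational vector space of affine graphs on two sinks and `n` aerial vertices. -/
abbrev GraphSpace (n : ℕ) : Type := (KGraph n →₀ ℚ) ⧸ graphRelations n

/-- The class of a graph. -/
noncomputable def graphClass {n : ℕ} (Γ : KGraph n) : GraphSpace n :=
  (graphRelations n).mkQ (Finsupp.single Γ 1)

/-- A linear combination of graphs, as an element of the graph space. -/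
noncomputable def sumClass {n : ℕ} (S : List (KGraph n × ℚ)) : GraphSpace n :=
  (S.map fun t => t.2 • graphClass t.1).sum

/-! ### Leibniz graphs on two sinks -/

/-- A Leibniz graph with `k` wedges and one trident: vertices `0, 1` are the sinks,
`2, …, k + 1` the wedge tops, and `k + 2` is the trident vertex, which carries the Jacobiator.
There are neither tadpoles nor multiple edges. -/
structure LeibnizGraph (k : ℕ) where
  wedge : Fin k → Fin 2 → Fin (k + 3)
  trident : Fin 3 → Fin (k + 3)
  wedge_ne : ∀ v, wedge v 0 ≠ wedge v 1
  wedge_no_loop : ∀ v s, (wedge v s).val ≠ v.val + 2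
  trident_injective : Function.Injective trident
  trident_no_loop : ∀ s, (trident s).val ≠ k + 2

namespace LeibnizGraph

variable {k : ℕ}

/-- The wedge edges that arrive at the vertex `t`. -/
def wedgeInEdges (L : LeibnizGraph k) (t : Fin (k + 3)) : List (Fin k × Fin 2) :=
  (List.finRange k ×ˢ List.finRange 2).filter fun e => L.wedge e.1 e.2 = t

/-- The trident edges that arrive at the vertex `t`. -/
def tridentInEdges (L : LeibnizGraph k) (t : Fin (k + 3)) : List (Fin 3) :=
  (List.finRange 3).filter fun s => L.trident s = t

def inDegree (L : LeibnizGraph k) (t : Fin (k + 3)) : ℕ :=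
  (L.wedgeInEdges t).length + (L.tridentInEdges t).length

/-- The in-degrees are at most one at the wedge tops, and at most two at the trident vertex. -/
def IsAffine (L : LeibnizGraph k) : Prop :=
  (∀ t : Fin (k + 3), 2 ≤ t.val → t.val < k + 2 → L.inDegree t ≤ 1) ∧
    L.inDegree (Fin.last (k + 2)) ≤ 2

/-- One term in the expansion of a Leibniz graph. The trident is replaced by two wedges: the
upper one, `k + 2`, with targets (`r`th target of the trident, `k + 3`), and the lower one,
`k + 3`, whose targets are the other two targets of the trident, in cyclic order. An edge that
arrived at the trident is directed to `k + 3` if it belongs to `S`, and to `k + 2` otherwise. -/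
def expandTerm (L : LeibnizGraph k) (S : Finset (Fin k × Fin 2)) (r : Fin 3) : KGraph (k + 2) :=
  Fin.snoc (α := fun _ => Fin 2 → Fin (k + 4))
    (Fin.snoc (α := fun _ => Fin 2 → Fin (k + 4))
      (fun v s => if (v, s) ∈ S then Fin.last (k + 3) else (L.wedge v s).castSucc)
      ![(L.trident r).castSucc, Fin.last (k + 3)])
    ![(L.trident (r + 1)).castSucc, (L.trident (r + 2)).castSucc]

/-- The Kontsevich graph expansion of a Leibniz graph: the sum over the three terms of the
Jacobiator and, by the Leibniz rule, over all ways to distribute the arrows that arrive at the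
trident between the two wedges that replace it. -/
noncomputable def expand (L : LeibnizGraph k) : GraphSpace (k + 2) :=
  ∑ r : Fin 3, ∑ S ∈ (L.wedgeInEdges (Fin.last (k + 2))).toFinset.powerset,
    graphClass (L.expandTerm S r)

end LeibnizGraph

/-- Rational linear combinations of Leibniz graphs, with any number of wedges. -/
abbrev LeibnizSum : Type := (k : ℕ) → LeibnizGraph k →₀ ℚ

/-- The graph expansion of a sum of Leibniz graphs at order `ħ^n`. A Leibniz graph with `k`
wedges is of order `k + 2`, because the Jacobiator is quadratic in the bi-vector. -/
noncomputable def LeibnizSum.expand (c : LeibnizSum) : (n : ℕ) → GraphSpace n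
  | 0 => 0
  | 1 => 0
  | k + 2 => (c k).sum fun L a => a • L.expand

/-! ### The analytic formulae that the graphs encode -/

/-- The partial derivative along the `i`th coordinate of `ℝ^d`. -/
noncomputable def partialDeriv {d : ℕ} (i : Fin d) (h : (Fin d → ℝ) → ℝ) : (Fin d → ℝ) → ℝ :=
  fun x => fderiv ℝ h x (Pi.single i 1)

/-- Iterated partial derivatives. -/
noncomputable def iterPartial {d : ℕ} : List (Fin d) → ((Fin d → ℝ) → ℝ) → (Fin d → ℝ) → ℝ
  | [], h => h
  | i :: l, h => partialDeriv i (iterPartial l h)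

/-- The components `P^{ij}` of a bi-vector field. -/
abbrev BivectorField (d : ℕ) : Type := Fin d → Fin d → (Fin d → ℝ) → ℝ

/-- The function `h` is (locally) affine on `U`. -/
def IsAffineFunOn {d : ℕ} (h : (Fin d → ℝ) → ℝ) (U : Set (Fin d → ℝ)) : Prop :=
  ∀ x ∈ U, ∃ A : (Fin d → ℝ) →ᵃ[ℝ] ℝ, h =ᶠ[𝓝 x] A

/-- `P` is a bi-vector field on `U`, i.e. skew-symmetric, with affine coefficients. -/
def IsAffineBivectorOn {d : ℕ} (P : BivectorField d) (U : Set (Fin d → ℝ)) : Prop :=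
  (∀ i j, ∀ x ∈ U, P i j x = - P j i x) ∧ ∀ i j, IsAffineFunOn (P i j) U

/-- The Jacobiator, i.e. the left-hand side of the Jacobi identity for the coordinates. -/
noncomputable def jacobiator {d : ℕ} (P : BivectorField d) (i j k : Fin d) : (Fin d → ℝ) → ℝ :=
  fun x => ∑ l, (P i l x * partialDeriv l (P j k) x + P j l x * partialDeriv l (P k i) x +
    P k l x * partialDeriv l (P i j) x)

/-- An affine Poisson structure on `U`. -/
def IsAffinePoissonOn {d : ℕ} (P : BivectorField d) (U : Set (Fin d → ℝ)) : Prop :=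
  IsAffineBivectorOn P U ∧ ∀ i j k, ∀ x ∈ U, jacobiator P i j k x = 0

/-- The bi-differential operator encoded by a Kontsevich graph: every edge carries a summation
index, each aerial vertex a copy of `P`, the sinks `0` and `1` the arguments `f` and `g`, and the
content of each vertex is differentiated along the edges that arrive there. -/
noncomputable def KGraph.op {n d : ℕ} (Γ : KGraph n) (P : BivectorField d)
    (f g : (Fin d → ℝ) → ℝ) : (Fin d → ℝ) → ℝ := fun x =>
  ∑ I : Fin n → Fin 2 → Fin d,
    (∏ v : Fin n,
      iterPartial ((Γ.inEdges (KGraph.aerial v)).map fun e => I e.1 e.2) (P (I v 0) (I v 1)) x) *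
    iterPartial ((Γ.inEdges 0).map fun e => I e.1 e.2) f x *
    iterPartial ((Γ.inEdges 1).map fun e => I e.1 e.2) g x

/-- The indices on the edges of a Leibniz graph that arrive at the vertex `t`. -/
def LeibnizGraph.inIndices {k d : ℕ} (L : LeibnizGraph k) (I : Fin k → Fin 2 → Fin d)
    (T : Fin 3 → Fin d) (t : Fin (k + 3)) : List (Fin d) :=
  (L.wedgeInEdges t).map (fun e => I e.1 e.2) ++ (L.tridentInEdges t).map T

/-- The operator encoded by a Leibniz graph, with a tri-vector `J` in the trident vertex. For fixed
`P`, `f`, `g` this is a linear differential operator acting on `J`. -/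
noncomputable def LeibnizGraph.op {k d : ℕ} (L : LeibnizGraph k) (P : BivectorField d)
    (J : Fin d → Fin d → Fin d → (Fin d → ℝ) → ℝ) (f g : (Fin d → ℝ) → ℝ) :
    (Fin d → ℝ) → ℝ := fun x =>
  ∑ I : Fin k → Fin 2 → Fin d, ∑ T : Fin 3 → Fin d,
    (∏ v : Fin k,
      iterPartial (L.inIndices I T ⟨v.val + 2, by omega⟩) (P (I v 0) (I v 1)) x) *
    iterPartial (L.inIndices I T (Fin.last (k + 2))) (J (T 0) (T 1) (T 2)) x *
    iterPartial (L.inIndices I T 0) f x * iterPartial (L.inIndices I T 1) g x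

/-- A bi-differential operator at every order `ħ^n`. -/
abbrev BidiffSeries (d : ℕ) : Type :=
  ℕ → ((Fin d → ℝ) → ℝ) → ((Fin d → ℝ) → ℝ) → (Fin d → ℝ) → ℝ

/-- The operators encoded by real linear combinations of Kontsevich graphs. -/
noncomputable def graphOps {d : ℕ} (S : (n : ℕ) → List (KGraph n × ℝ)) (P : BivectorField d) :
    BidiffSeries d :=
  fun n f g x => ((S n).map fun t => t.2 * t.1.op P f g x).sum

/-- The operators encoded by a linear combination of Leibniz graphs. -/
noncomputable def LeibnizSum.ops {d : ℕ} (c : LeibnizSum) (P : BivectorField d)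
    (J : Fin d → Fin d → Fin d → (Fin d → ℝ) → ℝ) : BidiffSeries d
  | 0 => fun _ _ _ => 0
  | 1 => fun _ _ _ => 0
  | k + 2 => fun f g x => (c k).sum fun L a => (a : ℝ) * L.op P J f g x

/-- The `ħ`-bilinear extension of `∑ ħ^n B n` to formal power series in `ħ`. -/
noncomputable def BidiffSeries.product {d : ℕ} (B : BidiffSeries d)
    (f g : PowerSeries ((Fin d → ℝ) → ℝ)) : PowerSeries ((Fin d → ℝ) → ℝ) :=
  PowerSeries.mk fun N => ∑ p ∈ Finset.HasAntidiagonal.antidiagonal N, ∑ q ∈ Finset.HasAntidiagonal.antidiagonal p.2,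
    B p.1 (PowerSeries.coeff q.1 f) (PowerSeries.coeff q.2 g)

/-- Formal power series in `ħ` whose coefficients are smooth functions on `U`. -/
def IsSmoothOn {d : ℕ} (f : PowerSeries ((Fin d → ℝ) → ℝ)) (U : Set (Fin d → ℝ)) : Prop :=
  ∀ m, ContDiffOn ℝ ∞ (PowerSeries.coeff m f) U

/-! ### The graph expansions of the affine star-product modulo `ō(ħ^7)` -/

/-- A term `graph · (rat + zeta · ζ(3)² / π⁶)` in the expansion, where the `2 n` decimal digits of
`graph` (leading zeros are not written) list the targets of the edges Left, Right of the aerial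
vertices `2, …, n + 1`. -/
structure Row where
  graph : ℕ
  rat : ℚ
  zeta : ℚ

/-- The row of the graph `c` with coefficient `a / b`. -/
def w (c : ℕ) (a : ℤ) (b : ℕ) : Row := ⟨c, a / b, 0⟩

/-- The row of the graph `c` with coefficient `a / b + (p / q) ζ(3)² / π⁶`. -/
def z (c : ℕ) (a : ℤ) (b : ℕ) (p : ℤ) (q : ℕ) : Row := ⟨c, a / b, p / q⟩

set_option maxRecDepth 20000

def affRows0 : List Row := [
  w 0 1 1]

def affRows1 : List Row := [
  w 1 1 1]

def affRows2 : List Row := [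
  w 1302 (-1) 6, w 1301 (-1) 3, w 301 1 3, w 101 1 2]

def affRows3 : List Row := [
  w 140101 (-1) 3, w 40101 1 3, w 10101 1 6, w 130201 (-1) 6, w 130401 (-1) 6, w 140201 (-1) 6]

def affRows4 : List Row := [
  w 15010101 (-1) 6, w 5010101 1 6, w 1010101 1 24, w 15140101 1 18, w 5040101 1 18,
  w 14151301 1 45, w 13020101 (-1) 12, w 13050101 (-1) 6, w 15020101 (-1) 6, w 15040101 (-1) 9,
  w 4050301 (-1) 45, w 15140301 1 18, w 35140101 1 18, w 13150201 1 90, w 14150301 1 15,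
  w 13140501 1 90, w 14050201 (-1) 18, w 35040101 1 18, w 13040501 (-1) 90, w 14020501 (-1) 15,
  w 15040201 (-1) 90, w 34121501 1 90, w 35141201 1 90, w 14151302 1 90, w 34050201 1 90,
  w 35040201 (-1) 90, w 13050204 1 90, w 15140302 1 72, w 35240101 1 180, w 34120501 1 180,
  w 34150201 1 180, w 45120301 (-1) 144, w 35140201 1 144, w 13140502 1 360, w 15140203 1 72]

def affRows5 : List Row := [
  w 101010101 1 120, w 1601010101 (-1) 18, w 601010101 1 18, w 1306010101 (-1) 12,
  w 1602010101 (-1) 12, w 1615010101 1 18, w 605010101 1 18, w 1605010101 (-1) 9,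
  w 1416130101 1 45, w 406030101 (-1) 45, w 1416030101 1 15, w 1402060101 (-1) 15,
  w 3615010101 1 18, w 3605010101 1 18, w 4512160101 (-1) 90, w 4502060101 1 90,
  w 1316020101 1 90, w 1304060101 (-1) 90, w 1516030101 1 18, w 1405060101 (-1) 18,
  w 1415130201 1 90, w 1305020401 1 90, w 3614120101 1 90, w 3604020101 (-1) 90,
  w 1415130601 1 90, w 1605020401 1 90, w 1314060101 1 90, w 1604020101 (-1) 90,
  w 1415060101 1 18, w 1506020101 (-1) 18, w 3615120401 (-1) 240, w 5614020301 (-1) 240,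
  w 1514020301 1 72, w 3614150101 (-1) 90, w 3604050101 1 90, w 1416130201 1 90,
  w 1305060401 1 90, w 4612050301 (-1) 720, w 3614150201 (-1) 720, w 3614050201 (-1) 1440,
  w 5614120301 (-1) 1440, w 1415060203 1 480, w 1416150302 (-1) 480, w 1615030201 43 1440,
  w 1514060301 43 1440, w 3614050101 7 360, w 4615030101 (-7) 360, w 4612050101 (-11) 1440,
  w 3615020101 11 1440, w 3645120101 (-1) 288, w 3645020101 1 288, w 4612030101 (-1) 144,
  w 3614020101 1 144, w 3416150201 (-1) 1440, w 4512060301 (-1) 1440, w 1416050301 19 1440,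
  w 1512030601 19 1440, w 1412050301 1 360, w 3514020601 1 240, w 3516120401 (-1) 240,
  w 3416050101 23 720, w 1412060305 (-1) 480, w 1416130205 1 480, w 3514120601 1 180,
  w 3416050201 (-1) 180, w 1612050301 1 720, w 1314050601 1 720, w 1302010101 (-1) 36,
  w 1416020101 1 18, w 1406020101 (-1) 18, w 3416120101 (-1) 90, w 3406020101 1 90,
  w 3625010101 1 180, w 4516030201 (-1) 180, w 3412150601 1 180, w 3412050601 1 1440,
  w 3514160201 (-1) 1440, w 1614030201 1 36, w 1514030601 1 36, w 3624150101 (-1) 240,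
  w 3425060101 1 240, w 3412060101 1 180, w 3416020101 1 180, w 1514030201 1 72]

def affRows6 : List Row := [
  w 10101010101 1 720, w 170101010101 (-1) 72, w 70101010101 1 72, w 130701010101 (-1) 36,
  w 170201010101 (-1) 36, w 171601010101 1 36, w 70601010101 1 36, w 170601010101 (-1) 18,
  w 141713010101 1 90, w 40703010101 (-1) 90, w 141703010101 1 30, w 140207010101 (-1) 30,
  w 131407010101 1 180, w 170402010101 (-1) 180, w 371601010101 1 36, w 370601010101 1 36,
  w 131702010101 1 180, w 130407010101 (-1) 180, w 161703010101 1 18, w 140706010101 (-1) 18,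
  w 141607010101 1 18, w 170206010101 (-1) 18, w 461217010101 (-1) 90, w 470206010101 1 90,
  w 471206010101 (-11) 1440, w 371602010101 11 1440, w 371412010101 1 180,
  w 470203010101 (-1) 180, w 471203010101 (-1) 288, w 371402010101 1 288, w 151402030101 1 144,
  w 141205030101 1 720, w 161715131401 (-2) 945, w 60705030401 2 945, w 171415160101 (-1) 135,
  w 70405060101 (-1) 135, w 371416010101 (-1) 90, w 370406010101 1 90, w 161715131402 (-1) 945,
  w 130702060405 (-1) 945, w 141713020101 1 90, w 130507040101 1 90, w 161415170301 (-1) 210,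
  w 140205060701 1 210, w 471603010101 (-7) 360, w 371406010101 7 360, w 131405070101 1 720,
  w 171205030101 1 720, w 141705030101 19 1440, w 151203070101 19 1440, w 341706010101 23 720,
  w 151407030101 43 1440, w 171503020101 43 1440, w 341517161201 (-1) 945, w 340507060201 1 945,
  w 171415160301 (-1) 270, w 140705060201 1 270, w 141715160301 (-1) 210, w 140507060201 1 210,
  w 141513070101 1 90, w 170502040101 1 90, w 141513020101 1 180, w 130502040101 1 180,
  w 171603020101 1 72, w 151406070101 1 72, w 151603070101 1 36, w 571412030101 (-1) 1440,
  w 371405020101 (-1) 1440, z 561712030101 (-19) 3240 15 4, z 361407020101 (-19) 3240 15 4,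
  w 371415020101 (-1) 720, w 471205030101 (-1) 720, z 161715030401 (-53) 3024 27 8,
  z 151603070201 53 3024 (-27) 8, w 171615030401 (-1) 216, w 161507020301 1 216,
  z 574612130101 (-29) 2268 17 2, z 574602030101 (-29) 2268 17 2, z 141715160302 103 4536 (-33) 2,
  z 151406030702 103 4536 (-33) 2, z 371416020101 (-103) 12960 15 4,
  z 471205060101 (-103) 12960 15 4, z 341716120501 (-43) 7560 4 1, z 561402070301 43 7560 (-4) 1,
  z 471215060101 (-157) 12960 15 4, z 571602030101 (-157) 12960 15 4, w 374612010101 (-1) 288,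
  w 374602010101 1 288, w 471215030101 (-1) 240, w 571402030101 (-1) 240,
  z 465713020101 (-47) 2520 49 4, z 171615030204 731 90720 (-105) 16, w 171615010101 (-1) 162,
  w 70605010101 1 162, w 171605010101 1 54, w 170605010101 (-1) 54, w 151617040101 (-1) 45,
  w 150602070101 (-1) 45, w 171415060101 (-1) 270, w 160705020101 (-1) 270,
  w 451617010101 (-1) 54, w 470605010101 1 54, w 461517120101 (-1) 270, w 460507020101 (-1) 270,
  w 371612141501 (-1) 945, w 370602040501 1 945, w 151417160301 (-1) 945, w 140605070201 1 945,
  w 171416030101 (-1) 270, w 140705060101 (-1) 270, w 461715120101 (-1) 270,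
  w 460705020101 (-1) 270, w 151613140701 (-1) 945, w 170602040501 1 945, w 141713060101 1 135,
  w 160507040101 1 135, w 341615121701 1 945, w 340605070201 1 945, w 151607030101 1 45,
  w 161503070101 1 45, w 131506070101 1 270, w 171605030101 1 270, w 371605010101 1 54,
  w 471605010101 (-1) 54, w 161207030101 1 270, w 171405060101 1 270,
  z 461517020101 (-13) 6480 (-3) 1, z 561203070101 (-13) 6480 (-3) 1, w 141615030201 (-1) 480,
  w 141506020301 1 480, w 451217030101 (-1) 240, w 351402070101 1 240, w 451217060101 (-59) 12960,
  w 351602070101 59 12960, w 341715020101 (-1) 1440, w 451207030101 (-1) 1440,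
  z 161415070301 (-173) 30240 15 8, z 171503060201 173 30240 (-15) 8,
  z 371512160401 4703 181440 (-273) 16, z 571402060301 (-4703) 181440 273 16,
  z 461217030101 (-11) 4320 (-3) 1, z 561402070101 (-11) 4320 (-3) 1,
  z 371615120401 (-1013) 36288 287 16, z 571406030201 1013 36288 (-287) 16,
  w 374516010101 19 12960, w 374506010101 (-19) 12960, z 151417160302 (-1583) 90720 23 2,
  z 151407060302 (-1583) 90720 23 2, z 571412060101 11 12960 (-3) 1,
  z 371605020101 11 12960 (-3) 1, w 561712040101 1 432, w 361507020101 1 432,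
  w 461715020101 (-1) 432, w 561207030101 (-1) 432, z 141615030701 377 90720 (-3) 1,
  z 171506020301 (-377) 90720 3 1, w 351412070101 1 180, w 341705020101 (-1) 180,
  w 341516120701 (-1) 1890, w 451706030201 1 1890, w 371412060101 1 270, w 471605020101 1 270,
  w 361517140101 (-1) 270, w 360507040101 (-1) 270, w 341715160101 (-1) 270,
  w 340705060101 (-1) 270, w 151713140201 (-1) 945, w 130607040501 1 945,
  z 374516120101 (-701) 181440 37 16, z 452607030101 (-701) 181440 37 16,
  z 371415060101 (-89) 12960 (-9) 8, z 471605030101 (-89) 12960 (-9) 8,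
  z 354712160101 43 181440 (-1) 16, z 562407030101 43 181440 (-1) 16, z 341715060101 (-1) 360 3 4,
  z 451607030101 (-1) 360 3 4, z 361512170401 (-53) 30240 11 8, z 351402060701 (-53) 30240 11 8,
  z 351416070101 (-13) 6480 (-3) 4, z 341705060101 13 6480 3 4, z 341516170201 137 45360 (-11) 8,
  z 451206030701 (-137) 45360 11 8, z 141613020701 11 2268 (-3) 8, z 141706030501 (-11) 2268 3 8,
  z 151713140206 (-239) 30240 5 1, z 141207030506 (-239) 30240 5 1,
  z 141713060201 (-53) 45360 3 2, z 131406070501 53 45360 (-3) 2,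
  z 671512140301 1963 181440 (-7) 1, z 371406020501 (-1963) 181440 7 1,
  z 571416030101 7 6480 (-9) 8, z 371405060101 7 6480 (-9) 8, z 371516140201 (-31) 2880 13 2,
  z 471206030501 31 2880 (-13) 2, z 141617030201 377 90720 (-27) 8,
  z 151406030701 (-377) 90720 27 8, z 451617030101 (-91) 6480 3 4, z 351406070101 91 6480 (-3) 4,
  z 141716020301 (-173) 30240 9 8, z 151407060301 173 30240 (-9) 8,
  z 361715120401 131 181440 (-17) 16, z 351406070201 131 181440 (-17) 16,
  z 341517160201 (-37) 12096 35 16, z 451206070301 37 12096 (-35) 16,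
  z 461715030101 (-13) 1440 (-9) 8, z 561407030101 (-13) 1440 (-9) 8,
  z 374615120101 163 11340 (-41) 4, z 472605030101 163 11340 (-41) 4,
  z 161417030501 11 18144 (-9) 8, z 151203060701 (-11) 18144 9 8, w 141613020501 1 480,
  w 141206030501 (-1) 480, w 141715060201 (-1) 1080, w 151207060301 1 1080,
  z 141715060301 11 18144 (-3) 2, z 151206070301 (-11) 18144 3 2,
  z 375612040101 487 45360 (-115) 16, z 374615020101 487 45360 (-115) 16,
  z 571216040301 3463 181440 (-379) 32, z 371615020401 (-3463) 181440 379 32,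
  w 361517120401 (-1) 420, w 351407060201 (-1) 420, w 361512140701 (-1) 1890,
  w 341706020501 (-1) 1890, w 141613070201 1 270, w 171406030501 (-1) 270,
  z 561412070301 779 362880 (-59) 32, z 341617020501 779 362880 (-59) 32,
  z 561712030401 (-299) 90720 2 1, z 341516070201 299 90720 (-2) 1,
  z 374512060101 (-811) 362880 11 32, z 374516020101 811 362880 (-11) 32,
  z 171416030205 (-643) 90720 17 4, z 171415060203 (-643) 90720 17 4,
  z 351612040701 (-31) 5040 11 4, z 351617040201 (-31) 5040 11 4,
  z 361415020701 13 13440 (-25) 32, z 451217060301 13 13440 (-25) 32,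
  z 371415060201 191 25920 (-151) 32, z 571412060301 (-191) 25920 151 32,
  z 354612070101 (-307) 362880 (-19) 32, z 345617020101 (-307) 362880 (-19) 32,
  z 141713060205 47 18144 (-31) 16, z 351412060701 (-53) 90720 3 4,
  z 351417060201 (-53) 90720 3 4, z 451216070301 (-37) 90720 (-17) 16,
  z 351716040201 (-37) 90720 (-17) 16, z 671415020301 41 36288 (-1) 4,
  z 371612040501 (-41) 36288 1 4, z 141613070501 (-53) 45360 3 2, z 171206030501 53 45360 (-3) 2,
  w 130201010101 (-1) 144, w 141702010101 1 36, w 130207010101 (-1) 36, w 341712010101 (-1) 180,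
  w 340207010101 (-1) 180, w 341207010101 1 360, w 341702010101 1 360, w 372601010101 1 360,
  w 151403070101 1 36, w 171403020101 1 36, w 341512161701 1 945, w 340502060701 (-1) 945,
  w 141615170301 (-1) 270, w 140502060701 1 270, w 351216170101 (-1) 270, w 450706020101 1 270,
  w 351417020101 (-1) 1440, w 341205070101 1 1440, w 372416010101 (-1) 240, w 342607010101 1 240,
  w 171415160302 (-1) 540, w 141506030702 (-1) 540, w 341216170501 (-1) 420,
  w 561407030201 (-1) 420, w 341512070101 (-1) 180, w 451703020101 (-1) 180,
  w 171516030204 (-1) 432, w 151716020101 (-1) 108, w 150706020101 (-1) 108, w 161507030101 1 54,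
  w 161715040301 (-1) 90, w 161503070201 1 90, w 451712060101 (-1) 540, w 351607020101 1 540,
  w 161415070201 (-1) 540, w 171403060201 1 540, w 451617020101 (-1) 540, w 351206070101 1 540,
  w 461517030101 (-1) 108, w 561403070101 (-1) 108, w 354617120101 1 540, w 562403070101 1 540,
  w 372615010101 (-1) 540, w 372605010101 1 540, w 361215170401 (-1) 1890,
  w 351406020701 (-1) 1890, w 161417030201 (-1) 540, w 151403060701 1 540,
  w 371516120401 (-1) 540, w 571403060201 1 540, w 341512160701 1 1890, w 451706020301 (-1) 1890,
  w 341712060101 (-1) 270, w 451607020101 (-1) 270, z 372516140101 17 90720 (-3) 8,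
  z 372405060101 17 90720 (-3) 8, z 361517140201 53 90720 (-3) 4, z 341206070501 53 90720 (-3) 4,
  z 352416170101 1 360 (-9) 8, z 352406070101 1 360 (-9) 8, z 352417060101 13 6480 (-15) 8,
  z 361415070201 11 36288 (-3) 4, z 451712060301 11 36288 (-3) 4, w 171415060302 (-1) 2160,
  z 345612070101 (-11) 25920 3 2, z 354617020101 (-11) 25920 3 2, w 571612040301 1 864,
  w 471615020301 (-1) 864, z 372415060101 (-11) 5040 (-3) 8, z 372516040101 (-11) 5040 (-3) 8,
  z 451716020301 377 181440 (-3) 2, z 351216040701 377 181440 (-3) 2,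
  z 561417020301 53 90720 (-3) 4, z 341612070501 53 90720 (-3) 4, w 151403020101 1 144,
  w 341712160501 1 540, w 561403070201 (-1) 540, w 171615040301 (-1) 216, w 161507030201 1 216,
  w 372615040101 (-1) 1080, w 451617020301 (-1) 1080, w 451612070301 (-1) 1080,
  w 171615040302 (-1) 1296]

def affRows7 : List Row := [
  w 1010101010101 1 5040, w 18010101010101 (-1) 360, w 8010101010101 1 360,
  w 13080101010101 (-1) 144, w 18020101010101 (-1) 144, w 18170101010101 1 108,
  w 8070101010101 1 108, w 18070101010101 (-1) 54, w 13141801010101 1 270,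
  w 3040801010101 (-1) 270, w 14180301010101 1 90, w 14020801010101 (-1) 90,
  w 13140801010101 1 540, w 18040201010101 (-1) 540, w 38170101010101 1 108,
  w 38070101010101 1 108, w 13180201010101 1 540, w 13040801010101 (-1) 540,
  w 17180301010101 1 36, w 14080701010101 (-1) 36, w 14170801010101 1 36,
  w 18020701010101 (-1) 36, w 48121701010101 (-1) 180, w 48020701010101 1 180,
  w 48120701010101 (-11) 2880, w 38170201010101 11 2880, w 38141201010101 1 540,
  w 48020301010101 (-1) 540, w 48120301010101 (-1) 864, w 38140201010101 1 864,
  w 14151302010101 1 540, w 13050204010101 1 540, w 15140203010101 1 432, w 13140502010101 1 2160,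
  w 38141701010101 (-1) 180, w 38040701010101 1 180, w 13141802010101 1 180,
  w 13050804010101 1 180, w 14151308010101 1 180, w 18050204010101 1 180,
  w 48170301010101 (-7) 720, w 38140701010101 7 720, w 13140508010101 1 1440,
  w 13180502010101 1 1440, w 15180304010101 19 2880, w 13150208010101 19 2880,
  w 34180701010101 23 1440, w 14150308010101 43 2880, w 15180203010101 43 2880,
  w 15180307010101 1 36, w 15140708010101 1 72, w 18170302010101 1 72, w 58141203010101 (-1) 2880,
  w 38140502010101 (-1) 2880, w 38141502010101 (-1) 1440, w 58120304010101 (-1) 1440,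
  w 48121503010101 (-1) 480, w 58140203010101 (-1) 480, z 58121704010101 (-19) 3240 15 4,
  z 38150207010101 (-19) 3240 15 4, z 38141702010101 (-103) 12960 15 4,
  z 48120507010101 (-103) 12960 15 4, z 48121507010101 (-157) 12960 15 4,
  z 58170203010101 (-157) 12960 15 4, w 38471201010101 (-1) 576, w 38470201010101 1 576,
  z 47581302010101 (-47) 2520 49 4, z 58471213010101 (-29) 2268 17 2,
  z 58470203010101 (-29) 2268 17 2, w 18171601010101 (-1) 162, w 8070601010101 1 162,
  w 18170601010101 1 54, w 18070601010101 (-1) 54, w 18141517010101 (-1) 135,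
  w 8040507010101 (-1) 135, w 15171804010101 (-1) 45, w 15070208010101 (-1) 45,
  w 13151708010101 (-1) 270, w 17080502010101 (-1) 270, w 46171801010101 (-1) 54,
  w 48070601010101 1 54, w 14171802010101 (-1) 270, w 14080507010101 (-1) 270,
  w 13141708010101 1 135, w 17050804010101 1 135, w 48170601010101 (-1) 54, w 38170601010101 1 54,
  w 17180503010101 1 270, w 13150708010101 1 270, w 15180207010101 1 45, w 14180307010101 1 45,
  w 14180507010101 1 270, w 13180207010101 1 270, w 17161804010101 (-1) 108,
  w 15070608010101 (-1) 108, w 15181706010101 (-1) 108, w 16080702010101 (-1) 108,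
  w 15170806010101 1 54, w 17180306010101 1 54, z 58141207010101 11 12960 (-3) 1,
  z 38170502010101 11 12960 (-3) 1, z 48151702010101 (-13) 6480 (-3) 1,
  z 58120307010101 (-13) 6480 (-3) 1, w 45121708010101 (-59) 12960, w 35180207010101 59 12960,
  z 48121703010101 (-11) 4320 (-3) 1, z 58140207010101 (-11) 4320 (-3) 1,
  w 38461701010101 19 12960, w 38460701010101 (-19) 12960, w 56121718010101 1 270,
  w 56070208010101 1 270, w 47151812010101 (-1) 270, w 47050802010101 (-1) 270,
  w 47181512010101 (-1) 270, w 47080502010101 (-1) 270, w 58121607010101 11 4320,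
  w 38170206010101 11 4320, w 46171802010101 (-11) 4320, w 58120706010101 (-11) 4320,
  w 48121607010101 (-1) 270, w 58170206010101 (-1) 270, w 45121803010101 (-1) 480,
  w 35140208010101 1 480, w 34151802010101 1 2880, w 45120308010101 1 2880,
  w 35141208010101 1 360, w 35180204010101 (-1) 360, w 58121703010101 1 432,
  w 38140207010101 1 432, w 38151702010101 (-1) 432, w 48120307010101 (-1) 432,
  w 38141207010101 1 270, w 58170204010101 1 270, w 16181513140101 (-2) 945,
  w 6080503040101 2 945, w 16141518030101 (-1) 210, w 14020506080101 1 210,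
  w 37151814010101 (-1) 270, w 37050804010101 (-1) 270, w 48121516170101 1 945,
  w 48020506070101 (-1) 945, w 34181517010101 (-1) 270, w 34080507010101 (-1) 270,
  w 15181314020101 (-1) 945, w 13060804050101 1 945, z 15181604030101 (-53) 3024 27 8,
  z 15160308020101 53 3024 (-27) 8, z 13151604080101 377 90720 (-3) 1,
  z 18150602030101 (-377) 90720 3 1, z 38141507010101 (-89) 12960 (-9) 8,
  z 58170304010101 (-89) 12960 (-9) 8, z 35141708010101 (-13) 6480 (-3) 4,
  z 34180507010101 13 6480 3 4, z 13181206040101 (-53) 45360 3 2,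
  z 13140608050101 53 45360 (-3) 2, z 13151208040101 11 2268 (-3) 8,
  z 14180603050101 (-11) 2268 3 8, z 34151708010101 1 360 (-3) 4, z 45180307010101 1 360 (-3) 4,
  z 58141703010101 7 6480 (-9) 8, z 38140507010101 7 6480 (-9) 8, z 45171803010101 (-91) 6480 3 4,
  z 35140807010101 91 6480 (-3) 4, z 16181204030101 (-173) 30240 9 8,
  z 15140806030101 173 30240 (-9) 8, z 18121604030101 377 90720 (-27) 8,
  z 15140603080101 (-377) 90720 27 8, z 38151704010101 (-13) 1440 (-9) 8,
  z 48150307010101 (-13) 1440 (-9) 8, z 18151206040101 11 18144 (-9) 8,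
  z 15120306080101 (-11) 18144 9 8, z 13151806040101 11 18144 (-3) 2,
  z 15120608030101 (-11) 18144 3 2, z 13141506080101 (-53) 45360 3 2,
  z 18120603050101 53 45360 (-3) 2, z 16151308040101 (-173) 30240 15 8,
  z 18150306020101 173 30240 (-15) 8, w 14181516030101 (-1) 210, w 14050806020101 1 210,
  w 18141516030101 (-1) 270, w 14080506020101 1 270, w 14181517030101 (-1) 270,
  w 14050806070101 1 270, w 34181516120101 1 945, w 34080506020101 (-1) 945,
  w 38161214150101 (-1) 945, w 38060204050101 1 945, w 47151816120101 1 945,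
  w 47050806020101 (-1) 945, w 15161314080101 (-1) 945, w 18060204050101 1 945,
  w 14161517080101 (-1) 270, w 18050206070101 1 270, w 16171803040101 (-1) 90,
  w 16150307080101 1 90, w 13151708040101 (-1) 540, w 15170608030101 1 540,
  w 46171803010101 (-1) 108, w 58140706010101 (-1) 108, w 17181203040101 (-1) 540,
  w 14150806070101 1 540, w 15161708040101 (-1) 90, w 17150308020101 1 90,
  w 14151607080101 (-1) 540, w 17180602030101 1 540, w 48151607010101 (-1) 108,
  w 58170306010101 (-1) 108, w 17151208040101 (-1) 540, w 15180306070101 1 540,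
  w 15121604030101 (-1) 960, w 14150602030101 1 960, w 13151206040101 1 960,
  w 14120603050101 (-1) 960, z 38471512010101 163 11340 (-41) 4,
  z 38470502010101 163 11340 (-41) 4, z 57181216030101 943 362880 3 16,
  z 67140802030101 (-943) 362880 (-3) 16, z 38471502010101 487 45360 (-115) 16,
  z 38571204010101 487 45360 (-115) 16, z 68151214030101 1963 181440 (-7) 1,
  z 38140602050101 (-1963) 181440 7 1, z 68151217030101 257 362880 1 16,
  z 38140602070101 (-257) 362880 (-1) 16, z 38151614020101 (-31) 2880 13 2,
  z 48120603050101 31 2880 (-13) 2, z 17151618030401 (-437) 72576 65 16,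
  z 15160307020801 (-437) 72576 65 16, z 67451812130101 (-5239) 362880 149 16,
  z 67450802030101 5239 362880 (-149) 16, z 34161712180501 53 5760 (-99) 16,
  z 56140207030801 53 5760 (-99) 16, z 17161814150302 (-289) 120960 27 16,
  z 14150308020607 289 120960 (-27) 16, z 37151814020101 131 51840 (-31) 16,
  z 47120608050101 (-131) 51840 31 16, z 37141508020101 (-11) 45360 (-7) 8,
  z 58121706040101 11 45360 7 8, z 67181302040101 173 362880 3 16,
  z 48121506070101 (-173) 362880 (-3) 16, z 38161702040101 17 6048 (-2) 1,
  z 67121508040101 (-17) 6048 2 1, z 58121604030101 3463 181440 (-379) 32,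
  z 38161502040101 (-3463) 181440 379 32, z 38141506020101 191 25920 (-151) 32,
  z 58121306040101 (-191) 25920 151 32, z 58161304020101 41 36288 (-1) 4,
  z 38151206040101 (-41) 36288 1 4, w 18161503040101 (-1) 216, w 16150802030101 1 216,
  w 13161208040101 1 270, w 18140603050101 (-1) 270, w 18151306040101 (-1) 1080,
  w 15120806030101 1 1080, w 47181516010101 1 270, w 47080506010101 1 270, w 48151612170101 1 945,
  w 48060507020101 (-1) 945, w 18141517030101 (-1) 270, w 14080506070101 1 270,
  w 16171513140201 (-1) 945, w 13070206040501 (-1) 945, w 34161512180101 1 945,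
  w 34060508020101 1 945, w 16171513140801 (-1) 945, w 18070206040501 (-1) 945,
  w 18141516070101 (-1) 270, w 17080506020101 1 270, w 14151618030101 (-1) 945,
  w 14060508020101 1 945, w 56171804010101 7 1080, w 38150706010101 7 1080,
  w 17181604030101 (-43) 4320, w 16150708030101 43 4320, w 38141607010101 (-1) 270,
  w 48170506010101 (-1) 270, w 13171208040101 1 270, w 14170608050101 (-1) 270,
  w 18141506070101 (-1) 2160, w 17120806030101 1 2160, w 18151706040101 (-19) 4320,
  w 16120307080101 19 4320, w 38151607010101 (-7) 1080, w 48170306010101 (-7) 1080,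
  w 17151308040101 (-19) 4320, w 15170806030101 19 4320, w 17181306040101 (-1) 2160,
  w 13150806070101 1 2160, w 45171806010101 (-23) 2160, w 35180706010101 23 2160,
  w 13141607080101 1 270, w 18170603050101 (-1) 270, w 17151604080101 (-43) 4320,
  w 17160308020101 43 4320, z 56121308040101 779 362880 (-59) 32,
  z 34181506020101 (-779) 362880 59 32, z 36141502080101 13 13440 (-25) 32,
  z 35181206040101 13 13440 (-25) 32, z 35161208040101 (-37) 90720 (-17) 16,
  z 36181502040101 (-37) 90720 (-17) 16, z 48161517020101 121 15120 (-35) 8,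
  z 58120306070101 (-121) 15120 35 8, z 14171516030201 103 4536 (-33) 2,
  z 15140603070201 103 4536 (-33) 2, z 46121518030101 (-53) 30240 11 8,
  z 35140206080101 (-53) 30240 11 8, z 46121517080101 131 72576 (-5) 4,
  z 35180206070101 131 72576 (-5) 4, z 34151618020101 137 45360 (-11) 8,
  z 45120603080101 (-137) 45360 11 8, z 17141516080301 43 120960 (-27) 16,
  z 18150306070201 43 120960 (-27) 16, z 56121718040101 1 4480 1 2, z 36140702080101 1 4480 1 2,
  z 17151816040301 9 4480 (-17) 16, z 15160207080301 9 4480 (-17) 16,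
  z 46151812030101 131 181440 (-17) 16, z 35140608020101 131 181440 (-17) 16,
  z 34181516020101 37 12096 (-35) 16, z 45120806030101 (-37) 12096 35 16,
  z 47151816020101 1 12960 1 4, z 57120608030101 (-1) 12960 (-1) 4, w 15181716040201 1 1440,
  w 15160807020301 1 1440, z 47581612130101 1849 362880 (-49) 16,
  z 47580602030101 (-1849) 362880 49 16, z 57481613010101 893 90720 (-31) 8,
  z 47580306010101 893 90720 (-31) 8, z 38151216170401 (-53) 4032 143 16,
  z 58140206070301 (-53) 4032 143 16, z 38171516120401 (-1) 160 71 16,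
  z 58140603070201 (-1) 160 71 16, z 48121517030101 (-163) 18144 53 8,
  z 58140206070101 163 18144 (-53) 8, z 38471516010101 (-41) 9072 29 8,
  z 38460507010101 (-41) 9072 29 8, z 34181517020101 (-1019) 362880 5 4,
  z 45120806070101 1019 362880 (-5) 4, z 15161718140203 293 181440 (-1) 1,
  z 14150708020306 (-293) 181440 1 1, z 34161812170501 (-1301) 72576 95 8,
  z 56140207080301 (-1301) 72576 95 8, z 47151812030101 71 10080 (-5) 1,
  z 57140608020101 (-71) 10080 5 1, z 34181716120501 (-2029) 120960 179 16,
  z 56140708030201 (-2029) 120960 179 16, z 35471816010101 (-109) 60480 (-3) 8,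
  z 35470806010101 (-109) 60480 (-3) 8, z 38141706020101 (-29) 11340 9 4,
  z 58141206070101 29 11340 (-9) 4, z 36141702080101 (-11) 13440 1 4,
  z 45121806070101 (-11) 13440 1 4, z 67121304080101 85 18144 (-57) 16,
  z 37181506020101 (-85) 18144 57 16, z 57481603010101 331 90720 1 8,
  z 47581306010101 331 90720 1 8, z 67181204030101 (-121) 25920 17 4,
  z 47161508020101 121 25920 (-17) 4, z 36181702040101 (-227) 51840 5 4,
  z 46121507080101 (-227) 51840 5 4, z 37181604020101 11 7560 (-35) 16,
  z 57161208040101 (-11) 7560 35 16, z 38561704010101 353 181440 1 2,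
  z 38461507010101 353 181440 1 2, z 37161204080101 (-1709) 181440 17 4,
  z 58161704020101 1709 181440 (-17) 4, z 34171508020101 (-43) 17280 1 1,
  z 56121708040101 43 17280 (-1) 1, z 37181206040101 13 5040 (-15) 8,
  z 67141502080101 (-13) 5040 15 8, z 35461807010101 (-23) 13440 3 16,
  z 34561807010101 (-23) 13440 3 16, z 67151812040101 7 2592 (-3) 4,
  z 37150608020101 (-7) 2592 3 4, w 67181512040101 1 4320, w 37150806020101 (-1) 4320,
  w 47181516020101 1 2160, w 57120806030101 (-1) 2160, z 15181716040301 17 6720 (-7) 4,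
  z 15160708020301 17 6720 (-7) 4, w 46181512030101 (-1) 420, w 35140806020101 (-1) 420,
  w 34151716120801 (-1) 1890, w 45180603070201 (-1) 1890, w 47181512030101 (-1) 540,
  w 57140806020101 1 540, w 67121308040101 (-1) 4320, w 47181506020101 1 4320,
  w 37141608020101 (-1) 2160, w 57181206040101 1 2160, w 37161208040101 (-1) 720,
  w 67181502040101 1 720, z 35161204080101 (-31) 5040 11 4, z 35161804020101 (-31) 5040 11 4,
  z 34151608020101 299 90720 (-2) 1, z 56181203040101 (-299) 90720 2 1,
  z 35141206080101 (-53) 90720 3 4, z 35141806020101 (-53) 90720 3 4, w 36151214080101 (-1) 1890,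
  w 34180602050101 (-1) 1890, w 17141516030801 (-1) 540, w 18140602070301 (-1) 540,
  z 68151214070101 (-1) 45360 1 2, z 38170602050101 1 45360 (-1) 2,
  z 14171516030801 (-89) 30240 1 2, z 18150602070301 (-89) 30240 1 2, w 67181203040101 1 864,
  w 47151608020101 (-1) 864, w 38161704020101 (-1) 864, w 57161204080101 1 864,
  z 38451712010101 (-701) 181440 37 16, z 45280307010101 701 181440 (-37) 16,
  z 35481217010101 43 181440 (-1) 16, z 35480207010101 43 181440 (-1) 16,
  z 48121516070101 1723 362880 (-45) 16, z 58170206030101 (-1723) 362880 45 16,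
  w 45121816070101 (-199) 362880, w 56170208030101 199 362880,
  z 45271803010101 811 362880 (-11) 32, z 45271308010101 (-811) 362880 11 32,
  z 34571802010101 (-307) 362880 (-19) 32, z 35471208010101 (-307) 362880 (-19) 32,
  w 57181216040101 1 720, w 67150802030101 (-1) 720, z 45121816030101 (-43) 7560 4 1,
  z 56140208030101 43 7560 (-4) 1, z 48151612030101 (-1013) 36288 287 16,
  z 58140603020101 1013 36288 (-287) 16, z 38461712010101 (-1) 45360 13 8,
  z 38560207010101 (-1) 45360 13 8, z 48121516030101 4703 181440 (-273) 16,
  z 58140206030101 (-4703) 181440 273 16, z 57161218040101 (-29) 4536 23 4,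
  z 67150302080101 29 4536 (-23) 4, z 38561207010101 29 15120 7 16,
  z 38461702010101 29 15120 7 16, z 48151612070101 (-17) 7560 3 4,
  z 58170603020101 17 7560 (-3) 4, w 38561712010101 1 864, w 38460207010101 1 864,
  w 48161512070101 (-1) 540, w 58170306020101 1 540, w 34151612080101 (-1) 1890,
  w 45180603020101 1 1890, w 38561702010101 (-1) 864, w 38461207010101 (-1) 864,
  z 67581312040101 (-7627) 362880 443 32, z 48671503020101 7627 362880 (-443) 32,
  z 46573812010101 (-479) 181440 39 16, z 46573802010101 (-479) 181440 39 16,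
  z 57481613020101 827 30240 (-569) 32, z 68571204030101 (-827) 30240 569 32,
  z 38171216040501 (-97) 3360 319 16, z 58161704020301 (-97) 3360 319 16,
  z 57681314020101 493 120960 (-21) 8, z 58471206030101 (-493) 120960 21 8,
  z 58461713020101 (-4901) 725760 143 32, z 67451208030101 (-4901) 725760 143 32,
  z 68451712030101 (-7157) 725760 203 32, z 56471208030101 7157 725760 (-203) 32,
  z 18151716020304 (-281) 120960 29 16, z 16151708030204 281 120960 (-29) 16,
  z 48561312070101 (-53) 20736 29 16, z 58461703020101 (-53) 20736 29 16,
  z 45121716080301 (-481) 725760 1 4, z 67181502040301 (-481) 725760 1 4,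
  w 14181517030201 (-1) 540, w 15140608070301 (-1) 540, w 18171602030401 (-1) 432,
  w 15171608030401 (-1) 432, w 15121807040301 (-1) 2160, w 16151307080401 (-1) 2160,
  z 17161503020401 731 90720 (-105) 16, z 13151207040601 47 18144 (-31) 16,
  z 16121507040301 (-643) 90720 17 4, z 15121607030401 (-643) 90720 17 4, w 37161814150101 1 945,
  w 37060804050101 (-1) 945, w 16181513140201 (-1) 945, w 13070806040501 (-1) 945,
  z 45271816130101 1021 103680 (-55) 8, z 45270806030101 (-1021) 103680 55 8,
  z 57241816130101 (-3659) 725760 57 16, z 57240806030101 3659 725760 (-57) 16,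
  z 47181516030101 199 90720 5 8, z 57140806030101 (-199) 90720 (-5) 8,
  z 35161718040101 41 181440 1 16, z 56140807030101 41 181440 1 16,
  z 78161214150301 263 362880 (-7) 16, z 38140702050601 263 362880 (-7) 16,
  z 67151814030101 (-37) 22680 2 1, z 37140608050101 37 22680 (-2) 1,
  z 38161714150201 25 5184 (-25) 8, z 48120703050601 25 5184 (-25) 8,
  z 14171518030201 (-853) 120960 53 16, z 15140603070801 (-853) 120960 53 16,
  z 37151618120401 (-3131) 725760 3 1, z 35140706080201 3131 725760 (-3) 1,
  z 34161518170201 3229 725760 (-47) 16, z 45120706080301 3229 725760 (-47) 16,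
  w 46181517030101 67 45360, w 35140806070101 67 45360, z 14181517020301 (-1483) 362880 21 16,
  z 15140806070301 (-1483) 362880 21 16, z 14181516070301 (-157) 90720 1 2,
  z 15120608070301 (-157) 90720 1 2, z 48151617030101 199 45360 (-19) 8,
  z 58140603070101 (-199) 45360 19 8, z 48271613150101 (-7) 1728 3 1,
  z 48270603050101 7 1728 (-3) 1, z 46151817030101 31 45360 (-7) 16,
  z 35140608070101 31 45360 (-7) 16, z 37181516120401 3961 725760 (-27) 8,
  z 35140608070201 (-3961) 725760 27 8, z 15141817020301 2123 362880 (-65) 16,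
  z 15140706030801 2123 362880 (-65) 16, z 34151816170201 5011 725760 (-37) 8,
  z 45120608070301 5011 725760 (-37) 8, z 15171314020601 (-239) 30240 5 1,
  z 14120703050601 (-239) 30240 5 1, z 17141518030601 37 17280 (-35) 16,
  z 15120306070801 37 17280 (-35) 16, z 58241613170101 461 145152 (-31) 16,
  z 58240603070101 (-461) 145152 31 16, z 45281613170101 733 145152 (-29) 8,
  z 45280603070101 (-733) 145152 29 8, z 34151617080101 1 1890 3 4,
  z 45180603070101 (-1) 1890 (-3) 4, z 38151614070101 (-13) 4320 5 4,
  z 48170603050101 13 4320 (-5) 4, z 37151216180401 13 4480 (-7) 4,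
  z 35140206070801 (-13) 4480 7 4, z 34151716180201 (-17) 9072 5 4,
  z 45120603070801 (-17) 9072 5 4, z 36151814070101 (-149) 45360 13 16,
  z 34170608050101 (-149) 45360 13 16, z 15171314020801 (-97) 51840 7 16,
  z 14180703050601 (-97) 51840 7 16, z 15181314070201 7 8640 (-5) 8,
  z 13140708050601 7 8640 (-5) 8, z 16181513140207 281 362880 (-11) 16,
  z 14120803070506 (-281) 362880 11 16, z 46251317180101 (-71) 362880 3 16,
  z 56240803070101 71 362880 (-3) 16, z 34181516070101 (-11) 8640 (-9) 16,
  z 45170806030101 11 8640 9 16, z 18161704020301 (-131) 12960 25 8,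
  z 15161704080301 (-131) 12960 25 8, z 15121807030401 37 25920 (-15) 8,
  z 15161307080401 37 25920 (-15) 8, z 18121604070301 55 72576 (-11) 16,
  z 16151307040801 55 72576 (-11) 16, z 38141506070101 (-19) 60480 (-3) 8,
  z 57181306040101 19 60480 3 8, z 13151207040801 (-199) 120960 19 16,
  z 15181307040601 (-199) 120960 19 16, z 13181207040601 (-191) 90720 1 1,
  z 14151307080601 (-191) 90720 1 1, z 57161304080101 37 181440 1 8,
  z 38151706040101 (-37) 181440 (-1) 8, w 35161704080101 (-13) 2520,
  z 16121704080301 (-163) 36288 7 4, z 16181507040301 (-163) 36288 7 4,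
  z 16121807040301 (-61) 45360 3 8, z 13151607080401 (-61) 45360 3 8,
  z 37161508040101 (-149) 30240 3 8, z 57181604030101 149 30240 (-3) 8,
  z 15121604080301 13 7560 (-5) 2, z 15181607030401 13 7560 (-5) 2,
  z 18121607030401 59 20160 (-2) 1, z 13151604070801 59 20160 (-2) 1,
  z 36171508040101 (-703) 120960 (-1) 8, z 35161708040101 (-703) 120960 (-1) 8,
  z 56171308040101 47 90720 (-1) 16, z 34181506070101 (-47) 90720 1 16,
  z 13161207080401 1 1440 (-3) 8, z 13151807040601 1 1440 (-3) 8,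
  z 36141507080101 (-967) 362880 (-1) 4, z 35181706040101 (-967) 362880 (-1) 4,
  z 38471612050101 (-599) 120960 57 16, z 68271503040101 599 120960 (-57) 16,
  z 36151718040201 1091 725760 (-7) 8, z 35161207040801 (-1091) 725760 7 8,
  z 68151714030201 (-4343) 362880 65 8, z 38151207040601 (-4343) 362880 65 8,
  z 67151812030401 97 290304 (-15) 32, z 34151607080201 97 290304 (-15) 32,
  z 47181516020301 5129 1451520 (-75) 32, z 35161207080401 (-5129) 1451520 75 32,
  z 36151214070801 13 45360 (-1) 4, z 35141807020601 (-13) 45360 1 4,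
  z 68151214070301 17 16128 (-9) 16, z 38141507020601 17 16128 (-9) 16,
  z 46121518070301 (-3019) 1451520 45 32, z 36141502070801 3019 1451520 (-45) 32,
  z 38151714020601 (-379) 725760 5 16, z 58121307040601 (-379) 725760 5 16,
  z 38461517020101 (-205) 290304 9 32, z 38451206070101 (-205) 290304 9 32,
  z 34171518020601 (-181) 161280 25 32, z 56121307040801 181 161280 (-25) 32,
  z 35671814020101 169 483840 (-1) 32, z 48251306070101 (-169) 483840 1 32,
  z 18141516020307 (-23) 362880 (-3) 16, z 15121607030804 23 362880 3 16,
  z 18141516070203 (-19) 10368 17 16, z 16121507040803 19 10368 (-17) 16,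
  z 38461512070101 1573 1451520 (-29) 32, z 45271806030101 1573 1451520 (-29) 32,
  z 36471512080101 751 207360 (-87) 32, z 58241706030101 (-751) 207360 87 32,
  z 38561712040101 (-2939) 1451520 61 32, z 46271508030101 (-2939) 1451520 61 32,
  z 46181712050301 451 145152 (-23) 16, z 36171508040201 (-451) 145152 23 16,
  z 36171512040801 (-2689) 1451520 9 8, z 35161804070201 2689 1451520 (-9) 8,
  z 34171516020801 271 290304 (-5) 8, z 56181207030401 (-271) 290304 5 8,
  z 36571812040101 29 23040 (-13) 32, z 67241508030101 (-29) 23040 13 32,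
  z 45181716020301 (-1243) 725760 19 16, z 67121508040301 (-1243) 725760 19 16,
  z 35471216080101 19 32256 (-3) 8, z 68251704030101 (-19) 32256 3 8,
  z 38451612070101 (-1241) 1451520 3 8, z 56271803040101 (-1241) 1451520 3 8,
  z 46121718050301 (-899) 241920 45 16, z 36171502040801 899 241920 (-45) 16,
  z 15141716030201 (-1583) 90720 23 2, z 15140706030201 (-1583) 90720 23 2,
  z 38161512170401 1807 120960 (-39) 4, z 58140706030201 1807 120960 (-39) 4,
  z 36171204080101 (-479) 362880 (-3) 2, z 36171502080101 (-479) 362880 (-3) 2,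
  w 46151812070101 (-409) 181440, w 35170608020101 (-409) 181440, w 56121718030101 1 720,
  w 36150702080101 1 720, w 35161718020101 (-1) 4320, w 56120807030101 (-1) 4320,
  z 15141716080201 (-149) 60480 5 4, z 18140706030201 (-149) 60480 5 4, w 46181512070101 (-1) 540,
  w 35170806020101 (-1) 540, w 34161512170801 1 1890, w 45180706030201 (-1) 1890,
  w 36171208040101 (-1) 720, w 46171502080101 (-1) 720, w 34171608020101 (-1) 4320,
  w 56171208040101 1 4320, w 36141207080101 1 540, w 45171806020101 1 540,
  z 15141816070301 (-29) 36288 1 2, z 15120607030801 (-29) 36288 1 2, w 14181516070201 (-1) 1440,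
  w 15120806070301 (-1) 1440, w 15121704080301 (-1) 1440, w 18151607030401 (-1) 1440,
  w 13151207080401 1 1440, w 15181207040601 1 1440, z 35481617020101 1349 1451520 (-11) 16,
  z 36571204080101 (-1349) 1451520 11 16, z 48151716020301 1961 103680 (-199) 16,
  z 68121507040301 1961 103680 (-199) 16, z 38461712050101 4237 483840 (-45) 8,
  z 46271503080101 4237 483840 (-45) 8, z 46121817050301 14659 1451520 (-197) 32,
  z 36171502080401 (-14659) 1451520 197 32, z 78151216040301 10153 725760 (-37) 4,
  z 38161502070401 10153 725760 (-37) 4, z 34171816020501 2495 290304 (-187) 32,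
  z 56121704080301 2495 290304 (-187) 32, z 38671512040101 593 72576 (-175) 32,
  z 48271506030101 (-593) 72576 175 32, z 38471516020101 (-707) 51840 289 32,
  z 38571206040101 707 51840 (-289) 32, z 35681217040101 (-9907) 1451520 153 32,
  z 47251608030101 9907 1451520 (-153) 32, z 68151712040301 (-4519) 725760 71 16,
  z 38161507040201 (-4519) 725760 71 16, z 38451617020101 (-6407) 1451520 105 32,
  z 37561208040101 (-6407) 1451520 105 32, z 38151716040201 479 241920 (-15) 16,
  z 58121607030401 479 241920 (-15) 16, z 36451812070101 (-37) 15120 45 32,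
  z 56241708030101 37 15120 (-45) 32, z 34171516080201 787 725760 (-17) 16,
  z 56181207040301 (-787) 725760 17 16, z 47121516080301 2243 725760 (-29) 16,
  z 35161807020401 (-2243) 725760 29 16, z 35461217080101 (-17) 40320 15 32,
  z 46251708030101 (-17) 40320 15 32, z 35461817020101 (-299) 362880 1 8,
  z 36451207080101 (-299) 362880 1 8, z 15141617080302 347 90720 (-5) 2,
  z 16121508070403 (-347) 90720 5 2, z 34151816070201 (-7801) 1451520 113 32,
  z 56121307080401 (-7801) 1451520 113 32, z 46151812070301 (-1303) 483840 55 32,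
  z 36141507080201 1303 483840 (-55) 32, z 36151712040801 (-89) 60480 1 4,
  z 35161807040201 89 60480 (-1) 4, z 35671214080101 1 90720 (-1) 4,
  z 48251706030101 (-1) 90720 1 4, z 46181512070301 (-157) 181440 1 4,
  z 36141508070201 157 181440 (-1) 4, z 47151816020301 (-313) 90720 41 16,
  z 35161208070401 313 90720 (-41) 16, z 36471812050101 (-23) 6480 21 8,
  z 67241503080101 23 6480 (-21) 8, z 35471816020101 73 24192 (-19) 8,
  z 36571208040101 (-73) 24192 19 8, z 46121517080301 1427 362880 (-83) 32,
  z 36181502070401 (-1427) 362880 83 32, z 46151712080301 (-799) 181440 81 32,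
  z 36181507040201 799 181440 (-81) 32, z 67151214030801 3701 1451520 (-59) 32,
  z 34151807020601 3701 1451520 (-59) 32, z 67151218030401 (-19) 11520 19 16,
  z 34151607020801 (-19) 11520 19 16, z 36171518040201 (-419) 241920 19 16,
  z 35161204070801 419 241920 (-19) 16, z 36151714080201 (-607) 207360 51 32,
  z 35181207040601 607 207360 (-51) 32, z 15181314070206 143 362880 (-3) 16,
  z 13151208040607 (-143) 362880 3 16, z 36151814070201 191 181440 (-1) 2,
  z 35141207080601 (-191) 181440 1 2, z 45273816010101 (-1429) 362880 45 16,
  z 35482607010101 (-1429) 362880 45 16, z 48121516070301 11 8640 (-3) 4,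
  z 58161307020401 11 8640 (-3) 4, z 34171812050601 1 896 (-3) 4, z 56171304080201 1 896 (-3) 4,
  z 38171512040601 217 17280 (-67) 8, z 58161304070201 217 17280 (-67) 8,
  z 15171314080601 13 22680 (-1) 2, z 18120703050601 13 22680 (-1) 2, w 57241618130101 (-1) 1890,
  w 57240608030101 1 1890, w 37161214150801 (-1) 1890, w 34180702050601 1 1890,
  z 34171512080601 (-13) 45360 1 4, z 56181307040201 13 45360 (-1) 4, w 13020101010101 (-1) 720,
  w 14180201010101 1 108, w 13020801010101 (-1) 108, w 34121801010101 1 540,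
  w 34020801010101 (-1) 540, w 34120801010101 1 1080, w 34180201010101 1 1080,
  w 38270101010101 1 1080, w 15140308010101 1 72, w 15180302010101 1 72,
  w 35141802010101 (-1) 2880, w 34120508010101 1 2880, w 34271801010101 (-1) 480,
  w 34270801010101 1 480, w 34151208010101 (-1) 360, w 45180302010101 (-1) 360,
  w 15181702010101 (-1) 108, w 15080702010101 (-1) 108, w 14180207010101 1 54,
  w 14161518030101 (-1) 270, w 14050206080101 1 270, w 35121718010101 (-1) 270,
  w 45080702010101 1 270, w 16181504030101 (-1) 90, w 16150308020101 1 90,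
  w 35121708010101 (-1) 540, w 34180207010101 1 540, w 13151608040101 (-1) 540,
  w 18140306020101 1 540, w 45171802010101 (-1) 540, w 35120807010101 1 540,
  w 48151703010101 (-1) 108, w 58140307010101 (-1) 108, w 38271601010101 (-1) 540,
  w 38270601010101 1 540, w 18121504030101 (-1) 540, w 15140306080101 1 540,
  w 34121708010101 1 270, w 45180207010101 1 270, w 17181504030101 (-1) 108,
  w 16140307080101 1 108, w 17151608040101 (-1) 108, w 17140308020101 1 108,
  z 34571208010101 (-11) 25920 3 2, z 35471802010101 (-11) 25920 3 2, w 57161218030101 1 540,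
  w 67140302080101 (-1) 540, w 35471812010101 1 540, w 34580207010101 1 540,
  w 48161512030101 (-1) 540, w 58140306020101 1 540, w 67121504080101 11 8640,
  w 37181504020101 (-11) 8640, w 68121504030101 1 864, w 38161504020101 (-1) 864,
  w 34151216180101 1 945, w 34050206080101 (-1) 945, z 36151814020101 53 90720 (-3) 4,
  z 34120608050101 53 90720 (-3) 4, z 38251714010101 17 90720 (-3) 8,
  z 34280507010101 17 90720 (-3) 8, z 35241718010101 1 360 (-9) 8, z 35240708010101 1 360 (-9) 8,
  z 36121508040101 377 181440 (-3) 2, z 35161802040101 377 181440 (-3) 2,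
  z 34271508010101 (-11) 5040 (-3) 8, z 35271804010101 (-11) 5040 (-3) 8,
  z 35241807010101 13 6480 (-15) 8, z 35121806040101 11 36288 (-3) 4,
  z 36141508020101 11 36288 (-3) 4, z 34121506080101 (-53) 90720 3 4,
  z 56181304020101 (-53) 90720 3 4, w 45181612030101 1 420, w 56140803020101 (-1) 420,
  w 17141516030201 (-1) 540, w 14150603070201 (-1) 540, w 35121718040101 (-1) 540,
  w 56140807020101 (-1) 540, w 67451312180101 1 1890, w 67450302080101 (-1) 1890,
  w 34151216080101 1 1890, w 45180602030101 (-1) 1890, w 45161812070101 1 540,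
  w 56170308020101 (-1) 540, w 36181704020101 (-1) 1080, w 36121507080101 (-1) 1080,
  w 38271604010101 (-1) 1080, w 38271506010101 (-1) 1080, w 36171508020101 (-1) 1080,
  w 36121704080101 (-1) 1080, w 17151603020401 (-1) 432, w 16121504070301 (-1) 2160,
  w 46181517020101 1 4320, w 35120806070101 1 4320, w 38251716010101 1 720,
  w 35270806010101 1 720, w 48161517030101 1 540, w 58140306070101 (-1) 540,
  w 58241316170101 (-1) 1890, w 58240306070101 1 1890, w 17141518030201 (-1) 540,
  w 15140306070801 (-1) 540, w 34151216170801 1 1890, w 45180602070301 1 1890,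
  w 45181612070101 1 540, w 56170803020101 (-1) 540, w 17141516080201 (-1) 540,
  w 18140306070201 (-1) 540, w 46151218030101 (-1) 1890, w 35140602080101 (-1) 1890,
  w 67181504030101 7 2160, w 37161504080101 (-7) 2160, w 18171604020301 (-43) 8640,
  w 15171604080301 (-43) 8640, w 36141708020101 (-1) 4320, w 45181206070101 (-1) 4320,
  w 34261807010101 (-1) 720, w 35261807010101 (-1) 720, w 16121504080301 (-19) 8640,
  w 16181504070301 (-19) 8640, w 18121504070301 (-1) 4320, w 13151607040801 (-1) 4320,
  w 36171504080101 (-23) 4320, w 34121607080101 1 540, w 56181704020101 1 540,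
  z 56481712030101 1 25920 1 8, z 67451203080101 1 25920 1 8, w 18151716020403 1 2880,
  w 16151708020304 (-1) 2880, z 56481713020101 (-13) 10080 15 16,
  z 46571208030101 (-13) 10080 15 16, z 57482316010101 (-7) 1920 25 16,
  z 34275806010101 7 1920 (-25) 16, z 36481517020101 29 22680 (-9) 8,
  z 34571206080101 (-29) 22680 9 8, z 35671812040101 (-7) 5184 3 8,
  z 47251603080101 7 5184 (-3) 8, w 68171512040301 1 8640, w 38161504070201 1 8640,
  w 48171516020301 1 4320, w 68121504070301 1 4320, z 46181217050301 17 13440 (-7) 8,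
  z 36171508020401 (-17) 13440 7 8, z 68451213070101 1 90720 (-1) 4,
  z 48561703020101 1 90720 (-1) 4, z 34171216080501 89 60480 (-1) 4,
  z 56181704020301 89 60480 (-1) 4, w 38171216050401 1 1440, w 58171604020301 1 1440,
  z 35471612080101 17 15120 (-3) 8, z 68251703040101 (-17) 15120 3 8, w 38571612040101 1 1728,
  w 68271504030101 (-1) 1728, z 37161814150201 (-7) 17280 5 16, z 34120708050601 7 17280 (-5) 16,
  z 34271618150101 (-31) 30240 15 16, z 34270608050101 31 30240 (-15) 16,
  z 34251816170101 (-179) 181440 11 16, z 34250806070101 179 181440 (-11) 16,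
  z 46181517020301 61 90720 (-3) 16, z 36121508070401 (-61) 90720 3 16,
  z 35261817040101 23 181440 3 8, z 34251607080101 (-23) 181440 (-3) 8,
  z 38251716040101 (-1) 40320 3 4, z 37251604080101 1 40320 (-3) 4,
  z 67151814030201 191 181440 (-1) 2, z 34151207080601 191 181440 (-1) 2,
  z 34171218050601 157 181440 (-1) 4, z 56171304020801 157 181440 (-1) 4,
  z 38261517040101 319 181440 (-15) 16, z 38241506070101 (-319) 181440 15 16,
  z 46151718020301 (-59) 40320 1 1, z 36121507040801 59 40320 (-1) 1,
  z 35261814070101 (-11) 24192 3 16, z 34251806070101 11 24192 (-3) 16,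
  z 36151714020801 (-1) 2880 3 16, z 35121807040601 1 2880 (-3) 16,
  z 35241617080101 121 90720 (-1) 8, z 35261708040101 (-121) 90720 1 8,
  z 38251614070101 (-353) 362880 5 8, z 38251706040101 353 362880 (-5) 8,
  w 35461812070101 409 362880, w 46251703080101 409 362880, w 46171812050301 1 1440,
  w 36171504080201 (-1) 1440, w 45171816020301 1 8640, w 67121504080301 1 8640,
  z 47151216080301 (-149) 120960 5 8, z 35161802070401 149 120960 (-5) 8,
  w 46171512080301 (-1) 1080, w 36181504070201 1 1080, z 46151218070301 (-29) 72576 1 4,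
  z 36141507020801 29 72576 (-1) 4, w 18141516070302 (-1) 2880, w 16121504070803 1 2880,
  z 34151216070801 (-13) 45360 1 4, z 56181307020401 (-13) 45360 1 4, w 15140302010101 1 432,
  w 18161504030101 (-1) 216, w 16150803020101 1 216, w 45161812030101 1 540,
  w 56140308020101 (-1) 540, w 36121504080101 (-1) 1080, w 36181504020101 (-1) 1080,
  w 38271504010101 (-1) 1080, w 15171608040301 (-1) 432, w 18171602040301 (-1) 432,
  w 46171518020301 1 8640, w 36121504070801 (-1) 8640, w 38251617040101 1 1440,
  w 37251608040101 (-1) 1440, w 45171216080301 (-1) 1080, w 67181504020301 (-1) 1080,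
  w 17161504030201 (-1) 1296]

/-- The rows of `⋆_aff` at order `ħ^n`, `n ≤ 7`. -/
def affRows : ℕ → List Row
  | 0 => affRows0
  | 1 => affRows1
  | 2 => affRows2
  | 3 => affRows3
  | 4 => affRows4
  | 5 => affRows5
  | 6 => affRows6
  | 7 => affRows7
  | _ => []

def redRows0 : List Row := [
  w 0 1 1]

def redRows1 : List Row := [
  w 1 1 1]

def redRows2 : List Row := [
  w 1302 (-1) 6, w 1301 (-1) 3, w 301 1 3, w 101 1 2]

def redRows3 : List Row := [
  w 130201 (-1) 6, w 140201 (-1) 3, w 140101 (-1) 3, w 40101 1 3, w 10101 1 6]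

def redRows4 : List Row := [
  w 15140302 1 72, w 13140502 (-2) 45, w 15140203 11 180, w 15140301 1 18, w 13150201 (-2) 45,
  w 13140501 2 15, w 14050201 (-1) 18, w 13040501 2 45, w 15040201 (-2) 15, w 13020101 (-1) 12,
  w 15020101 (-1) 3, w 15040101 (-1) 9, w 15010101 (-1) 6, w 5010101 1 6, w 1010101 1 24,
  w 15140101 1 18, w 5040101 1 18, w 14151301 1 45, w 4050301 (-1) 45, w 14151302 1 90,
  w 13050204 1 90]

def redRows5 : List Row := [
  w 1412050301 1 60, w 3416050101 2 15, w 1612050301 2 45, w 1314050601 2 45, w 1514030601 1 18,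
  w 3416020101 11 360, w 1514030201 1 72, w 1316020101 (-2) 45, w 1314060101 2 15,
  w 1415060101 1 9, w 1416020101 1 18, w 1304060101 2 45, w 1604020101 (-2) 15,
  w 1506020101 (-1) 9, w 1406020101 (-1) 18, w 1602010101 (-1) 6, w 1605010101 (-1) 9,
  w 1302010101 (-1) 36, w 1415130201 1 90, w 1514160301 2 45, w 1416150301 (-1) 45,
  w 1305020401 1 90, w 1405060201 (-1) 45, w 1402050601 2 45, w 101010101 1 120,
  w 1601010101 (-1) 18, w 601010101 1 18, w 1615010101 1 18, w 605010101 1 18, w 1416130101 1 45,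
  w 406030101 (-1) 45]

def redRows6 : List Row := [
  w 141713060205 (-2) 567, w 351716040201 (-31) 3780, w 171415060302 (-1) 360,
  w 351216040701 (-7) 1620, w 451612070301 (-11) 2160, w 171615040302 (-1) 1296,
  w 141617030201 4 315, w 461715030101 (-2) 105, w 161417030501 (-2) 315, w 141715060201 (-1) 180,
  w 141715060301 (-4) 105, w 141613070201 1 270, w 141613070501 2 135, w 461517030101 (-1) 45,
  w 372615010101 (-11) 1080, w 161417030201 (-2) 135, w 171615040301 (-1) 216,
  w 151406030701 (-4) 315, w 561407030101 (-2) 105, w 151203060701 2 315, w 151207060301 1 180,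
  w 151206070301 4 105, w 171406030501 (-1) 270, w 171206030501 (-2) 135, w 561403070101 (-1) 45,
  w 372605010101 11 1080, w 151403060701 2 135, w 161507030201 1 216, w 141205030101 1 120,
  w 341706010101 2 45, w 151407030101 2 45, w 171503020101 2 45, w 151603070101 1 18,
  w 371605010101 2 45, w 471605010101 (-2) 45, w 161207030101 4 135, w 171405060101 4 135,
  w 372601010101 11 720, w 171403020101 1 18, w 161507030101 1 54, w 151403020101 1 144,
  w 151713140206 (-1) 378, w 361512140701 (-31) 11340, w 171415160302 (-1) 540,
  w 352416170101 1 567, w 141207030506 (-1) 378, w 341706020501 (-31) 11340,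
  w 141506030702 (-1) 540, w 352406070101 1 567, w 170601010101 (-1) 18, w 130201010101 (-1) 144,
  w 130701010101 (-1) 18, w 371601010101 1 15, w 131702010101 2 45, w 141607010101 1 9,
  w 171605010101 1 54, w 141702010101 1 36, w 370601010101 1 15, w 130407010101 (-2) 45,
  w 170206010101 (-1) 9, w 170605010101 (-1) 54, w 130207010101 (-1) 36, w 141513020101 1 180,
  w 451617010101 (-2) 45, w 171416030101 (-4) 135, w 141713060101 1 135, w 151716020101 (-1) 108,
  w 151417030101 2 45, w 141715030101 (-1) 45, w 130502040101 1 180, w 470605010101 2 45,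
  w 140705060101 (-4) 135, w 160507040101 1 135, w 150706020101 (-1) 108, w 140507020101 (-1) 45,
  w 140205070101 2 45, w 171415160301 (-1) 270, w 141615170301 (-1) 270, w 361517140101 (-2) 315,
  w 151417160301 (-4) 315, w 140705060201 1 270, w 140502060701 1 270, w 360507040101 (-2) 315,
  w 140605070201 4 315, w 10101010101 1 720, w 170101010101 (-1) 72, w 70101010101 1 72,
  w 171601010101 1 36, w 70601010101 1 36, w 141713010101 1 90, w 171615010101 (-1) 162,
  w 40703010101 (-1) 90, w 70605010101 1 162, w 161715131401 (-2) 945, w 60705030401 2 945,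
  w 171415160101 (-1) 135, w 70405060101 (-1) 135, w 161715131402 (-1) 945,
  w 130702060405 (-1) 945]

def redRows7 : List Row := [
  w 16151307080401 (-1) 180, w 13151207040601 53 11340, w 15121607030401 (-31) 3780,
  w 13151604070801 2 135, w 13161207080401 (-8) 945, w 13151807040601 (-29) 945,
  w 36141507080101 (-46) 945, w 35181706040101 (-32) 945, w 36171502080101 8 315,
  w 36141508020101 (-191) 22680, w 36121704080101 (-11) 1080, w 16121504070301 (-1) 360,
  w 18121504070301 (-1) 135, w 13151607040801 (-1) 135, w 36171504080101 (-1) 45,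
  w 38271504010101 (-11) 2160, w 18171602040301 (-1) 216, w 17161504030201 (-1) 1296,
  w 48263701010101 31 22680, w 35141706080101 (-16) 945, w 45261807010101 16 945,
  w 14180207010101 1 54, w 15140302010101 1 432, w 15140203010101 1 360, w 38140201010101 1 135,
  w 15180304010101 1 15, w 13140508010101 (-1) 45, w 15180307010101 1 18, w 17180503010101 4 135,
  w 48170601010101 (-2) 135, w 38170601010101 2 135, w 13150708010101 4 135,
  w 15170806010101 1 27, w 15140308010101 1 36, w 18121604030101 4 315, w 38151704010101 (-2) 105,
  w 13151806040101 (-2) 105, w 13141506080101 8 945, w 16151308040101 (-2) 105,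
  w 48151607010101 (-2) 45, w 17151208040101 (-4) 135, w 13161208040101 1 270,
  w 18151306040101 (-1) 180, w 17181306040101 (-1) 135, w 45171806010101 (-1) 45,
  w 17151604080101 (-1) 45, w 48151703010101 (-1) 45, w 38271601010101 (-11) 1080,
  w 18121504030101 (-2) 135, w 17151608040101 (-1) 54, w 18161504030101 (-1) 216,
  w 17161208040101 2 135, w 13161708040101 (-1) 135, w 15140603080101 (-4) 315,
  w 48150307010101 (-2) 105, w 15120608030101 2 105, w 18120603050101 (-8) 945,
  w 18150306020101 2 105, w 58170306010101 (-2) 45, w 15180306070101 4 135,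
  w 18140603050101 (-1) 270, w 15120806030101 1 180, w 13150806070101 1 135,
  w 35180706010101 1 45, w 17160308020101 1 45, w 58140307010101 (-1) 45,
  w 38270601010101 11 1080, w 15140306080101 2 135, w 17140308020101 1 54, w 16150803020101 1 216,
  w 17150608030101 1 135, w 18150306070101 (-2) 135, w 14181517030201 (-1) 270,
  w 15171314020601 11 7560, w 17141518030601 (-2) 315, w 15171314020801 (-4) 315,
  w 34181516070101 (-4) 315, w 15141716030201 (-31) 7560, w 15141816070301 8 945,
  w 15171314080601 (-2) 945, w 17141516030201 (-1) 540, w 46151218030101 (-37) 15120,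
  w 17151618040301 (-1) 135, w 17151816040201 1 270, w 15140608070301 (-1) 270,
  w 14120703050601 11 7560, w 15120306070801 (-2) 315, w 14180703050601 (-4) 315,
  w 45170806030101 4 315, w 15140706030201 (-31) 7560, w 15120607030801 8 945,
  w 18120703050601 (-2) 945, w 14150603070201 (-1) 540, w 35140602080101 (-37) 15120,
  w 16150708020301 1 270, w 16150307020801 (-1) 135, w 18020101010101 (-1) 72,
  w 18070101010101 (-1) 54, w 13020101010101 (-1) 720, w 38170101010101 1 45,
  w 13180201010101 2 135, w 14170801010101 1 18, w 18170601010101 1 54, w 14180201010101 1 108,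
  w 38070101010101 1 45, w 13040801010101 (-2) 135, w 18020701010101 (-1) 18,
  w 18070601010101 (-1) 54, w 13020801010101 (-1) 108, w 14151302010101 1 540,
  w 46171801010101 (-2) 45, w 14171802010101 (-4) 135, w 13141708010101 1 135,
  w 15181706010101 (-1) 54, w 15181702010101 (-1) 108, w 15141803010101 1 45,
  w 13151804010101 (-1) 90, w 13050204010101 1 540, w 48070601010101 2 45,
  w 14080507010101 (-4) 135, w 17050804010101 1 135, w 16080702010101 (-1) 54,
  w 15080702010101 (-1) 108, w 14050802010101 (-1) 90, w 14020508010101 1 45,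
  w 15181314020101 2 315, w 18141516030101 (-1) 270, w 14161517080101 (-1) 135,
  w 14151618030101 (-2) 105, w 14161518030101 (-1) 270, w 18161517040101 (-2) 135,
  w 15171816040101 1 135, w 48121517010101 2 315, w 13060804050101 (-2) 315,
  w 14080506020101 1 270, w 18050206070101 1 135, w 14060508020101 2 105, w 14050206080101 1 270,
  w 15060708020101 (-1) 135, w 15080206070101 2 135, w 48020507010101 2 315,
  w 16171513140201 (-1) 945, w 17161814150301 (-4) 945, w 34181516170101 2 945,
  w 16141817150301 4 945, w 18161714150201 (-2) 945, w 13070206040501 (-1) 945,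
  w 14020708050601 (-4) 945, w 34080506070101 (-2) 945, w 13080702050601 (-2) 945,
  w 14070508020601 4 945, w 1010101010101 1 5040, w 18010101010101 (-1) 360,
  w 8010101010101 1 360, w 18170101010101 1 108, w 8070101010101 1 108, w 13141801010101 1 270,
  w 18171601010101 (-1) 162, w 3040801010101 (-1) 270, w 8070601010101 1 162,
  w 18141517010101 (-1) 135, w 8040507010101 (-1) 135, w 16181513140101 (-2) 945,
  w 6080503040101 2 945]

/-- The rows of `⋆_aff^red` at order `ħ^n`, `n ≤ 7`; they are rational. -/
def redRows : ℕ → List Row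
  | 0 => redRows0
  | 1 => redRows1
  | 2 => redRows2
  | 3 => redRows3
  | 4 => redRows4
  | 5 => redRows5
  | 6 => redRows6
  | 7 => redRows7
  | _ => []

/-- All digits are numbers of vertices. -/
theorem row_digits : ∀ n ≤ 7, ∀ r ∈ affRows n ++ redRows n,
    ∀ j < 2 * n, r.graph / 10 ^ j % 10 < n + 2 := by decide +kernel

/-- Decoding of a graph from its decimal digits. -/
def KGraph.ofCode (n code : ℕ) : KGraph n := fun v s =>
  Fin.ofNat (n + 2) (code / 10 ^ (2 * n - 1 - (2 * v.val + s.val)) % 10)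

/-- The graph expansion, modulo `ō(ħ^7)`, of Kontsevich's star-product with harmonic propagators for
affine Poisson brackets: graphs, each with the rational part and the
`ζ(3)² / π⁶`-part of its coefficient. -/
def starAff (n : ℕ) : List (KGraph n × ℚ × ℚ) :=
  (affRows n).map fun r => (KGraph.ofCode n r.graph, r.rat, r.zeta)

/-- The rational part of `⋆_aff`. -/
def starAffRat (n : ℕ) : List (KGraph n × ℚ) := (starAff n).map fun t => (t.1, t.2.1)

/-- The `ζ(3)² / π⁶`-part of `⋆_aff`. -/
def starAffZeta (n : ℕ) : List (KGraph n × ℚ) := (starAff n).map fun t => (t.1, t.2.2)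

/-- The graph expansion of `⋆_aff^red`. -/
def starRed (n : ℕ) : List (KGraph n × ℚ) :=
  (redRows n).map fun r => (KGraph.ofCode n r.graph, r.rat)

/-- The real number `ζ(3)² / π⁶`. -/
noncomputable def zetaConst : ℝ := (riemannZeta 3).re ^ 2 / Real.pi ^ 6

/-- The operators of `⋆_aff` for the bi-vector `P`. -/
noncomputable def starAffOps {d : ℕ} (P : BivectorField d) : BidiffSeries d :=
  graphOps (fun n => (starAff n).map fun t => (t.1, (t.2.1 : ℝ) + (t.2.2 : ℝ) * zetaConst)) P

/-- The operators encoded by the graphs near `ζ(3)² / π⁶` in `⋆_aff`. -/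
noncomputable def starAffZetaOps {d : ℕ} (P : BivectorField d) : BidiffSeries d :=
  graphOps (fun n => (starAffZeta n).map fun t => (t.1, (t.2 : ℝ))) P

/-- The operators of `⋆_aff^red` for the bi-vector `P`. -/
noncomputable def starRedOps {d : ℕ} (P : BivectorField d) : BidiffSeries d :=
  graphOps (fun n => (starRed n).map fun t => (t.1, (t.2 : ℝ))) P

/-- The listed graphs are pairwise different nonzero affine Kontsevich graphs: no two of them are
related by a relabeling and swaps, and none equals minus itself. -/
def AreDistinctAffineGraphs {n : ℕ} (G : List (KGraph n)) : Prop :=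
  (∀ Γ ∈ G, Γ.IsKontsevich ∧ Γ.IsAffine) ∧
    LinearIndependent ℚ fun i : Fin G.length => graphClass (G.get i)

end AffStar

/-! The claims about graphs are finite linear algebra over ℚ. They are reduced to tests that the
kernel evaluates, and the claims about operators follow because, for an affine bi-vector, the
operator of a graph depends only on the class of the graph.

Independence. Color refinement assigns to the vertices colors that are carried along by relabelings
and unaffected by swaps. The sum of the colors (`KGraph.key`) is therefore an invariant, while the
product of the signs of the color differences Right minus Left (`KGraph.orientation`) is invariant
under relabelings and changes sign under a swap. So the function equal to the orientation on the
affine graphs with a given key, and to zero elsewhere, is a linear functional on the graph space.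
Listed graphs with different keys and nonzero orientations are separated by these functionals
(`linearIndependent_graphClass`). Completeness of the invariant is never needed.

Factorization. The combinations of Leibniz graphs are explicit data, and only an identity in the
graph space has to be verified. In the expansion of a Leibniz graph the lower of the two new wedges
already receives the arrow from the upper one, so in an affine term every arrow that came to the
trident goes to the upper wedge (`LeibnizGraph.expand_eq`): three terms remain. All terms are
replaced by normal forms with signs and grouped by graph. In every group either the coefficients add
up to zero, or the graph has a symmetry with the wrong sign and its class is zero
(`sum_itemClass_eq_zero`). The search for normal forms is not trusted: the isomorphism that it
proposes is tested (`graphClass_of_isIso`), so a poor search could make the verification fail but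
could not make it prove a false identity.

Analysis. At a fixed point the value of the operator respects the three relations: partial
derivatives of smooth functions commute, the bi-vector is skew-symmetric, and second derivatives of
affine functions vanish (`exists_linearMap_op`). Identities between classes thus become identities
between operators. Since first derivatives of the bi-vector are locally constant, derivatives of the
Jacobiator fall only on its undifferentiated factor (`iterPartial_jacobiator`); this matches the
three surviving terms of the expansion and gives `LeibnizGraph.sum_op_expandTerm`. For a Poisson
structure the Jacobiator vanishes on an open set, hence so do its derivatives and all these
operators. -/

namespace AffStar

/-! ### The graph space -/

namespace KGraph

variable {n : ℕ}

@[simp]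
theorem val_aerial (v : Fin n) : (aerial v).val = v.val + 2 := by
  simp [aerial]

theorem aerial_injective : Function.Injective (aerial : Fin n → Fin (n + 2)) := fun a b h => by
  have := congrArg Fin.val h
  simp only [val_aerial] at this
  exact Fin.ext (by omega)

@[simp]
theorem vertexPerm_aerial (σ : Equiv.Perm (Fin n)) (v : Fin n) :
    vertexPerm σ (aerial v) = aerial (σ v) := by
  simp [vertexPerm]

theorem vertexPerm_of_lt (σ : Equiv.Perm (Fin n)) {t : Fin (n + 2)} (h : t.val < 2) :
    vertexPerm σ t = t := by
  simp [vertexPerm, Nat.not_le.2 h]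

theorem eq_aerial_of_two_le {t : Fin (n + 2)} (h : 2 ≤ t.val) :
    ∃ v : Fin n, t = aerial v :=
  ⟨⟨t.val - 2, by omega⟩, Fin.ext (by simp; omega)⟩

theorem vertexPerm_symm_apply (σ : Equiv.Perm (Fin n)) (t : Fin (n + 2)) :
    vertexPerm σ.symm (vertexPerm σ t) = t := by
  rcases Nat.lt_or_ge t.val 2 with h | h
  · rw [vertexPerm_of_lt σ h, vertexPerm_of_lt _ h]
  · obtain ⟨v, rfl⟩ := eq_aerial_of_two_le h
    simp

/-- The permutation of all vertices induced by a permutation of the aerial vertices. -/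
def vertexEquiv (σ : Equiv.Perm (Fin n)) : Equiv.Perm (Fin (n + 2)) where
  toFun := vertexPerm σ
  invFun := vertexPerm σ.symm
  left_inv := vertexPerm_symm_apply σ
  right_inv t := by simpa using vertexPerm_symm_apply σ.symm t

theorem vertexPerm_injective (σ : Equiv.Perm (Fin n)) : Function.Injective (vertexPerm σ) :=
  (vertexEquiv σ).injective

theorem mem_inEdges {Γ : KGraph n} {t : Fin (n + 2)} {e : Fin n × Fin 2} :
    e ∈ Γ.inEdges t ↔ Γ e.1 e.2 = t := by
  simp only [inEdges, List.mem_filter, decide_eq_true_eq, and_iff_right_iff_imp]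
  intro _
  exact List.mem_product.2 ⟨List.mem_finRange _, List.mem_finRange _⟩

theorem nodup_inEdges (Γ : KGraph n) (t : Fin (n + 2)) : (Γ.inEdges t).Nodup :=
  ((List.nodup_finRange n).product (List.nodup_finRange 2)).filter _

/-- An isomorphism of the sets of edges that respects the targets permutes the incoming edges. -/
theorem inEdges_perm_map {m : ℕ} {Γ : KGraph n} {Γ' : KGraph m} {t : Fin (n + 2)}
    {t' : Fin (m + 2)} (e : (Fin n × Fin 2) ≃ (Fin m × Fin 2))
    (h : ∀ a, Γ' (e a).1 (e a).2 = t' ↔ Γ a.1 a.2 = t) :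
    (Γ'.inEdges t').Perm ((Γ.inEdges t).map e) := by
  refine (List.perm_ext_iff_of_nodup (nodup_inEdges _ _)
    ((nodup_inEdges _ _).map e.injective)).2 fun a => ?_
  obtain ⟨a, rfl⟩ := e.surjective a
  rw [mem_inEdges, h, List.mem_map_of_injective e.injective, mem_inEdges]

/-- Relabelings and swaps are both bijections of edges compatible with targets, so being affine is
preserved by both. -/
theorem inDegree_eq_of_equiv {m : ℕ} {Γ : KGraph n} {Γ' : KGraph m} {t : Fin (n + 2)}
    {t' : Fin (m + 2)} (e : (Fin n × Fin 2) ≃ (Fin m × Fin 2))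
    (h : ∀ a, Γ' (e a).1 (e a).2 = t' ↔ Γ a.1 a.2 = t) :
    Γ'.inDegree t' = Γ.inDegree t := by
  simpa [inDegree] using (inEdges_perm_map e h).length_eq

/-- The relabeling of the edges under a relabeling of the aerial vertices. -/
def relabelEdges (σ : Equiv.Perm (Fin n)) : (Fin n × Fin 2) ≃ (Fin n × Fin 2) :=
  σ.prodCongr (Equiv.refl _)

theorem relabel_apply_relabelEdges (σ : Equiv.Perm (Fin n)) (Γ : KGraph n) (t : Fin (n + 2))
    (a : Fin n × Fin 2) :
    Γ.relabel σ (relabelEdges σ a).1 (relabelEdges σ a).2 = vertexPerm σ t ↔ Γ a.1 a.2 = t := by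
  simp [relabelEdges, relabel, (vertexPerm_injective σ).eq_iff]

/-- The transposition of the two edges issued from `v`. -/
def swapEdges (v : Fin n) : (Fin n × Fin 2) ≃ (Fin n × Fin 2) where
  toFun a := (a.1, if a.1 = v then 1 - a.2 else a.2)
  invFun a := (a.1, if a.1 = v then 1 - a.2 else a.2)
  left_inv a := by by_cases h : a.1 = v <;> simp [h, Prod.ext_iff]
  right_inv a := by by_cases h : a.1 = v <;> simp [h, Prod.ext_iff]

theorem swap_apply (v u : Fin n) (s : Fin 2) (Γ : KGraph n) :
    Γ.swap v u s = if u = v then Γ u (1 - s) else Γ u s := by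
  by_cases h : u = v
  · subst h; simp [swap]
  · simp [swap, h]

theorem swap_apply_swapEdges (v : Fin n) (Γ : KGraph n) (t : Fin (n + 2)) (a : Fin n × Fin 2) :
    Γ.swap v (swapEdges v a).1 (swapEdges v a).2 = t ↔ Γ a.1 a.2 = t := by
  by_cases h : a.1 = v <;> simp [swapEdges, swap_apply, h]

theorem isAffine_relabel_iff (σ : Equiv.Perm (Fin n)) (Γ : KGraph n) :
    (Γ.relabel σ).IsAffine ↔ Γ.IsAffine := by
  have key (v : Fin n) : (Γ.relabel σ).inDegree (aerial (σ v)) = Γ.inDegree (aerial v) := by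
    rw [← vertexPerm_aerial]
    exact inDegree_eq_of_equiv (relabelEdges σ) (relabel_apply_relabelEdges σ Γ _)
  refine ⟨fun h v => key v ▸ h (σ v), fun h v => ?_⟩
  obtain ⟨v, rfl⟩ := σ.surjective v
  exact key v ▸ h v

theorem isAffine_swap_iff (v : Fin n) (Γ : KGraph n) : (Γ.swap v).IsAffine ↔ Γ.IsAffine :=
  forall_congr' fun u => by
    rw [inDegree_eq_of_equiv (swapEdges v) (swap_apply_swapEdges v Γ (aerial u))]

end KGraph

variable {n : ℕ}

theorem graphClass_relabel (σ : Equiv.Perm (Fin n)) (Γ : KGraph n) :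
    graphClass (Γ.relabel σ) = graphClass Γ := by
  rw [graphClass, graphClass, ← sub_eq_zero, ← map_sub]
  exact (Submodule.Quotient.mk_eq_zero _).2
    (Submodule.subset_span (.inl (.inl ⟨Γ, σ, rfl⟩)))

theorem graphClass_swap (v : Fin n) (Γ : KGraph n) :
    graphClass (Γ.swap v) = - graphClass Γ := by
  rw [graphClass, graphClass, ← add_eq_zero_iff_eq_neg, ← map_add]
  exact (Submodule.Quotient.mk_eq_zero _).2
    (Submodule.subset_span (.inl (.inr ⟨Γ, v, rfl⟩)))

theorem graphClass_eq_zero {Γ : KGraph n} (h : ¬ Γ.IsAffine) : graphClass Γ = 0 :=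
  (Submodule.Quotient.mk_eq_zero _).2 (Submodule.subset_span (.inr ⟨Γ, h, rfl⟩))

/-- A function of graphs that respects the relations induces a linear map on the graph space. -/
noncomputable def GraphSpace.lift {M : Type*} [AddCommGroup M] [Module ℚ M] (χ : KGraph n → M)
    (hrel : ∀ Γ σ, χ (Γ.relabel σ) = χ Γ) (hswap : ∀ Γ v, χ (Γ.swap v) = - χ Γ)
    (haff : ∀ Γ : KGraph n, ¬ Γ.IsAffine → χ Γ = 0) : GraphSpace n →ₗ[ℚ] M :=
  (graphRelations n).liftQ (Finsupp.linearCombination ℚ χ) <| by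
    rw [graphRelations, Submodule.span_le]
    rintro _ ((⟨Γ, σ, rfl⟩ | ⟨Γ, v, rfl⟩) | ⟨Γ, h, rfl⟩)
    · simp [hrel]
    · simp [hswap]
    · simp [haff Γ h]

@[simp]
theorem GraphSpace.lift_graphClass {M : Type*} [AddCommGroup M] [Module ℚ M] (χ : KGraph n → M)
    (hrel : ∀ Γ σ, χ (Γ.relabel σ) = χ Γ) (hswap : ∀ Γ v, χ (Γ.swap v) = - χ Γ)
    (haff : ∀ Γ : KGraph n, ¬ Γ.IsAffine → χ Γ = 0) (Γ : KGraph n) :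
    GraphSpace.lift χ hrel hswap haff (graphClass Γ) = χ Γ := by
  simp [GraphSpace.lift, graphClass, Submodule.liftQ_apply]

/-- The swap of the edges issued from all the vertices of a set. -/
theorem graphClass_swap_finset (Γ : KGraph n) (S : Finset (Fin n)) :
    graphClass (fun v s => if v ∈ S then Γ v (1 - s) else Γ v s) =
      (-1 : ℚ) ^ S.card • graphClass Γ := by
  induction S using Finset.induction_on with
  | empty => simp
  | insert a S ha ih =>
    have : (fun v s => if v ∈ insert a S then Γ v (1 - s) else Γ v s) =
        KGraph.swap a (fun v s => if v ∈ S then Γ v (1 - s) else Γ v s) := by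
      funext v s
      rw [KGraph.swap_apply]
      by_cases h : v = a
      · subst h; simp [ha]
      · simp [h]
    rw [this, graphClass_swap, ih, Finset.card_insert_of_notMem ha, pow_succ]
    simp

/-- Isomorphic graphs have the same class, up to the sign of the swaps. -/
theorem graphClass_eq_of_iso {Γ Γ' : KGraph n} (σ : Equiv.Perm (Fin n)) (S : Finset (Fin n))
    (h : ∀ v s, Γ' (σ v) s = KGraph.vertexPerm σ (if v ∈ S then Γ v (1 - s) else Γ v s)) :
    graphClass Γ' = (-1 : ℚ) ^ S.card • graphClass Γ := by
  have hΓ : Γ' = KGraph.relabel σ fun v s => if v ∈ S then Γ v (1 - s) else Γ v s := by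
    funext v s
    obtain ⟨v, rfl⟩ := σ.surjective v
    simp [h, KGraph.relabel]
  rw [← graphClass_swap_finset, hΓ, graphClass_relabel]

/-! ### An invariant of graphs -/

/-- A symmetric operation that is used to mix the colors of the two targets of a vertex. -/
def mixColors (a b : ℕ) : ℕ := ((a + b) ^ 2 + a * b + 3) % 2 ^ 256

/-- The symmetry makes the colors insensitive to swaps. The modulus in `mixColors` is the capacity
of a cell in the packed lists below. -/
theorem mixColors_comm (a b : ℕ) : mixColors a b = mixColors b a := by
  simp only [mixColors, Nat.add_comm a b, Nat.mul_comm a b]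

namespace KGraph

/-- The targets of the edges issued from a vertex; a sink is considered as its own target. -/
def out (Γ : KGraph n) (t : Fin (n + 2)) (s : Fin 2) : Fin (n + 2) :=
  if h : 2 ≤ t.val then Γ ⟨t.val - 2, by omega⟩ s else t

theorem out_of_lt (Γ : KGraph n) {t : Fin (n + 2)} (h : t.val < 2) (s : Fin 2) :
    Γ.out t s = t := by simp [out, Nat.not_le.2 h]

@[simp]
theorem out_aerial (Γ : KGraph n) (v : Fin n) (s : Fin 2) : Γ.out (aerial v) s = Γ v s := by
  simp [out]

theorem out_relabel (σ : Equiv.Perm (Fin n)) (Γ : KGraph n) (t : Fin (n + 2)) (s : Fin 2) :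
    (Γ.relabel σ).out (vertexPerm σ t) s = vertexPerm σ (Γ.out t s) := by
  rcases Nat.lt_or_ge t.val 2 with h | h
  · rw [vertexPerm_of_lt σ h, out_of_lt _ h, out_of_lt _ h, vertexPerm_of_lt σ h]
  · obtain ⟨v, rfl⟩ := eq_aerial_of_two_le h
    simp [relabel]

theorem out_swap (v : Fin n) (Γ : KGraph n) (t : Fin (n + 2)) (s : Fin 2) :
    (Γ.swap v).out t s = Γ.out t (if t = aerial v then 1 - s else s) := by
  rcases Nat.lt_or_ge t.val 2 with h | h
  · rw [out_of_lt _ h, out_of_lt _ h]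
  · obtain ⟨u, rfl⟩ := eq_aerial_of_two_le h
    by_cases hu : u = v
    · subst hu; simp [swap_apply]
    · simp [swap_apply, hu, aerial_injective.eq_iff]

/-- The number of ways to return to the vertex `t` in two steps. -/
def returns (Γ : KGraph n) (t : Fin (n + 2)) : ℕ :=
  ∑ s, ∑ r, if Γ.out (Γ.out t s) r = t then 1 else 0

theorem returns_relabel (σ : Equiv.Perm (Fin n)) (Γ : KGraph n) (t : Fin (n + 2)) :
    (Γ.relabel σ).returns (vertexPerm σ t) = Γ.returns t := by
  simp only [returns, out_relabel, (vertexPerm_injective σ).eq_iff]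

theorem sum_out_swap {M : Type*} [AddCommMonoid M] (v : Fin n) (Γ : KGraph n) (t : Fin (n + 2))
    (f : Fin (n + 2) → M) : ∑ s, f ((Γ.swap v).out t s) = ∑ s, f (Γ.out t s) := by
  simp only [out_swap]
  by_cases h : t = aerial v
  · simp [h, add_comm]
  · simp [h]

theorem returns_swap (v : Fin n) (Γ : KGraph n) (t : Fin (n + 2)) :
    (Γ.swap v).returns t = Γ.returns t := by
  simp only [returns]
  rw [sum_out_swap v Γ t fun u => ∑ r, if (Γ.swap v).out u r = t then 1 else 0]
  exact Finset.sum_congr rfl fun s _ => sum_out_swap v Γ _ fun u => if u = t then 1 else 0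

/-- Colors of the vertices, refined `m` times. -/
def color (Γ : KGraph n) : ℕ → Fin (n + 2) → ℕ
  -- In the absence of tadpoles the initial color of an aerial vertex counts the two-cycles through
  -- it; the shift by 2 keeps it apart from the colors 0 and 1 of the sinks.
  | 0, t => if t.val < 2 then t.val else 2 + Γ.returns t
  | m + 1, t => if t.val < 2 then t.val else
      mixColors (color Γ m (Γ.out t 0)) (color Γ m (Γ.out t 1))

theorem val_vertexPerm_lt_two (σ : Equiv.Perm (Fin n)) (t : Fin (n + 2)) :
    (vertexPerm σ t).val < 2 ↔ t.val < 2 := by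
  rcases Nat.lt_or_ge t.val 2 with h | h
  · rw [vertexPerm_of_lt σ h]
  · obtain ⟨v, rfl⟩ := eq_aerial_of_two_le h
    simp

theorem color_relabel (σ : Equiv.Perm (Fin n)) (Γ : KGraph n) (m : ℕ) (t : Fin (n + 2)) :
    (Γ.relabel σ).color m (vertexPerm σ t) = Γ.color m t := by
  induction m generalizing t with
  | zero =>
    simp only [color, val_vertexPerm_lt_two, returns_relabel]
    split_ifs with h
    · rw [vertexPerm_of_lt σ h]
    · rfl
  | succ m ih =>
    simp only [color, val_vertexPerm_lt_two, out_relabel, ih]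
    split_ifs with h
    · rw [vertexPerm_of_lt σ h]
    · rfl

theorem color_swap (v : Fin n) (Γ : KGraph n) (m : ℕ) (t : Fin (n + 2)) :
    (Γ.swap v).color m t = Γ.color m t := by
  induction m generalizing t with
  | zero => simp only [color, returns_swap]
  | succ m ih =>
    simp only [color, out_swap, ih]
    by_cases h : t = aerial v
    · simp [h, mixColors_comm (Γ.color m (Γ v 1))]
    · simp [h]

/-- The sum of the colors of the aerial vertices. -/
def key (Γ : KGraph n) : ℕ := ∑ v, Γ.color 6 (aerial v)

theorem key_relabel (σ : Equiv.Perm (Fin n)) (Γ : KGraph n) : (Γ.relabel σ).key = Γ.key := by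
  rw [key, ← Equiv.sum_comp σ]
  exact Finset.sum_congr rfl fun v _ => by rw [← vertexPerm_aerial, color_relabel]

/-- The invariant only has to tell the listed graphs apart, which is verified by evaluation; equal
keys of nonisomorphic graphs elsewhere would do no harm. -/
theorem key_swap (v : Fin n) (Γ : KGraph n) : (Γ.swap v).key = Γ.key := by
  simp only [key, color_swap]

/-- The sign of the graph in which Left and Right are ordered by the colors of the targets. -/
noncomputable def orientation (Γ : KGraph n) : ℚ :=
  ∏ v, (SignType.sign ((Γ.color 6 (Γ v 1) : ℤ) - Γ.color 6 (Γ v 0)) : ℚ)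

theorem orientation_relabel (σ : Equiv.Perm (Fin n)) (Γ : KGraph n) :
    (Γ.relabel σ).orientation = Γ.orientation := by
  rw [orientation, ← Equiv.prod_comp σ]
  exact Finset.prod_congr rfl fun v _ => by simp only [relabel, Equiv.symm_apply_apply, color_relabel]

/-- The colors stay, and the two targets of `v` are exchanged: exactly one factor, the sign of a
difference, is negated. -/
theorem orientation_swap (v : Fin n) (Γ : KGraph n) :
    (Γ.swap v).orientation = - Γ.orientation := by
  simp only [orientation, color_swap]
  rw [← Finset.mul_prod_erase _ _ (Finset.mem_univ v),
    ← Finset.mul_prod_erase Finset.univ (fun u => (SignType.sign _ : ℚ)) (Finset.mem_univ v), ← neg_mul]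
  congr 1
  · rw [swap_apply, swap_apply, ← neg_sub, Left.sign_neg]
    simp
  · refine Finset.prod_congr rfl fun u hu => ?_
    rw [swap_apply, swap_apply, if_neg (Finset.ne_of_mem_erase hu),
      if_neg (Finset.ne_of_mem_erase hu)]

end KGraph

/-- The coefficient of the graphs with the given key. -/
noncomputable def keyFunctional (n K : ℕ) : GraphSpace n →ₗ[ℚ] ℚ := by
  classical
  exact GraphSpace.lift (fun Γ => if Γ.IsAffine ∧ Γ.key = K then Γ.orientation else 0)
    (fun Γ σ => by simp only [KGraph.isAffine_relabel_iff, KGraph.key_relabel,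
      KGraph.orientation_relabel])
    (fun Γ v => by
      simp only [KGraph.isAffine_swap_iff, KGraph.key_swap, KGraph.orientation_swap]
      split_ifs <;> simp)
    (fun Γ h => if_neg fun h' => h h'.1)

theorem keyFunctional_self {Γ : KGraph n} (h : Γ.IsAffine) :
    keyFunctional n Γ.key (graphClass Γ) = Γ.orientation := by
  simp [keyFunctional, h]

theorem keyFunctional_of_ne {Γ : KGraph n} {K : ℕ} (h : Γ.key ≠ K) :
    keyFunctional n K (graphClass Γ) = 0 := by
  simp [keyFunctional, h]

/-- Graphs with different keys are linearly independent. -/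
theorem linearIndependent_graphClass {G : List (KGraph n)} (haff : ∀ Γ ∈ G, Γ.IsAffine)
    (hne : ∀ Γ ∈ G, Γ.orientation ≠ 0) (hkey : (G.map KGraph.key).Nodup) :
    LinearIndependent ℚ fun i : Fin G.length => graphClass (G.get i) := by
  rw [Fintype.linearIndependent_iff]
  intro c hc i
  -- The functional of the key of graph number `i` annihilates all the other graphs of the list and
  -- is nonzero on this one.
  have := congrArg (keyFunctional n (G.get i).key) hc
  rw [map_sum, Finset.sum_eq_single i, map_smul, keyFunctional_self (haff _ (List.get_mem _ _)),
    map_zero, smul_eq_mul] at this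
  · exact (mul_eq_zero.1 this).resolve_right (hne _ (List.get_mem _ _))
  · intro j _ hj
    rw [map_smul, keyFunctional_of_ne, smul_zero]
    intro h
    refine hj (Fin.ext ?_)
    exact (List.Nodup.getElem_inj_iff hkey (hi := by simp) (hj := by simp)).1 (by simpa using h)
  · simp

/-! ### Graphs packed into natural numbers

The functions below are meant to be evaluated by the kernel, which is why they are written in terms
of recursors and of the operations on `ℕ` for which the kernel has special support. -/

section Packed

/-- `f x`, in a form that makes the kernel evaluate `x` first. -/
def force {α : Type} (x : ℕ) (f : ℕ → α) : α := Nat.rec (f 0) (fun k _ => f (Nat.succ k)) x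

def sel {α : Type} (b : Bool) (x y : α) : α := Bool.rec y x b

def loopSum (f : ℕ → ℕ) (n : ℕ) : ℕ := Nat.rec 0 (fun v a => Nat.add a (f v)) n

def loopAll (f : ℕ → Bool) (n : ℕ) : Bool := Nat.rec true (fun v a => sel (f v) a false) n

/-- The target of the Left edge issued from the vertex `v + 2` of a packed graph. -/
def lf (g v : ℕ) : ℕ := Nat.land (Nat.shiftRight g (Nat.mul 8 v)) 15

/-- The target of the Right edge issued from the vertex `v + 2` of a packed graph. -/
def rt (g v : ℕ) : ℕ := Nat.land (Nat.shiftRight g (Nat.add (Nat.mul 8 v) 4)) 15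

/-- Byte `v` has the Left target in its low four bits and the Right target in its high four bits;
this suffices for vertices up to 15. -/
def packBytes (L R : ℕ → ℕ) (n : ℕ) : ℕ :=
  loopSum (fun v => Nat.shiftLeft (Nat.add (L v) (Nat.mul 16 (R v))) (Nat.mul 8 v)) n

/-- The graph with `n` wedges that is packed into a number, one byte for each wedge. -/
def ofPacked (n g : ℕ) : KGraph n := fun v s => Fin.ofNat (n + 2) (if s = 0 then lf g v else rt g v)

/-- The cell number `t` of a list of numbers that is packed into `C` with the tag in the lowest
bits. -/
def cell (C t : ℕ) : ℕ := Nat.mod (Nat.shiftRight C (Nat.add 64 (Nat.mul 256 t))) (Nat.pow 2 256)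

/-- The numbers `0, 1, f 0, …, f (n - 1)` packed with the tag `g`, which makes the hash codes of the
packed lists different. -/
def packCells (g : ℕ) (f : ℕ → ℕ) (n : ℕ) : ℕ :=
  Nat.add (Nat.mod g (Nat.pow 2 64)) (Nat.mul (Nat.pow 2 64) (Nat.add (Nat.shiftLeft 1 256)
    (loopSum (fun v => Nat.shiftLeft (f v) (Nat.mul 256 (Nat.add v 2))) n)))

/-- This unfolds to `mixColors`, written with the operations that the kernel accelerates. -/
def mixPacked (a b : ℕ) : ℕ :=
  Nat.mod (Nat.add (Nat.add (Nat.pow (Nat.add a b) 2) (Nat.mul a b)) 3) (Nat.pow 2 256)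

def ind (a b : ℕ) : ℕ := sel (Nat.beq a b) 1 0

/-- The sinks are treated apart because truncated subtraction would send them to the byte of the
vertex 2. -/
def arrows (g a t : ℕ) : ℕ :=
  sel (Nat.ble a 1) 0 (Nat.add (ind (lf g (Nat.sub a 2)) t) (ind (rt g (Nat.sub a 2)) t))

/-- The colors of the vertices of a packed graph, refined `m` times. -/
def colors (n g m : ℕ) : ℕ :=
  Nat.rec (packCells g (fun v => Nat.add 2 (Nat.add (arrows g (lf g v) (Nat.add v 2))
      (arrows g (rt g v) (Nat.add v 2)))) n)
    (fun _ C => force C fun C => packCells g (fun v => mixPacked (cell C (lf g v)) (cell C (rt g v))) n)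
    m

def nib (S t : ℕ) : ℕ := Nat.land (Nat.shiftRight S (Nat.mul 4 t)) 15

/-- A step of the depth-first search. In the state `S`, the digit `t < 15` is the new number plus
one of the vertex `t`, or zero, the digit `15` is the next of these numbers, and the higher digits
are the inverse table. -/
def visit (g C fuel : ℕ) : ℕ → ℕ → ℕ :=
  Nat.rec (fun _ S => S) (fun _ ih t S =>
    sel (Nat.beq (nib S t) 0)
      (force (nib S 15) fun p =>
       force (Nat.add (Nat.add S (Nat.shiftLeft p (Nat.mul 4 t)))
          (Nat.add (Nat.shiftLeft t (Nat.mul 4 (Nat.add 16 p))) (Nat.shiftLeft 1 60))) fun S =>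
       force (lf g (Nat.sub t 2)) fun a => force (rt g (Nat.sub t 2)) fun b =>
        -- The target of smaller color is visited before the other one, so that, up to ties, the
        -- order of the search does not depend on the labels.
        sel (Nat.ble (cell C a) (cell C b))
         (force (ih a S) fun S => ih b S)
         (force (ih b S) fun S => ih a S)) S) fuel

/-- The vertex of the greatest color among those not yet visited. -/
def nextRoot (C S n : ℕ) : ℕ :=
  Nat.mod (Nat.rec 0 (fun v x => force x fun x => sel (Nat.beq (nib S (Nat.add v 2)) 0)
    (force (Nat.add (Nat.mul 16 (cell C (Nat.add v 2))) (Nat.add v 2)) fun y =>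
      sel (Nat.ble x y) y x) x) n) 16

/-- In the initial state 33 = 1 + 2 · 16 gives the numbers 1 and 2 to the sinks, and the digit 15
announces the number 3. The search is restarted until the aerial vertices have the numbers 3, …, n +
2. -/
def explore (n g C : ℕ) : ℕ :=
  Nat.rec (Nat.add 33 (Nat.shiftLeft 3 60)) (fun _ S => force S fun S =>
     sel (Nat.beq (nib S 15) (Nat.add n 3)) S (visit g C n (nextRoot C S n) S)) n

/-- The relabeled graph, times `16`, plus the number of the swaps. -/
def relabelPacked (n g S : ℕ) : ℕ :=
  loopSum (fun v =>
    force (nib S (lf g v)) fun a => force (nib S (rt g v)) fun b =>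
      sel (Nat.ble a b)
        -- The stored numbers exceed the new labels by one, so 17 = 1 + 16 corrects both targets at
        -- once. The byte index is the new label minus 2, that is, the stored number minus 3, and
        -- the four lowest bits are left for counting swaps.
        (Nat.shiftLeft (Nat.sub (Nat.add a (Nat.mul 16 b)) 17)
          (Nat.add 4 (Nat.mul 8 (Nat.sub (nib S (Nat.add v 2)) 3))))
        (Nat.add 1 (Nat.shiftLeft (Nat.sub (Nat.add b (Nat.mul 16 a)) 17)
          (Nat.add 4 (Nat.mul 8 (Nat.sub (nib S (Nat.add v 2)) 3)))))) n

/-- Whether `S` describes an isomorphism from `g` to `g'`. -/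
def isIso (n g S g' : ℕ) : Bool :=
  sel (Nat.beq (Nat.land S 255) 33)
    (loopAll (fun v => force (nib S (Nat.add v 2)) fun p =>
      sel (Nat.ble 3 p) (sel (Nat.ble p (Nat.add n 2))
        (sel (Nat.beq (nib S (Nat.add 16 p)) (Nat.add v 2))
          (force (lf g v) fun l => force (rt g v) fun r =>
            sel (Nat.ble l (Nat.add n 1)) (sel (Nat.ble r (Nat.add n 1))
            (force (nib S l) fun a => force (nib S r) fun b =>
            force (Nat.succ (lf g' (Nat.sub p 3))) fun l' =>
            force (Nat.succ (rt g' (Nat.sub p 3))) fun r' =>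
              sel (Nat.ble a b) (sel (Nat.beq l' a) (Nat.beq r' b) false)
                (sel (Nat.beq l' b) (Nat.beq r' a) false)) false) false) false) false) false) n)
    false

/-- The normal form of a graph, times `16`, plus a number of the same parity as the swaps. -/
def normal (n g : ℕ) : ℕ :=
  force (colors n g 6) fun C => force (explore n g C) fun S => force (relabelPacked n g S) fun X =>
   sel (isIso n g S (Nat.shiftRight X 4)) X (Nat.mul 16 g)

/-- Whether the swap at some vertex is undone by a relabeling and an even number of swaps. -/
def isOdd (n g : ℕ) : Bool :=
  force (colors n g 6) fun C => force (normal n g) fun X => Bool.not <|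
    -- The comparison of colors only narrows the search; the conclusion rests on the two normal
    -- forms.
    loopAll (fun v => sel (Nat.beq (cell C (lf g v)) (cell C (rt g v)))
      (force (normal n (packBytes (fun u => sel (Nat.beq u v) (rt g u) (lf g u))
        (fun u => sel (Nat.beq u v) (lf g u) (rt g u)) n)) fun Y =>
        Bool.not (sel (Nat.beq (Nat.shiftRight X 4) (Nat.shiftRight Y 4))
          (Nat.beq (Nat.mod X 2) (Nat.mod Y 2)) false)) true) n

theorem force_eq {α : Type} (x : ℕ) (f : ℕ → α) : force x f = f x := by cases x <;> rfl

theorem sel_eq {α : Type} (b : Bool) (x y : α) : sel b x y = if b then x else y := by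
  cases b <;> rfl

theorem loopSum_eq (f : ℕ → ℕ) (n : ℕ) : loopSum f n = ∑ v ∈ Finset.range n, f v := by
  induction n with
  | zero => rfl
  | succ n ih => rw [Finset.sum_range_succ, ← ih]; rfl

theorem loopAll_eq_true {f : ℕ → Bool} {n : ℕ} : loopAll f n = true ↔ ∀ v < n, f v = true := by
  induction n with
  | zero => simp [loopAll]
  | succ n ih =>
    have : loopAll f (n + 1) = if f n then loopAll f n else false := sel_eq _ _ _
    rw [this]
    constructor
    · intro h v hv
      by_cases hn : f n = true
      · rw [if_pos hn] at h
        rcases Nat.lt_succ_iff_lt_or_eq.1 hv with hv | rfl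
        exacts [ih.1 h v hv, hn]
      · simp [hn] at h
    · intro h
      rw [if_pos (h n n.lt_succ_self)]
      exact ih.2 fun v hv => h v (hv.trans n.lt_succ_self)

/-- Digits in base `B` are unique: the terms below position `u` add up to less than `B ^ u`, and
those above it are divisible by `B ^ (u + 1)`. -/
theorem digit_sum {B : ℕ} (hB : 0 < B) (f : ℕ → ℕ) (hf : ∀ v, f v < B) {n u : ℕ} (hu : u < n) :
    (∑ v ∈ Finset.range n, f v * B ^ v) / B ^ u % B = f u := by
  have hlt (m : ℕ) : ∑ v ∈ Finset.range m, f v * B ^ v < B ^ m := by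
    induction m with
    | zero => simp
    | succ m ih =>
      rw [Finset.sum_range_succ, pow_succ]
      nlinarith [hf m, Nat.mul_le_mul_right (B ^ m) (Nat.succ_le_of_lt (hf m))]
  obtain ⟨m, rfl⟩ := Nat.exists_eq_add_of_lt hu
  rw [add_right_comm, Finset.sum_range_add, Finset.sum_range_succ]
  have : ∑ x ∈ Finset.range m, f (u + 1 + x) * B ^ (u + 1 + x) =
      B ^ u * (B * ∑ x ∈ Finset.range m, f (u + 1 + x) * B ^ x) := by
    rw [Finset.mul_sum, Finset.mul_sum]
    exact Finset.sum_congr rfl fun x _ => by ring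
  rw [this, add_assoc, mul_comm (f u), ← mul_add, Nat.add_mul_div_left _ _ (pow_pos hB u),
    Nat.div_eq_of_lt (hlt u), zero_add, Nat.add_mul_mod_self_left, Nat.mod_eq_of_lt (hf u)]

theorem lf_eq (g v : ℕ) : lf g v = g / 256 ^ v % 256 % 16 := by
  change (g >>> (8 * v)) &&& 15 = _
  rw [Nat.shiftRight_eq_div_pow, Nat.and_two_pow_sub_one_eq_mod _ 4, pow_mul]
  norm_num [Nat.mod_mod_of_dvd]

theorem rt_eq (g v : ℕ) : rt g v = g / 256 ^ v % 256 / 16 := by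
  change (g >>> (8 * v + 4)) &&& 15 = _
  rw [Nat.shiftRight_eq_div_pow, Nat.and_two_pow_sub_one_eq_mod _ 4, pow_add, pow_mul,
    ← Nat.div_div_eq_div_mul]
  norm_num
  omega

theorem lf_lt (g v : ℕ) : lf g v < 16 := by rw [lf_eq]; omega

theorem rt_lt (g v : ℕ) : rt g v < 16 := by rw [rt_eq]; omega

theorem packBytes_eq (L R : ℕ → ℕ) (n : ℕ) :
    packBytes L R n = ∑ v ∈ Finset.range n, (L v + 16 * R v) * 256 ^ v := by
  rw [packBytes, loopSum_eq]
  refine Finset.sum_congr rfl fun v _ => ?_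
  change (L v + 16 * R v) <<< (8 * v) = _
  rw [Nat.shiftLeft_eq, pow_mul]
  norm_num

theorem lf_rt_packBytes {L R : ℕ → ℕ} (hL : ∀ v, L v < 16) (hR : ∀ v, R v < 16) {n v : ℕ}
    (hv : v < n) : lf (packBytes L R n) v = L v ∧ rt (packBytes L R n) v = R v := by
  have hv' := digit_sum (B := 256) (by norm_num) (fun v => L v + 16 * R v)
    (fun v => by have := hL v; have := hR v; omega) hv
  rw [lf_eq, rt_eq, packBytes_eq, hv']
  have := hL v
  have := hR v
  omega

/-- Graphs are recovered from their packed form. -/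
theorem ofPacked_packBytes {n : ℕ} {L R : ℕ → ℕ} (hL : ∀ v, L v < 16) (hR : ∀ v, R v < 16) :
    ofPacked n (packBytes L R n) =
      fun v : Fin n => fun s : Fin 2 => Fin.ofNat (n + 2) (if s = 0 then L v else R v) := by
  funext v s
  obtain ⟨h1, h2⟩ := lf_rt_packBytes hL hR v.isLt
  simp only [ofPacked, h1, h2]

/-- The tag occupies the 64 lowest bits, which every cell skips, so it has no influence on the
colors. -/
theorem cell_add (a C t : ℕ) : cell (a % 2 ^ 64 + 2 ^ 64 * C) t = C / (2 ^ 256) ^ t % 2 ^ 256 := by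
  change ((a % 2 ^ 64 + 2 ^ 64 * C) >>> (64 + 256 * t)) % 2 ^ 256 = _
  rw [Nat.shiftRight_eq_div_pow, pow_add, ← Nat.div_div_eq_div_mul,
    Nat.add_mul_div_left _ _ (by positivity), Nat.div_eq_of_lt (Nat.mod_lt _ (by positivity)),
    zero_add, pow_mul]

/-- The constant `1 <<< 256` in `packCells` is the cell of the sink 1; that of the sink 0 is zero.
The bound on `f` prevents carries between cells. -/
theorem cell_packCells (g : ℕ) {f : ℕ → ℕ} (hf : ∀ v, f v < 2 ^ 256) {n t : ℕ} (ht : t < n + 2) :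
    cell (packCells g f n) t = if t < 2 then t else f (t - 2) := by
  have h : packCells g f n = g % 2 ^ 64 + 2 ^ 64 *
      ∑ t ∈ Finset.range (n + 2), (if t < 2 then t else f (t - 2)) * (2 ^ 256) ^ t := by
    rw [Finset.sum_range_succ', Finset.sum_range_succ', packCells, loopSum_eq]
    have (v : ℕ) : Nat.shiftLeft (f v) (Nat.mul 256 (Nat.add v 2)) =
        f v * (2 ^ 256) ^ (v + 1 + 1) := by
      change (f v) <<< (256 * (v + 2)) = _
      rw [Nat.shiftLeft_eq, pow_mul]
    simp only [this]
    have h1 : Nat.shiftLeft 1 256 = 2 ^ 256 := by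
      change 1 <<< 256 = _
      rw [Nat.shiftLeft_eq, one_mul]
    rw [h1]
    change g % 2 ^ 64 + 2 ^ 64 * (2 ^ 256 + _) = _
    rw [add_comm (2 ^ 256)]
    simp
  rw [h, cell_add, digit_sum (by positivity) _ _ ht]
  intro v
  split_ifs with hv
  · exact hv.trans (by norm_num)
  · exact hf _

theorem ind_eq (a b : ℕ) : ind a b = if a = b then 1 else 0 := by
  simp [ind, sel_eq]

/-! #### Colors -/

/-- All targets are numbers of vertices. -/
def ValidPacked (n g : ℕ) : Prop := ∀ v < n, lf g v < n + 2 ∧ rt g v < n + 2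

section

variable {n g : ℕ}

/-- `ofPacked` reduces targets modulo `n + 2`; validity makes this reduction harmless. -/
theorem ValidPacked.val_zero (h : ValidPacked n g) (v : Fin n) :
    (ofPacked n g v 0).val = lf g v := by
  simp [ofPacked, Nat.mod_eq_of_lt (h v v.isLt).1]

theorem ValidPacked.val_one (h : ValidPacked n g) (v : Fin n) :
    (ofPacked n g v 1).val = rt g v := by
  simp [ofPacked, Nat.mod_eq_of_lt (h v v.isLt).2]

theorem arrows_eq (h : ValidPacked n g) (a : Fin (n + 2)) (v : Fin n) :
    arrows g a (v + 2) = ∑ r, if (ofPacked n g).out a r = KGraph.aerial v then 1 else 0 := by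
  rcases Nat.lt_or_ge a.val 2 with ha | ha
  · simp only [KGraph.out_of_lt _ ha]
    have : a ≠ KGraph.aerial v := fun h => by simp [h] at ha
    simp [arrows, sel_eq, this, Nat.le_of_lt_succ ha]
  · obtain ⟨u, rfl⟩ := KGraph.eq_aerial_of_two_le ha
    rw [Fin.sum_univ_two]
    simp [arrows, sel_eq, ind_eq, Fin.ext_iff, h.val_zero, h.val_one]

theorem arrows_le (g a t : ℕ) : arrows g a t ≤ 2 := by
  simp only [arrows, sel_eq, ind_eq, Nat.add_eq]
  split_ifs <;> omega

/-- This transfers the evaluated colors to the invariant theory above; each refinement step agrees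
because every color fits its cell. -/
theorem cell_colors (h : ValidPacked n g) (m : ℕ) (t : Fin (n + 2)) :
    cell (colors n g m) t = (ofPacked n g).color m t := by
  induction m generalizing t with
  | zero =>
    have : colors n g 0 = packCells g (fun v => 2 + (arrows g (lf g v) (v + 2) +
      arrows g (rt g v) (v + 2))) n := rfl
    rw [this, cell_packCells _ _ t.isLt, KGraph.color]
    · split_ifs with ht
      · rfl
      · obtain ⟨v, rfl⟩ := KGraph.eq_aerial_of_two_le (Nat.not_lt.1 ht)
        simp only [KGraph.val_aerial, Nat.add_sub_cancel, KGraph.returns, Fin.sum_univ_two (f :=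
          fun s => ∑ r, _), KGraph.out_aerial, ← h.val_zero, ← h.val_one, arrows_eq h]
    · intro v
      have := arrows_le g (lf g v) (v + 2)
      have := arrows_le g (rt g v) (v + 2)
      -- An initial color is 2 plus two counts of at most 2 each.
      exact lt_of_le_of_lt (b := 6) (by omega) (by norm_num)
  | succ m ih =>
    have : colors n g (m + 1) = packCells g (fun v => mixColors (cell (colors n g m) (lf g v))
      (cell (colors n g m) (rt g v))) n :=
      force_eq (colors n g m) fun C => packCells g (fun v =>
        mixPacked (cell C (lf g v)) (cell C (rt g v))) n
    rw [this, cell_packCells _ _ t.isLt, KGraph.color]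
    · split_ifs with ht
      · rfl
      · obtain ⟨v, rfl⟩ := KGraph.eq_aerial_of_two_le (Nat.not_lt.1 ht)
        simp only [KGraph.val_aerial, Nat.add_sub_cancel, KGraph.out_aerial, ← h.val_zero,
          ← h.val_one, ih]
    · exact fun v => Nat.mod_lt _ (by positivity)

end

/-! #### Normal forms -/

section

variable {n g : ℕ}

/-- Nothing is assumed about how `S` was found. The test makes `S` a bijection, by means of its
inverse table, and compares all edges up to Left and Right; the parity of `X` is that of the number
of swaps. -/
theorem graphClass_of_isIso {S X : ℕ} (hX : X = relabelPacked n g S)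
    (h : isIso n g S (X >>> 4) = true) :
    graphClass (ofPacked n g) = (-1 : ℚ) ^ X • graphClass (ofPacked n (X >>> 4)) := by
  generalize X >>> 4 = g' at h ⊢
  simp only [isIso, sel_eq, force_eq, Bool.if_false_right, Bool.and_eq_true, Nat.beq_eq,
    Nat.ble_eq, decide_eq_true_eq, loopAll_eq_true, Nat.add_eq, Nat.sub_eq,
    Nat.succ_eq_add_one] at h
  obtain ⟨hS, h⟩ := h
  have hval : ValidPacked n g := fun v hv => by
    obtain ⟨-, -, -, h1, h2, -⟩ := h v hv
    omega
  -- The lowest byte 33 consists of the digits 1 and 2: both sinks are fixed.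
  have hS0 : nib S 0 = 1 := by
    change (S >>> (4 * 0)) &&& 15 = 1
    change S &&& 255 = 33 at hS
    rw [Nat.shiftRight_eq_div_pow, Nat.and_two_pow_sub_one_eq_mod _ 4]
    rw [Nat.and_two_pow_sub_one_eq_mod _ 8] at hS
    omega
  have hS1 : nib S 1 = 2 := by
    change (S >>> (4 * 1)) &&& 15 = 2
    change S &&& 255 = 33 at hS
    rw [Nat.shiftRight_eq_div_pow, Nat.and_two_pow_sub_one_eq_mod _ 4]
    rw [Nat.and_two_pow_sub_one_eq_mod _ 8] at hS
    omega
  -- Stored numbers are labels plus one, and the label of the aerial vertex `v` is `v + 2`; hence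
  -- the shift by 3.
  let σ₀ : Fin n → Fin n := fun v => ⟨nib S (v + 2) - 3, by
    have := h v v.isLt
    omega⟩
  have hσ₀ (v : Fin n) : nib S (v + 2) = (σ₀ v).val + 3 := by
    have := h v v.isLt
    simp only [σ₀]
    omega
  -- The inverse table recovers the old label from the new number.
  have hinj : Function.Injective σ₀ := fun u v huv => by
    have hu := (h u u.isLt).2.2.1
    have hv := (h v v.isLt).2.2.1
    rw [hσ₀, huv, ← hσ₀, hv] at hu
    exact Fin.ext (by omega)
  let σ : Equiv.Perm (Fin n) := Equiv.ofBijective σ₀ (Finite.injective_iff_bijective.1 hinj)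
  have hσ (t : Fin (n + 2)) : nib S t = (KGraph.vertexPerm σ t).val + 1 := by
    rcases Nat.lt_or_ge t.val 2 with ht | ht
    · rw [KGraph.vertexPerm_of_lt σ ht]
      interval_cases ht' : t.val <;> assumption
    · obtain ⟨v, rfl⟩ := KGraph.eq_aerial_of_two_le ht
      simp [hσ₀, σ]
  -- These are the vertices at which the relabeled targets come in decreasing order and the edges
  -- get swapped.
  let F : Finset (Fin n) := Finset.univ.filter fun v => ¬ nib S (lf g v) ≤ nib S (rt g v)
  have hF : (-1 : ℚ) ^ X = (-1) ^ F.card := by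
    rw [hX, relabelPacked, loopSum_eq, ← Finset.prod_pow_eq_pow_sum, Finset.prod_range,
      ← Finset.prod_const, Finset.prod_filter]
    refine Finset.prod_congr rfl fun v _ => ?_
    -- The graph part of `X` is shifted by at least four bits, so it does not affect the parity.
    have heven (a b : ℕ) : (-1 : ℚ) ^ Nat.shiftLeft a (Nat.add 4 b) = 1 := by
      refine Even.neg_one_pow ?_
      change Even (a <<< (4 + b))
      rw [Nat.shiftLeft_eq, pow_add]
      exact ((even_two.pow_of_ne_zero four_ne_zero).mul_right _).mul_left _
    simp only [force_eq, sel_eq, Nat.ble_eq, ite_not]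
    split_ifs
    · exact heven _ _
    · rw [Nat.add_eq, pow_add, heven, pow_one, mul_one]
  have hiso := graphClass_eq_of_iso (Γ := ofPacked n g) (Γ' := ofPacked n g') σ F ?_
  · rw [hF, hiso, smul_smul, ← mul_pow]
    simp
  · intro v s
    have hv := (h v v.isLt).2.2.2.2.2
    rw [hσ₀, Nat.add_sub_cancel] at hv
    rw [← hval.val_zero, ← hval.val_one, hσ, hσ] at hv
    apply Fin.ext
    have hmem : v ∈ F ↔ ¬ (KGraph.vertexPerm σ (ofPacked n g v 0)).val ≤
        (KGraph.vertexPerm σ (ofPacked n g v 1)).val := by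
      simp only [F, Finset.mem_filter, Finset.mem_univ, true_and]
      rw [← hval.val_zero, ← hval.val_one, hσ, hσ]
      omega
    have hl : (ofPacked n g' (σ v) 0).val = lf g' (σ₀ v) % (n + 2) := rfl
    have hr : (ofPacked n g' (σ v) 1).val = rt g' (σ₀ v) % (n + 2) := rfl
    have h0 := (KGraph.vertexPerm σ (ofPacked n g v 0)).isLt
    have h1 := (KGraph.vertexPerm σ (ofPacked n g v 1)).isLt
    by_cases hvF : v ∈ F
    · rw [if_neg (by rw [hmem] at hvF; omega)] at hv
      simp only [Bool.and_eq_true, decide_eq_true_eq, Nat.beq_eq] at hv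
      rw [if_pos hvF]
      fin_cases s
      · simp only [Fin.zero_eta, hl, sub_zero]
        rw [Nat.mod_eq_of_lt (by omega)]
        exact Nat.succ_injective hv.1
      · simp only [Fin.mk_one, hr, sub_self]
        rw [Nat.mod_eq_of_lt (by omega)]
        exact Nat.succ_injective hv.2
    · rw [if_pos (by rw [hmem] at hvF; omega)] at hv
      simp only [Bool.and_eq_true, decide_eq_true_eq, Nat.beq_eq] at hv
      rw [if_neg hvF]
      fin_cases s
      · simp only [Fin.zero_eta, hl]
        rw [Nat.mod_eq_of_lt (by omega)]
        exact Nat.succ_injective hv.1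
      · simp only [Fin.mk_one, hr]
        rw [Nat.mod_eq_of_lt (by omega)]
        exact Nat.succ_injective hv.2

/-- No validity is required: when the test fails, `normal` falls back to `16 * g`, the graph itself
with an even number of swaps. -/
theorem graphClass_normal (n g : ℕ) : graphClass (ofPacked n g) =
    (-1 : ℚ) ^ normal n g • graphClass (ofPacked n (normal n g >>> 4)) := by
  simp only [normal, force_eq, sel_eq]
  split_ifs with h
  · exact graphClass_of_isIso rfl h
  · have : Nat.mul 16 g >>> 4 = g := by
      change (16 * g) >>> 4 = g
      rw [Nat.shiftRight_eq_div_pow]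
      omega
    rw [this, Even.neg_one_pow ⟨8 * g, by change 16 * g = _; omega⟩, one_smul]

end

end Packed

/-! ### Graphs with an odd symmetry, and lists split by hash bits -/

section Packed

/-- The packed graph with the edges issued from `v + 2` swapped. -/
theorem ofPacked_swap (n g : ℕ) (v : Fin n) :
    ofPacked n (packBytes (fun u => sel (Nat.beq u v) (rt g u) (lf g u))
      (fun u => sel (Nat.beq u v) (lf g u) (rt g u)) n) = (ofPacked n g).swap v := by
  rw [ofPacked_packBytes]
  · funext u s
    rw [KGraph.swap_apply]
    by_cases h : u = v
    · subst h
      fin_cases s <;> simp [ofPacked, sel_eq]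
    · have h' : u.val ≠ v.val := fun h' => h (Fin.ext h')
      fin_cases s <;> simp [ofPacked, sel_eq, h, h']
  · intro u
    rw [sel_eq]
    split_ifs
    exacts [rt_lt g u, lf_lt g u]
  · intro u
    rw [sel_eq]
    split_ifs
    exacts [lf_lt g u, rt_lt g u]

/-- If a graph and its swap at one vertex have the same normal form with the same parity, then the
class equals its own negative, and 2 is invertible in ℚ. -/
theorem graphClass_eq_zero_of_isOdd {n g : ℕ} (h : isOdd n g = true) :
    graphClass (ofPacked n g) = 0 := by
  simp only [isOdd, force_eq, Bool.not_eq_true', Bool.eq_false_iff, ne_eq, loopAll_eq_true,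
    not_forall] at h
  obtain ⟨v, hv, h⟩ := h
  rw [sel_eq, sel_eq] at h
  split_ifs at h with h1 h2
  · simp only [Bool.not_eq_true', Bool.not_eq_false, Nat.beq_eq] at h
    have e1 := graphClass_normal n g
    have e2 := graphClass_normal n (packBytes (fun u => sel (Nat.beq u v) (rt g u) (lf g u))
      (fun u => sel (Nat.beq u v) (lf g u) (rt g u)) n)
    generalize normal n (packBytes _ _ n) = Y at *
    rw [ofPacked_swap n g ⟨v, hv⟩, graphClass_swap] at e2
    generalize normal n g = X at *
    have hXY : (-1 : ℚ) ^ X = (-1) ^ Y := by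
      rw [neg_one_pow_eq_pow_mod_two X, neg_one_pow_eq_pow_mod_two Y]
      exact congrArg _ h
    have hc : X >>> 4 = Y >>> 4 := by simpa using h2
    rw [← hXY, ← hc, ← e1] at e2
    have h2x : (2 : ℚ) • graphClass (ofPacked n g) = 0 := by
      rw [two_smul, ← sub_neg_eq_add, e2, sub_self]
    exact (smul_eq_zero.1 h2x).resolve_left two_ne_zero
  · simp at h
  · simp at h

/-- The list of the elements that satisfy `p`. -/
def pick {α : Type} (p : α → Bool) (L : List α) : List α :=
  List.rec [] (fun a _ ih => sel (p a) (a :: ih) ih) L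

def allOf {α : Type} (p : α → Bool) (L : List α) : Bool :=
  List.rec true (fun a _ ih => sel (p a) ih false) L

theorem pick_eq {α : Type} (p : α → Bool) (L : List α) : pick p L = L.filter p := by
  induction L with
  | nil => rfl
  | cons a L ih =>
    have : pick p (a :: L) = sel (p a) (a :: pick p L) (pick p L) := rfl
    rw [this, sel_eq, ih, List.filter_cons]

theorem allOf_eq_true {α : Type} {p : α → Bool} {L : List α} :
    allOf p L = true ↔ ∀ a ∈ L, p a = true := by
  induction L with
  | nil => simp [allOf]
  | cons a L ih =>
    have : allOf p (a :: L) = sel (p a) (allOf p L) false := rfl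
    rw [this, sel_eq, List.forall_mem_cons, ← ih]
    split_ifs with h <;> simp [h]

/-- The digit number `i` in a hash of the number `N`. -/
def hashBit (N i : ℕ) : Bool := Nat.beq (Nat.land (Nat.shiftRight (Nat.mod (Nat.mul N 2654435761) 1000000007) i) 1) 1

/-- Whether the numbers are pairwise different; found out by splitting the list. -/
def distinct (fuel : ℕ) : List ℕ → Bool :=
  Nat.rec (fun _ => false) (fun i ih L =>
    List.casesOn L true fun _ T => List.casesOn T true fun _ _ =>
      sel (ih (pick (fun N => hashBit N i) L)) (ih (pick (fun N => Bool.not (hashBit N i)) L)) false)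
    fuel

/-- Equal numbers have equal hash bits, so they are never separated by the splitting. Collisions of
the hash could only exhaust the fuel, which counts as failure. -/
theorem nodup_of_distinct {fuel : ℕ} {L : List ℕ} (h : distinct fuel L = true) : L.Nodup := by
  induction fuel generalizing L with
  | zero => simp [distinct] at h
  | succ i ih =>
    match L, h with
    | [], _ => exact List.nodup_nil
    | [a], _ => exact List.nodup_singleton a
    | a :: b :: T, h =>
      generalize hL : a :: b :: T = L at *
      have h' : sel (distinct i (pick (fun N => hashBit N i) L))
          (distinct i (pick (fun N => Bool.not (hashBit N i)) L)) false = true := by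
        subst hL; exact h
      rw [sel_eq] at h'
      split_ifs at h' with h1
      have e1 := ih h1
      have e2 := ih h'
      rw [pick_eq] at e1 e2
      rw [List.nodup_iff_count_le_one] at e1 e2 ⊢
      intro N
      -- All copies of `N` lie in the same half of the list.
      by_cases hN : hashBit N i = true
      · rw [← List.count_filter (p := fun N => hashBit N i) hN]
        exact e1 N
      · rw [← List.count_filter (p := fun N => Bool.not (hashBit N i)) (by simpa using hN)]
        exact e2 N

/-! #### Cancellation of terms -/

/-- A term with the graph `normal n g`, and the numerators of two coefficients. -/
abbrev Item : Type := ℕ × ℤ × ℤ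

/-- The number `N` is a normal form, whose parity is the sign of the swaps. -/
def signed (N : ℕ) (x : ℤ) : ℤ := sel (Nat.beq (Nat.mod N 2) 0) x (Int.neg x)

def total (φ : Item → ℤ) (L : List Item) : ℤ :=
  List.rec 0 (fun a _ ih => Int.add (signed a.1 (φ a)) ih) L

/-- Whether the terms cancel in the graph space; found out by splitting the list. -/
def cancels (n fuel : ℕ) : List Item → Bool :=
  Nat.rec (fun _ => false) (fun i ih L =>
    List.casesOn L true fun a _ => force (Nat.shiftRight a.1 4) fun g =>
      sel (allOf (fun b => Nat.beq g (Nat.shiftRight b.1 4)) L)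
        (sel (sel (Nat.beq (Int.natAbs (total (fun b => b.2.1) L)) 0)
            (Nat.beq (Int.natAbs (total (fun b => b.2.2) L)) 0) false) true (isOdd n g))
        (sel (ih (pick (fun b => hashBit (Nat.shiftRight b.1 4) i) L))
          (ih (pick (fun b => Bool.not (hashBit (Nat.shiftRight b.1 4) i)) L)) false)) fuel

/-- The four lowest bits of the normal form carry the sign, the remaining ones the graph. -/
noncomputable def itemClass (n : ℕ) (φ : Item → ℤ) (a : Item) : GraphSpace n :=
  ((φ a : ℚ) * (-1) ^ a.1) • graphClass (ofPacked n (a.1 >>> 4))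

theorem cast_signed (N : ℕ) (x : ℤ) : (signed N x : ℚ) = x * (-1) ^ N := by
  have : signed N x = if N % 2 = 0 then x else -x := by
    rw [signed, sel_eq]
    simp
    rfl
  rw [this]
  rcases Nat.even_or_odd N with h | h
  · rw [if_pos (Nat.even_iff.1 h), h.neg_one_pow, mul_one]
  · rw [if_neg (by rw [Nat.odd_iff.1 h]; simp), h.neg_one_pow]
    simp

theorem sum_itemClass_eq_of_eq {n g : ℕ} (φ : Item → ℤ) {L : List Item}
    (h : ∀ a ∈ L, g = a.1 >>> 4) :
    (L.map (itemClass n φ)).sum = (total φ L : ℚ) • graphClass (ofPacked n g) := by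
  induction L with
  | nil => simp [total]
  | cons a L ih =>
    have : total φ (a :: L) = signed a.1 (φ a) + total φ L := rfl
    rw [List.map_cons, List.sum_cons, ih fun b hb => h b (List.mem_cons_of_mem _ hb), this,
      itemClass, ← h a List.mem_cons_self, Int.cast_add, cast_signed, add_smul]

theorem sum_map_filter_add {α M : Type*} [AddCommMonoid M] (p : α → Bool) (f : α → M)
    (L : List α) :
    ((L.filter p).map f).sum + ((L.filter fun a => !p a).map f).sum = (L.map f).sum := by
  induction L with
  | nil => simp
  | cons a L ih =>
    rw [List.filter_cons, List.filter_cons, List.map_cons, List.sum_cons, ← ih]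
    cases h : p a
    · simp [add_left_comm]
    · simp [add_assoc]

theorem cancels_succ_cons (n i : ℕ) (a : Item) (T : List Item) : cancels n (i + 1) (a :: T) =
    force (a.1 >>> 4) fun g =>
      sel (allOf (fun b => Nat.beq g (b.1 >>> 4)) (a :: T))
        (sel (sel (Nat.beq (Int.natAbs (total (fun b => b.2.1) (a :: T))) 0)
            (Nat.beq (Int.natAbs (total (fun b => b.2.2) (a :: T))) 0) false) true (isOdd n g))
        (sel (cancels n i (pick (fun b => hashBit (b.1 >>> 4) i) (a :: T)))
          (cancels n i (pick (fun b => Bool.not (hashBit (b.1 >>> 4) i)) (a :: T))) false) := rfl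

/-- Splitting by hash bits only rearranges the sum. A part with a single graph contributes a
multiple of one class, and either both integer totals are zero or the class is. Both kinds of
coefficients are treated in one pass. -/
theorem sum_itemClass_eq_zero {n fuel : ℕ} {L : List Item} (h : cancels n fuel L = true) :
    (L.map (itemClass n fun b => b.2.1)).sum = 0 ∧
      (L.map (itemClass n fun b => b.2.2)).sum = 0 := by
  induction fuel generalizing L with
  | zero => simp [cancels] at h
  | succ i ih =>
    cases hL : L with
    | nil => simp
    | cons a T =>
      rw [hL, cancels_succ_cons, force_eq, ← hL, sel_eq] at h
      rw [← hL]
      split_ifs at h with h1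
      · have h1' : ∀ b ∈ L, a.1 >>> 4 = b.1 >>> 4 := by simpa [allOf_eq_true] using h1
        rw [sum_itemClass_eq_of_eq _ h1', sum_itemClass_eq_of_eq _ h1']
        rw [sel_eq] at h
        by_cases h2 : sel (Nat.beq (Int.natAbs (total (fun b => b.2.1) L)) 0)
            (Nat.beq (Int.natAbs (total (fun b => b.2.2) L)) 0) false = true
        · simp only [sel_eq, Bool.if_false_right, Bool.and_eq_true, decide_eq_true_eq, Nat.beq_eq,
            Int.natAbs_eq_zero] at h2
          simp [h2.1, h2.2]
        · rw [if_neg h2] at h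
          simp [graphClass_eq_zero_of_isOdd h]
      · rw [sel_eq] at h
        split_ifs at h with h2
        have e1 := ih h2
        have e2 := ih h
        rw [pick_eq] at e1 e2
        constructor
        · rw [← sum_map_filter_add (fun b : Item => hashBit (b.1 >>> 4) i), e1.1, e2.1, add_zero]
        · rw [← sum_map_filter_add (fun b : Item => hashBit (b.1 >>> 4) i), e1.2, e2.2, add_zero]

end Packed

/-! ### The Leibniz graphs -/

/-- These lists are certificates: they solve the linear system that expresses the difference of the
expansions through Leibniz graphs, and only the verification matters. A code has 2k + 3 digits; thus
`1012`, read as 01012, is the wedge with targets 0, 1 and the trident with targets 0, 1, 2. -/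
def leibnizRows1 : List Row := [
  w 1012 1 6]

def leibnizRows2 : List Row := [
  w 101012 1 6, w 104123 (-1) 180, w 104203 1 90, w 114203 (-1) 180, w 114213 (-1) 90,
  w 301012 1 18, w 304102 1 90, w 401013 11 90, w 1301012 1 18, w 1304102 (-17) 720,
  w 1314102 (-1) 90, w 1401013 11 90, w 1402013 (-17) 720, w 3401012 (-1) 180]

def leibnizRows3 : List Row := [
  w 10101012 1 12, w 10401012 1 18, w 10401023 1 45, w 10401123 73 1440, w 10405123 1 180,
  w 10415123 7 1440, w 10501123 1 40, w 10501203 1 90, w 11401012 1 18, w 11401023 (-73) 1440,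
  w 11401123 (-1) 45, w 11405203 (-7) 1440, w 11415203 (-1) 180, w 11501203 (-1) 180,
  w 11501213 (-1) 90, w 30101012 1 18, w 30115204 (-1) 1440, w 30115214 (-1) 180,
  w 30401012 (-1) 90, w 30415102 1 480, w 30501014 1 90, w 30501102 1 90, w 31501014 (-19) 1440,
  w 31501102 (-1) 144, w 50101013 11 90, w 50401013 1 30, w 51401013 (-31) 720, w 130101012 1 18,
  w 130105124 1 1440, w 130105204 (-1) 180, w 130201014 1 36, w 130405012 (-1) 240,
  w 130501012 (-1) 144, w 130501014 19 1440, w 131401012 1 90, w 131501014 (-1) 90,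
  w 131501102 (-1) 90, w 131502014 (-1) 480, w 150101013 11 90, w 150401013 31 720,
  w 151401013 (-1) 30, w 151402103 1 240, w 340105012 (-1) 160, w 340115012 1 240,
  w 350101012 (-1) 180, w 350101014 (-1) 32, w 350101214 1 240, w 350101402 1 240,
  w 350102014 1 360, w 350112014 (-1) 1440]

def leibnizRows4 : List Row := [
  w 1010101012 (-1) 36, w 1040101012 1 18, w 1040101023 1 45, w 1040101123 1 160,
  z 1040116235 1 6480 (-25) 16, w 1040501123 529 45360, w 1040501203 (-1) 270,
  w 1040506123 (-5) 2268, w 1040506203 (-1) 945, z 1040516123 157 362880 (-27) 32,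
  z 1040516203 971 181440 (-59) 16, w 1040601123 1 180, w 1041501012 1 72,
  z 1041501023 143 45360 (-9) 4, w 1041501123 9 1120, z 1041506123 (-781) 90720 31 16,
  z 1041506203 37 3024 (-15) 2, z 1041516203 (-103) 90720 (-11) 8, w 1041601123 7 1440,
  z 1045601203 29 2268 (-17) 2, w 1060101123 (-1) 360, w 1060101203 1 180, w 1060501123 (-1) 540,
  w 1060501203 1 270, w 1060501423 (-1) 756, w 1061501123 1 540, w 1061501203 (-1) 270,
  w 1140101012 1 18, w 1140101023 (-1) 160, w 1140101123 (-1) 45, w 1140106235 5 3024,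
  z 1140116235 (-67) 36288 (-13) 16, z 1140506123 1 640 (-35) 32, z 1140506203 (-569) 36288 167 16,
  z 1140516123 1 192 (-9) 4, z 1140516203 247 90720 11 8, w 1140601203 (-7) 1440,
  z 1141501023 41 6048 (-9) 4, w 1141501213 (-1) 270, z 1141506123 (-599) 181440 3 2,
  w 1141516203 (-5) 2268, w 1141516213 1 945, w 1141601203 (-1) 180, w 1160101203 (-1) 360,
  w 1160101213 (-1) 180, w 1160501203 (-1) 540, w 1160501213 (-1) 270, w 1161501203 1 540,
  w 1161501213 1 270, z 1450106213 (-341) 51840 111 32, z 1450116213 (-17) 6480 1 4,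
  z 1460501123 (-13) 6480 15 8, z 1460501203 23 22680 (-9) 8, z 1461501123 (-23) 22680 9 8,
  w 3010101012 (-7) 180, w 3010501012 (-7) 270, z 3010506124 (-133) 8640 171 16,
  w 3010506204 (-1) 945, z 3010516204 181 25920 (-77) 16, w 3011501012 7 270,
  z 3011506204 (-499) 60480 77 16, z 3011516204 53 90720 (-3) 4, w 3011601204 (-1) 1440,
  w 3011601214 (-1) 180, w 3040101012 (-1) 90, w 3040106205 (-1) 945, z 3040116205 (-53) 90720 3 4,
  z 3040116215 1 181440 37 16, w 3040501012 (-1) 945, w 3040506102 (-1) 945,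
  z 3040516102 (-559) 45360 135 16, w 3040601015 1 945, z 3041516012 (-2929) 362880 5 2,
  z 3041601015 3511 90720 (-3) 2, w 3060101014 1 90, w 3060101102 1 180, w 3060501014 11 1890,
  w 3060501102 1 270, w 3061201014 (-1) 480, z 3061501014 145 9072 (-3) 2, w 3061501102 (-1) 270,
  w 3140101012 (-19) 1440, z 3140116205 (-299) 90720 2 1, z 3140116215 1103 181440 13 16,
  z 3140601015 (-1919) 90720 9 8, w 3140601102 1 240, w 3160101102 (-1) 288,
  z 3160501014 (-47) 12960 (-9) 4, w 3160501102 (-1) 432, z 3161501014 (-881) 90720 (-15) 8,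
  w 3161501102 1 432, z 3460101015 (-1) 360 3 1, z 3460501201 197 22680 (-49) 8,
  w 6010101013 (-1) 180, w 6010501013 (-1) 270, w 6010501034 1 105, z 6010501134 (-1) 324 3 4,
  w 6011501013 1 270, z 6011501034 1373 90720 3 2, w 6040101013 1 30, w 6040501013 (-11) 1890,
  z 6041501013 (-1219) 45360 3 1, w 6140101013 1 720, z 6141501013 (-53) 45360 3 2,
  w 13010101012 (-7) 180, w 13010501012 (-7) 270, z 13010501024 (-31) 2268 (-3) 4,
  z 13010501124 797 90720 (-3) 2, z 13010506124 53 90720 (-3) 4, z 13010506204 (-41) 2240 171 16,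
  z 13010516124 (-397) 181440 (-17) 16, w 13010601124 1 1440, w 13010601204 (-1) 180,
  w 13011501012 7 270, z 13011506124 167 181440 17 16, w 13011516204 11 3780, w 13011516214 1 945,
  w 13020101014 (-1) 36, w 13020106504 1 540, w 13020106514 1 1080, w 13020116504 1 240,
  w 13020116514 (-1) 540, w 13020501014 7 540, w 13020506104 (-1) 540, w 13020601015 1 540,
  w 13021501014 7 540, w 13021516104 1 540, w 13021601015 1 540, w 13025601401 1 1080,
  w 13040101012 19 1440, w 13040101015 (-1) 72, z 13040106125 (-11) 36288 3 4,
  w 13040106205 (-13) 3780, z 13040116205 (-19) 6720 (-45) 16, w 13040116215 1 1890,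
  z 13040501012 (-2) 189 (-9) 8, z 13040506012 641 90720 (-55) 16, z 13040601015 (-11) 2268 3 8,
  z 13041501012 (-5) 324 (-3) 4, z 13041601015 (-337) 12960 3 2, w 13060101012 (-1) 288,
  w 13060501012 (-1) 432, z 13060501014 79 90720 (-3) 4, z 13060502014 (-1583) 90720 23 2,
  w 13061501012 1 432, z 13061501014 631 90720 (-9) 8, z 13061502014 17 17280 7 4,
  w 13061504102 (-1) 864, w 13140101012 1 90, z 13140106125 (-53) 90720 3 4,
  z 13140106205 271 181440 (-3) 4, z 13140116205 (-115) 36288 (-13) 16, w 13140116215 1 945,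
  z 13140501012 11 2268 (-3) 8, z 13140506102 709 362880 (-9) 16, z 13140601015 3511 90720 (-3) 2,
  w 13141501012 (-1) 945, z 13141506102 53 10080 (-5) 1, w 13141516102 1 945, w 13141601015 1 945,
  w 13160101014 (-1) 90, w 13160101102 (-1) 180, w 13160201014 (-1) 480,
  z 13160501014 145 9072 (-3) 2, w 13160501102 (-1) 270, w 13161501014 11 1890,
  w 13161501102 1 270, z 13161502014 (-641) 90720 55 16, z 13460101015 (-17) 45360 (-3) 4,
  w 16010101013 (-1) 180, w 16010501013 (-1) 270, z 16010501034 443 90720 9 4,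
  z 16010501134 1373 90720 3 2, w 16011501013 1 270, z 16011501034 163 90720 3 1,
  w 16011501134 1 105, w 16021504013 (-1) 864, w 16040101013 (-1) 720,
  z 16040501013 (-53) 45360 3 2, z 16041502013 3281 362880 (-77) 16, w 16140101013 (-1) 30,
  w 16140201103 1 240, z 16140501013 (-1219) 45360 3 1, w 16141501013 (-11) 1890,
  z 16141502103 (-157) 15120 129 16, w 34010501012 19 12960, z 34010506012 (-1) 630 7 4,
  z 34010516012 (-503) 120960 119 32, w 34010601012 (-1) 240, z 34010601015 101 10080 (-9) 8,
  z 34011501012 (-65) 9072 9 8, w 34011601012 1 240, z 34011601015 (-1063) 90720 (-3) 4,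
  z 34011602015 22 2835 (-67) 16, z 34011612015 85 12096 (-21) 4, z 34016201015 59 11340 (-71) 16,
  z 35040116201 139 362880 (-1) 32, w 35060102014 (-1) 1890, z 35060112014 181 60480 (-5) 4,
  z 35140106201 37 45360 (-7) 8, z 35140116201 (-31) 8640 (-3) 8, w 36010101012 1 80,
  w 36010101214 1 240, w 36010101402 1 240, z 36010102145 (-313) 72576 147 32,
  z 36010112145 (-569) 181440 3 1, w 36010201014 1 1440, w 36010501012 1 120,
  z 36010501042 335 36288 (-81) 16, w 36011201014 (-1) 1440, w 36011501012 (-1) 120,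
  z 36011501014 517 90720 (-9) 8, z 36011501204 67 9072 (-65) 16, z 36011502014 (-37) 5760 83 32,
  z 36011512014 (-521) 60480 7 1, z 36040101015 91 6480 (-3) 4, z 36040112015 979 362880 9 32,
  z 36040501201 (-1709) 181440 87 16, z 36140101015 (-109) 18144 3 4,
  z 36140501201 (-137) 45360 77 16, z 36141501201 (-17) 90720 3 8,
  z 64010502013 215 12096 (-171) 16, z 64011502013 37 12960 (-3) 4, w 64011512013 (-1) 1890,
  w 65040102013 1 1890, z 65040112013 (-1) 1728 49 16, z 65140102013 (-377) 181440 3 2,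
  z 65140112013 671 181440 13 16]

def leibnizRows5 : List Row := [
  w 101010101012 1 144, w 104010101012 1 36, w 104010101023 1 90, w 104010101123 (-11) 576,
  w 104010601012 1 108, w 104010601023 1 135, w 104010601123 41 4320, w 104011601023 (-1) 135,
  w 104011601123 (-1) 480, z 104011617235 1 90720 (-1) 4, w 104050101023 1 270,
  z 104050101123 101 45360 3 4, w 104050601023 (-2) 945, z 104050601123 (-233) 90720 (-1) 16,
  w 104050607123 (-1) 1890, z 104050617123 (-11) 12960 (-5) 16, w 104050701123 1 1890,
  w 104050701203 (-1) 945, z 104051601023 107 40320 7 16, z 104051601123 (-23843) 362880 5 16,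
  z 104051607203 7681 725760 (-7) 1, z 104051617123 (-143) 72576 17 16,
  z 104051617203 4043 181440 (-457) 32, z 104051701203 (-13) 4320 5 8, w 104070101123 1 360,
  w 104070601123 1 540, w 104070601523 (-1) 1890, w 104071601123 (-1) 540,
  w 104071601523 (-5) 18144, w 104150101012 1 72, z 104150101023 2393 90720 (-3) 4,
  z 104150101123 91 6480 (-3) 4, z 104150117236 1423 90720 (-313) 32,
  z 104150601023 1439 362880 (-11) 16, z 104150601123 1711 72576 7 16,
  z 104150607203 (-1579) 145152 121 16, z 104150617203 (-421) 24192 189 16,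
  z 104150701203 223 45360 (-11) 8, z 104151601023 7 51840 (-1) 8,
  z 104151601123 143 25920 (-25) 16, z 104151607123 (-593) 483840 15 32,
  z 104151607203 9 448 (-45) 4, z 104151617123 (-13) 10368 7 16,
  z 104151701123 (-371) 25920 167 16, z 104151701203 (-643) 60480 225 32,
  z 104156701123 (-3559) 725760 23 8, w 104170101123 7 2880, w 104170601123 7 4320,
  w 104170601203 (-7) 4320, w 104171601123 (-7) 4320, z 104560107123 (-827) 30240 569 32,
  z 104560107203 (-1837) 181440 47 8, z 104570601203 71 45360 (-7) 4,
  z 104571601123 7157 725760 (-203) 32, w 107010101123 (-1) 1080, w 107010101203 1 540,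
  w 107050101123 (-1) 540, w 107050101203 1 270, z 107051601423 907 82944 (-225) 32,
  w 107150101123 1 540, w 107150101203 (-1) 270, w 107150601123 1 540, w 107150601203 (-1) 270,
  w 114010101012 1 36, w 114010101023 (-1) 320, w 114010101123 (-1) 90, w 114010601012 1 54,
  w 114010601023 (-1) 480, w 114010601123 (-1) 135, w 114010601235 (-1) 945,
  w 114011601012 (-1) 108, w 114011601023 41 4320, w 114011601123 1 135,
  z 114011607235 (-5221) 483840 225 32, w 114011701235 19 5040, z 114050101023 (-139) 10080 (-9) 4,
  z 114050101123 (-11) 7560 (-9) 4, z 114050117236 1241 1451520 (-3) 8,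
  z 114050601023 13 36288 (-13) 16, z 114050601123 (-19) 60480 (-3) 8,
  z 114050617123 5191 1451520 (-87) 32, w 114050701123 1 630, z 114051601123 31 6480 21 16,
  z 114051607203 (-73) 40320 (-5) 4, w 114070101203 (-7) 2880, w 114071601203 7 4320,
  z 114150101023 101 45360 3 4, w 114150101123 1 270, z 114150601023 16697 362880 (-1) 4,
  z 114150601123 (-691) 60480 9 16, z 114150607203 (-4271) 181440 517 32,
  z 114150617123 503 120960 (-55) 16, z 114150617203 11 12960 5 16,
  z 114150701123 109 6720 (-179) 16, z 114150701203 739 60480 (-225) 32,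
  z 114151601023 (-149) 45360 13 16, w 114151601123 2 945, z 114151607123 (-947) 362880 39 16,
  w 114151617203 1 1890, w 114151701203 1 1890, w 114151701213 1 945,
  z 114156701023 1697 41472 (-819) 32, w 114170101203 (-1) 360, w 114170601203 (-1) 540,
  w 114171601203 1 540, w 114171601523 1 1890, z 114560117213 37 11520 (-11) 4,
  z 114570601123 16243 1451520 (-59) 8, z 114571601023 (-5959) 80640 1485 32,
  w 117010101203 (-1) 1080, w 117010101213 (-1) 540, w 117050101203 (-1) 540,
  w 117050101213 (-1) 270, z 117050601423 527 362880 (-19) 16, w 117051601203 (-1) 120,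
  w 117150101203 1 540, w 117150101213 1 270, w 117150601213 1 270, w 117151601423 1 1890,
  w 145010601012 (-1) 45, z 145010601123 (-5441) 362880 (-1) 2,
  z 145010701213 (-2671) 181440 301 32, z 145011601123 (-1) 45360 13 8,
  z 145011701213 37 45360 1 1, z 146050107123 (-299) 362880 11 8, z 146050107203 (-71) 51840 25 16,
  z 146050117213 (-88079) 1451520 1219 32, z 146150107203 (-517) 181440 37 16,
  z 146150107213 517 48384 (-207) 32, z 146150117213 (-71) 362880 3 16,
  z 147050601213 35977 2903040 (-75) 8, z 147051601123 (-23) 181440 (-3) 8,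
  z 147150101123 (-1) 360 9 8, z 147150101302 (-13) 6480 15 8, z 147151601213 187 362880 (-11) 16,
  w 301010101012 (-7) 540, z 301016701245 (-23011) 2903040 83 32, w 301050101012 (-7) 270,
  w 301050601124 (-67) 45360, z 301050701124 11 11340 1 4, w 301050701204 (-1) 945,
  w 301051601024 193 30240, z 301051601124 (-391) 60480 1 16, z 301051607204 53 120960 (-1) 4,
  z 301051617124 (-4153) 362880 225 32, z 301051617204 11 20160 (-1) 4,
  z 301051701204 (-37) 36288 21 16, z 301056701124 (-4237) 483840 45 8,
  z 301070101524 461 181440 (-17) 16, z 301071601524 21289 2903040 (-201) 32,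
  w 301150101012 (-1) 270, z 301150117246 22391 1451520 (-291) 32, w 301150601012 7 540,
  z 301150607124 (-1127) 41472 545 32, z 301150617124 22363 725760 (-593) 32,
  z 301150701204 (-1) 4032 (-21) 16, z 301151607124 (-43) 2016 211 16,
  z 301151617204 (-13) 45360 1 4, w 301151617214 1 1890, z 301151701204 53 90720 (-3) 4,
  z 301151701214 3097 181440 (-155) 16, w 301170101204 (-1) 2880, w 301170101214 (-1) 360,
  z 301170101524 29 181440 3 4, w 301170601204 (-1) 4320, w 301170601214 (-1) 540,
  w 301171601204 1 4320, w 301171601214 1 540, z 301570101214 463 45360 (-239) 32,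
  z 301570601204 179 181440 (-11) 16, z 301571601124 (-121) 90720 1 8,
  z 301571601204 (-4951) 414720 147 16, w 304010101012 (-1) 180, w 304010601012 (-1) 270,
  z 304010617125 (-223) 362880 1 4, z 304010701125 (-223) 181440 (-17) 16, w 304010701205 (-1) 945,
  w 304011601012 1 270, z 304011607205 373 362880 (-1) 2, z 304011617205 191 181440 (-1) 2,
  z 304011617215 (-13) 45360 1 4, z 304011701205 (-53) 90720 3 4, w 304050101012 (-1) 135,
  w 304050101016 (-1) 270, z 304050117206 (-7) 17280 5 16, z 304050117216 191 181440 (-1) 2,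
  w 304050601012 1 945, z 304050617102 (-347) 103680 35 16, w 304050701016 (-1) 945,
  w 304050701102 (-1) 945, z 304051601012 43 120960 (-27) 16, z 304051617102 (-2203) 362880 29 16,
  z 304051701012 (-361) 181440 2 1, z 304051701016 (-493) 181440 5 4,
  z 304056701201 (-319) 241920 17 16, w 304070101015 1 945, w 304070601015 1 945,
  z 304071201105 2059 181440 (-7) 1, z 304071601015 61 22680 (-1) 2,
  z 304071602015 1867 725760 (-3) 2, z 304150101012 (-377) 11340 (-3) 8,
  z 304150107126 (-149) 120960 5 8, w 304150107206 1 1890, z 304150117206 89 48384 (-17) 16,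
  z 304150617102 2083 362880 (-23) 16, z 304150701102 (-5) 5184 (-17) 16,
  z 304151601012 (-211) 5184 1 2, z 304151617012 (-19) 20736 1 2, z 304151701016 2657 72576 (-3) 4,
  w 304170101102 (-1) 960, z 304170601015 (-11) 9072 (-3) 4, w 304170601102 1 720,
  z 304171601015 149 181440 (-1) 1, w 304171601102 1 4320, z 304560117201 13729 725760 (-483) 32,
  z 304570101016 523 181440 (-1) 2, z 304570601201 (-3961) 725760 27 8,
  z 304571601201 223 7560 (-627) 32, w 307010101014 1 180, w 307010101102 1 540,
  w 307010601014 1 270, w 307010601045 2 945, z 307010601145 (-103) 90720 (-1) 2,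
  w 307011601014 (-1) 270, w 307011601045 121 45360, z 307011601145 29 181440 21 16,
  w 307050101014 11 1890, w 307050101102 1 270, w 307050601014 (-1) 315,
  z 307050612104 583 181440 (-11) 4, z 307051201014 371 25920 (-167) 16,
  z 307051601014 149 60480 (-5) 4, w 307051601102 (-1) 540, z 307150101014 437 45360 (-3) 2,
  w 307150101102 (-1) 270, w 307150401102 (-1) 540, z 307150601014 (-269) 60480 7 4,
  w 307150601102 (-1) 540, z 307151601014 (-191) 90720 1 1, z 307151602014 103 18144 (-13) 8,
  w 314010101012 173 2880, w 314010601012 (-19) 4320, w 314010601501 7 540,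
  z 314010607125 (-521) 20160 239 16, w 314010607205 1 1890, z 314010617205 (-41) 48384 33 16,
  w 314011601012 (-13) 4320, w 314011601501 (-1) 108, z 314011607125 1433 725760 (-7) 8,
  z 314050101012 257 11340 (-3) 4, z 314050107126 17 13440 (-7) 8,
  z 314050117206 (-2161) 725760 33 16, z 314050117216 (-703) 725760 13 16,
  z 314050601012 (-919) 60480 7 2, z 314051617012 35489 1451520 (-477) 32,
  z 314051701016 (-1049) 181440 33 16, z 314051701102 (-731) 90720 105 16, w 314070101015 8 315,
  w 314070101102 1 240, z 314070601015 473 362880 (-5) 16, w 314070601102 (-1) 720,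
  z 314071601015 1003 24192 (-19) 16, w 314071601102 (-1) 540, z 314150101012 (-11) 18144 9 8,
  w 314150101016 1 135, z 314150701016 (-1) 216 (-9) 16, z 314151601012 (-151) 24192 43 16,
  z 314151701016 1 567 (-11) 4, z 314170101015 (-269) 18144 (-15) 8,
  z 314170601015 199 120960 (-19) 16, z 314171601015 2123 362880 (-65) 16,
  z 314560117201 (-13397) 207360 1287 32, z 314570101016 (-3799) 90720 (-13) 16,
  w 317010101014 (-2) 45, w 317010601014 (-1) 135, z 317010601045 821 90720 1 2,
  z 317010601145 (-1103) 362880 19 8, z 317011601045 11 25920 (-21) 16,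
  z 317011601145 (-547) 51840 49 8, z 317050101014 11 18144 (-9) 8,
  z 317150101014 (-59) 6480 (-3) 1, z 317150601014 12881 362880 43 16,
  z 345010601012 (-733) 51840 79 16, z 345010701016 19 9072 (-13) 4,
  z 345011601012 13667 362880 15 8, z 346050117201 1531 241920 (-83) 32,
  z 347010601015 1 45360 (-13) 8, z 347050101016 1 4480 1 2, z 347050601201 53 16128 (-5) 2,
  z 347051601201 67 145152 31 16, z 347150101016 1 945 (-13) 16, w 701010101013 (-1) 540,
  w 701050101013 (-1) 270, w 701050101034 1 105, z 701050601134 3667 362880 1 1,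
  w 701051601013 1 540, z 701051601134 2899 72576 (-17) 8, w 701150101013 (-7) 270,
  z 701150101034 797 90720 3 2, z 701150101134 (-59) 12960 3 1, w 701150601013 1 540,
  z 701151601034 37 60480 1 16, z 701151601134 (-569) 362880 (-1) 2, w 704010101013 1 60,
  w 704010601013 1 90, w 704011601013 (-1) 90, w 704050101013 (-23) 1890, w 704050601103 1 315,
  z 704050612013 (-293) 181440 1 1, z 704150101013 71 12960 3 2, z 704150601013 (-2) 2835 3 4,
  w 714010101013 1 1440, w 714010601013 1 2160, z 714010601035 (-157) 25920 (-1) 2,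
  z 714010601135 173 120960 (-3) 16, w 714011601013 1 144, z 714050101013 (-1783) 90720 3 2,
  z 714050601013 (-1901) 181440 (-1) 4, z 714051601013 (-385) 10368 1 8,
  z 714150101013 (-53) 45360 3 2, z 714150601013 16609 362880 (-9) 8, z 714151601013 7 8640 (-5) 8,
  z 745011601013 (-29) 15120 (-7) 16, w 1301010101012 (-7) 540, w 1301050101012 1 270,
  z 1301050101024 (-4) 945 (-3) 2, z 1301050101124 4 945 3 2, z 1301050601024 59 10080 (-3) 4,
  w 1301050601124 (-16) 945, z 1301050607124 13 45360 (-1) 4, w 1301050607204 1 1890,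
  z 1301050617124 (-8419) 1451520 129 32, z 1301050617204 289 161280 (-53) 32,
  z 1301050701124 53 90720 (-3) 4, z 1301050701204 (-11) 5670 1 4,
  z 1301051601024 2087 60480 (-1) 16, w 1301051601124 (-193) 30240,
  z 1301051607124 2495 290304 (-187) 32, z 1301051607204 (-3107) 1451520 15 16,
  z 1301051617124 43 60480 (-5) 4, z 1301051617204 (-97) 290304 15 32,
  z 1301051701124 53 45360 (-5) 8, z 1301051701204 1 40320 35 32, w 1301070101124 1 2880,
  w 1301070101204 (-1) 360, z 1301070101524 179 20160 (-1) 4, w 1301070601124 1 4320,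
  w 1301070601204 (-1) 540, w 1301071601124 (-1) 4320, w 1301071601204 1 540,
  w 1301150101012 7 270, w 1301150601012 19 540, z 1301150607124 (-101) 30240 33 16,
  z 1301150607204 (-13177) 483840 18 1, z 1301150617124 (-139) 120960 3 2,
  z 1301150701124 (-221) 90720 5 8, z 1301150701204 (-1) 40320 (-35) 32,
  z 1301151601024 (-397) 90720 3 4, z 1301151607204 (-2953) 1451520 47 32,
  z 1301151701204 (-367) 25920 155 16, w 1301151701214 1 945, z 1301570101204 (-7529) 362880 67 8,
  z 1301571601214 (-109) 72576 11 8, w 1302010101014 1 72, w 1302010601014 (-1) 108,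
  w 1302010601045 (-1) 270, w 1302010601145 (-73) 8640, w 1302010607145 (-1) 1080,
  w 1302010617145 (-7) 8640, w 1302010701504 1 540, w 1302010701514 1 1080,
  w 1302011601014 (-1) 108, w 1302011601045 73 8640, w 1302011601145 1 270, w 1302011607405 7 8640,
  w 1302011617405 1 1080, w 1302011701504 (-1) 1080, w 1302011701514 (-1) 540,
  w 1302050101014 7 540, w 1302050117406 1 8640, w 1302050117416 1 1080, w 1302050601014 1 540,
  w 1302050701016 (-1) 540, w 1302051601014 19 8640, w 1302051607104 (-1) 1440,
  w 1302070101015 1 540, w 1302070601015 (-1) 180, w 1302071601015 31 4320, w 1302150101014 7 540,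
  w 1302150107146 (-1) 8640, w 1302150107406 1 1080, w 1302150401016 1 432,
  w 1302150601014 (-19) 8640, w 1302150607014 1 2880, w 1302150617104 (-1) 1440,
  w 1302151601014 (-1) 540, w 1302151701016 1 540, w 1302170101015 1 540,
  w 1302170601015 (-31) 4320, w 1302170614015 1 2880, w 1302171601015 1 180,
  w 1302560107014 1 1440, w 1302560117014 (-1) 1440, w 1302570101016 1 135,
  w 1302570101401 (-1) 240, w 1302570101604 (-1) 1440, w 1302570101614 1 1440,
  w 1302570104016 (-1) 8640, w 1302570114016 1 8640, w 1304010101012 (-109) 2880,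
  w 1304010101015 (-1) 72, w 1304010601012 (-13) 4320, z 1304010607125 1439 60480 (-235) 16,
  z 1304010617125 (-22693) 1451520 277 32, z 1304010701125 (-17) 11340 1 2,
  z 1304010701205 (-403) 181440 (-17) 16, w 1304011601012 (-19) 4320,
  z 1304011607205 899 241920 (-45) 16, z 1304011617205 53 22680 (-1) 2, w 1304011617215 1 1890,
  z 1304011701205 (-163) 90720 3 2, w 1304011701215 1 1008, w 1304050101016 (-2) 135,
  z 1304050107126 (-29) 72576 1 4, w 1304050201016 (-1) 540, z 1304050601012 1027 120960 (-35) 16,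
  z 1304050701016 2029 181440 (-5) 4, z 1304051601012 157 25920 (-21) 16,
  z 1304051607012 (-209) 25920 13 4, z 1304051617102 (-58769) 1451520 809 32,
  w 1304051701012 31 11340, z 1304051701016 (-14743) 362880 (-13) 16, w 1304070101015 (-4) 105,
  w 1304070601012 (-1) 480, z 1304070601015 515 72576 1 16, z 1304071201105 73 11340 (-37) 16,
  w 1304071601012 1 2160, z 1304071601015 (-15367) 362880 27 16, w 1304150101016 (-1) 45,
  z 1304150107126 (-19) 72576 (-5) 16, z 1304150107206 31 15120 (-1) 4, w 1304150201016 (-1) 432,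
  z 1304150601012 401 12960 13 16, z 1304151617102 (-293) 181440 1 1,
  z 1304151701016 (-29) 2240 4 1, z 1304170101015 (-53) 3024 27 8, w 1304170101102 1 240,
  z 1304170601015 (-1333) 72576 5 4, w 1304170601102 1 360, z 1304171601015 (-67) 4480 81 16,
  z 1304171602015 (-101113) 725760 709 8, z 1304570101016 15919 362880 (-25) 16,
  z 1304570601201 (-8101) 1451520 37 16, w 1307010101102 1 288, w 1307011601014 (-1) 135,
  z 1307011601145 289 362880 (-47) 8, z 1307050101014 (-881) 90720 (-15) 8, w 1307050101102 1 432,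
  z 1307050601014 (-17) 7560 (-1) 2, z 1307050612014 769 181440 (-3) 4, w 1307120101104 (-1) 960,
  w 1307120601104 (-1) 1440, w 1307121601104 (-1) 1440, w 1307150101102 (-1) 432,
  w 1307150401102 (-1) 864, z 1307150601014 (-2845) 72576 (-43) 16, w 1307150601102 (-1) 432,
  z 1307151601014 17 7560 1 2, z 1307151602014 60007 1451520 (-831) 32, w 1314010101012 1 180,
  w 1314010601012 1 270, z 1314010607125 (-191) 181440 1 2, z 1314010617205 (-3457) 290304 255 32,
  z 1314010701125 (-53) 90720 3 4, z 1314010701205 113 12960 (-1) 1, w 1314011601012 (-1) 270,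
  z 1314011607125 (-373) 362880 1 2, z 1314011607205 419 241920 (-19) 16, w 1314011701215 1 945,
  z 1314050101012 (-181) 18144 (-9) 4, z 1314050107126 1 2880 (-3) 16,
  z 1314050117206 13 3840 (-17) 16, w 1314050117216 1 1890, w 1314050201016 (-1) 2160,
  z 1314050701016 427 12960 1 16, z 1314051701016 269 60480 (-7) 4,
  z 1314070101015 1783 90720 (-3) 2, z 1314070601015 2867 90720 7 16, w 1314071601015 29 15120,
  w 1314150101012 (-1) 135, w 1314150101016 (-1) 270, z 1314150107126 7 17280 (-5) 16,
  w 1314150201016 1 540, z 1314150601012 1523 120960 (-37) 16, z 1314150607102 379 725760 (-5) 16,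
  z 1314150701016 (-157) 90720 1 2, z 1314150701102 559 45360 (-135) 16, w 1314151601012 (-1) 945,
  z 1314151607102 (-281) 362880 11 16, w 1314151701016 1 945, w 1314151701102 1 945,
  w 1314170101015 1 945, z 1314170201015 (-269) 90720 55 16, z 1314170601015 (-61) 22680 1 2,
  w 1314171601015 (-1) 945, z 1314570101016 (-997) 120960 (-1) 1,
  z 1314571601201 169 48384 (-27) 16, w 1317010101014 (-1) 180, w 1317010101102 (-1) 540,
  w 1317010601014 (-1) 270, z 1317010601045 2089 120960 (-19) 8, w 1317010601145 (-121) 45360,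
  w 1317011601014 1 270, z 1317011601045 167 90720 (-1) 4, w 1317011601145 (-2) 945,
  z 1317050101014 437 45360 (-3) 2, w 1317050101102 (-1) 270, z 1317050601014 191 90720 (-1) 1,
  w 1317051601102 1 540, w 1317150101014 11 1890, w 1317150101102 1 270, w 1317150401102 1 540,
  z 1317150601014 1 504 (-1) 2, w 1317150601102 1 540, w 1317151601104 (-1) 315,
  z 1317151602014 (-157) 120960 7 4, z 1345010701016 1507 72576 39 16,
  z 1345011601012 283 30240 (-83) 16, z 1346050117201 (-13873) 483840 563 32,
  z 1346150107201 61 41472 (-55) 32, z 1346150117201 (-307) 26880 27 4,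
  z 1347010101015 (-53) 6480 (-3) 1, z 1347050101016 (-227) 51840 5 4,
  z 1347050601201 67 483840 (-9) 32, z 1347150101016 47 3360 2 1,
  z 1347151601201 (-523) 145152 7 4, w 1701010101013 (-1) 540, w 1701050101013 7 270,
  z 1701050101034 (-59) 12960 3 1, z 1701050101134 797 90720 3 2, z 1701050601034 (-311) 72576 5 4,
  z 1701050601134 6103 362880 (-9) 8, w 1701051601013 1 540, z 1701051601034 (-1399) 30240 51 16,
  z 1701051601134 893 120960 3 2, w 1701150101013 1 270, w 1701150101134 1 105,
  w 1701150601013 1 540, z 1701150601134 (-2423) 362880 (-9) 4,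
  z 1701151601034 (-257) 51840 (-1) 1, w 1702010101013 (-17) 4320, w 1702050101013 1 432,
  w 1702150101013 (-1) 432, w 1702150401013 (-1) 864, w 1702150601013 (-1) 432,
  w 1704010101013 (-11) 480, w 1704010601013 1 144, w 1704011601013 1 2160,
  z 1704050101013 (-53) 45360 3 2, z 1704050601013 (-7) 8640 5 8, z 1704051201013 (-79) 18144 17 4,
  z 1704051601013 71 45360 7 16, w 1704121601013 1 720, z 1704151601013 2029 181440 (-1) 2,
  z 1704151602013 10573 725760 (-37) 4, w 1714010101013 (-1) 60, w 1714010601013 (-1) 90,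
  z 1714010601035 (-1195) 36288 7 8, z 1714010601135 (-409) 60480 1 4, w 1714011601013 1 90,
  z 1714050101013 (-643) 45360 3 1, z 1714050601013 (-71) 4032 9 16, w 1714150101013 (-23) 1890,
  z 1714150201103 (-173) 12960 23 2, z 1714150602013 32071 1451520 (-433) 32,
  w 1714151601013 1 315, z 1745010601013 (-6137) 362880 (-15) 16, z 3401050101012 79 30240 15 8,
  z 3401050107126 1 720 (-1) 4, w 3401050107206 (-1) 945, z 3401050601012 2521 362880 (-39) 8,
  z 3401050607012 (-229) 241920 15 16, z 3401050617012 (-13) 2520 97 32,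
  z 3401050701012 (-233) 22680 63 8, z 3401050701062 1 560 (-1) 1,
  z 3401050712016 (-10771) 725760 399 32, z 3401051601012 2549 362880 (-21) 8,
  z 3401051607012 (-5657) 725760 4 1, z 3401051617012 1387 1451520 (-25) 32,
  z 3401051701012 95 36288 (-71) 32, z 3401051701016 (-1847) 40320 3 8,
  z 3401051701612 (-117169) 1451520 819 16, z 3401057201016 2945 193536 (-279) 32,
  w 3401070101012 (-1) 960, z 3401070201015 197 22680 (-49) 8, w 3401070601012 (-1) 864,
  z 3401070601015 149 24192 (-1) 16, z 3401070601052 121 362880 9 16,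
  z 3401070601215 (-14437) 725760 391 32, z 3401070602015 1201 362880 (-33) 16,
  z 3401071201015 619 45360 (-15) 2, w 3401071601012 1 864, w 3401071601015 (-989) 24192,
  z 3401071601052 12653 483840 (-135) 8, z 3401076201105 479 181440 (-39) 16,
  z 3401150101012 (-13) 6480 (-3) 1, z 3401150107126 (-79) 120960 (-3) 16,
  z 3401150107206 (-4183) 414720 213 32, z 3401150117206 6997 483840 (-295) 32,
  w 3401150117216 1 1890, z 3401150617012 5237 725760 (-4) 1, z 3401150701012 59 25920 (-1) 4,
  z 3401150701016 (-21571) 362880 (-7) 8, z 3401150701062 277 12096 (-217) 16,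
  z 3401150702016 (-859) 51840 77 8, z 3401150712016 77017 1451520 (-1039) 32,
  z 3401151607012 (-1297) 32256 791 32, z 3401151617012 139 22680 (-39) 8,
  z 3401151701012 (-689) 45360 37 4, z 3401151701016 (-101) 24192 3 1,
  z 3401151701162 377 181440 (-15) 8, z 3401151701602 2045 48384 (-867) 32,
  z 3401151712016 (-2501) 181440 159 16, w 3401170101012 1 960, z 3401170101015 23 5040 27 8,
  z 3401170101502 197 9072 (-247) 16, z 3401170102156 (-114829) 1451520 801 16,
  w 3401170601012 1 1440, z 3401170601052 419 20736 (-423) 32,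
  z 3401170601512 26507 1451520 (-181) 16, z 3401171201015 617 45360 (-15) 2,
  w 3401171601012 (-1) 480, z 3401171601015 (-491) 72576 37 16, z 3401171612015 2399 362880 (-5) 1,
  w 3401520101016 1 160, z 3401521701016 73 20160 (-13) 16, z 3401560117012 (-479) 181440 39 16,
  w 3401570101012 (-31) 22680, z 3401570101016 379 40320 (-1) 8,
  z 3401570101612 1429 362880 (-45) 16, z 3401720601015 (-3431) 580608 101 32,
  z 3401721601015 7 1920 (-25) 16, w 3504010201016 (-1) 540, z 3504010607012 (-5011) 725760 37 8,
  z 3504010617201 21887 1451520 (-151) 16, z 3504010701016 (-289) 120960 1 1,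
  z 3504010712016 (-563) 32256 11 1, w 3504011201016 (-1) 1080,
  z 3504011617201 27127 1451520 (-379) 32, z 3504011701012 4573 362880 (-113) 16,
  w 3507010201014 (-1) 1890, z 3507011201014 (-11) 36288 3 4, z 3507011602014 2071 725760 (-45) 16,
  z 3507011612014 157 181440 (-1) 4, w 3514010201016 (-1) 1080, z 3514010601012 (-451) 72576 19 8,
  z 3514010617201 617 207360 (-65) 32, z 3514010701012 13 36288 (-9) 8, w 3514011201016 1 540,
  z 3514011617012 1381 145152 (-113) 16, z 3514011701201 (-487) 181440 49 16,
  z 3517010201014 (-437) 60480 1 4, z 3517010602014 (-2237) 90720 239 16,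
  z 3517010612014 19781 1451520 (-253) 32, w 3517011201014 1 2160,
  z 3604050107012 (-3229) 725760 47 16, z 3604050117201 71 69120 (-29) 32,
  z 3604070112015 (-529) 241920 5 4, z 3604150107012 (-241) 161280 17 16,
  z 3604150117201 25523 1451520 (-193) 16, z 3604170102015 (-157) 181440 1 4,
  z 3604170112015 0 1 3 8, z 3607050112014 59 40320 (-1) 1, z 3607150102014 (-13) 45360 1 4,
  z 3607150112014 29 72576 (-1) 4, z 3614150107201 1475 290304 (-97) 32,
  z 3614150117012 265 48384 (-55) 16, z 3617050112014 13 45360 (-1) 4,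
  z 3617150102014 (-149) 362880 1 2, z 3647010112015 1039 483840 (-13) 16,
  w 3701010101012 (-1) 1080, w 3701010101014 1 15, w 3701010101402 1 480, w 3701010101412 (-1) 480,
  z 3701010201045 (-31) 7560 19 8, z 3701010201145 (-311) 25920 345 32,
  z 3701010601045 169 90720 1 1, z 3701010601145 (-4117) 362880 (-3) 8, w 3701010601402 13 4320,
  w 3701010601412 (-1) 720, z 3701011601045 13 30240 2 1, z 3701011601145 901 72576 (-41) 8,
  w 3701011601402 (-1) 720, w 3701011601412 1 720, z 3701011602145 157 120960 (-3) 16,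
  w 3701020101014 (-1) 1440, w 3701050101012 1 120, z 3701050101014 (-13) 11340 (-15) 8,
  z 3701050102046 (-379) 362880 11 16, z 3701050112046 (-983) 48384 451 32,
  z 3701050601014 (-173) 40320 1 4, w 3701050601042 23 51840, z 3701050601142 3571 580608 (-93) 32,
  z 3701050612014 (-269) 24192 135 16, w 3701051601012 31 4320, z 3701051601042 (-31) 241920 19 16,
  z 3701051602014 3979 725760 (-23) 8, z 3701051612014 6361 207360 (-619) 32,
  w 3701120101014 1 1440, w 3701120601014 1 2160, w 3701121601014 1 1080, w 3701150101012 (-1) 120,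
  z 3701150101014 7 12960 3 1, z 3701150101214 (-17) 90720 3 8,
  z 3701150102046 6109 1451520 (-103) 32, z 3701150102146 (-557) 72576 63 16,
  z 3701150201014 (-323) 15120 387 32, w 3701150601012 (-23) 4320,
  z 3701150601042 (-2461) 414720 125 32, z 3701150602014 2255 72576 (-609) 32,
  z 3701151601014 (-191) 24192 3 2, z 3701151601142 (-89) 60480 1 2,
  z 3701151601204 137 72576 (-5) 8, z 3701151602014 6253 483840 (-285) 32,
  z 3701520601104 1429 362880 (-45) 16, z 3704010101015 505 18144 3 2,
  z 3704010101052 (-1) 360 9 8, z 3704010112056 299 362880 (-1) 8, w 3704010601012 7 4320,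
  z 3704010601015 109 60480 3 8, z 3704010601512 (-23) 181440 (-3) 8,
  z 3704010612015 (-11479) 483840 463 32, z 3704011201015 295 24192 (-65) 8,
  z 3704011601015 79 120960 (-3) 16, z 3704011601052 121 90720 (-1) 8,
  z 3704011601512 (-11) 24192 3 16, z 3704011612015 13327 1451520 (-87) 16,
  z 3704050101012 (-17) 90720 3 8, z 3704050601012 (-533) 362880 15 16,
  z 3704051601201 (-613) 725760 (-9) 16, z 3704150101012 (-83) 13440 53 32,
  z 3714010601015 3223 181440 5 16, z 3714011201015 (-109) 181440 5 16,
  z 3714011601015 331 181440 (-5) 4, z 3714050601201 367 241920 (-19) 16,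
  z 3714150102016 319 207360 (-19) 32, z 3714150601201 (-961) 362880 3 16,
  z 3714151601012 151 60480 (-23) 16, z 3745010601012 197 120960 (-17) 8,
  z 7401050201013 4 2835 (-1) 4, z 7401050612013 7933 290304 (-545) 32,
  z 7401051201013 37 12960 (-3) 4, z 7401051601103 (-703) 60480 1 16,
  z 7401056201013 1751 138240 (-61) 8, z 7401150612013 (-73) 4608 81 8,
  z 7401151201013 3001 181440 (-155) 16, z 7401151601013 1 1890 3 4,
  z 7401151602013 26213 1451520 (-193) 16, z 7401520101013 281 22680 (-227) 32,
  z 7401560112013 8137 483840 (-169) 16, z 7504010201013 (-25) 36288 17 16,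
  z 7504011201013 (-53) 90720 3 4, z 7504011602013 193 362880 (-1) 4,
  z 7514010201013 (-211) 22680 7 4, z 7514010602013 (-13) 45360 1 4,
  z 7514010612013 14891 1451520 (-217) 32, w 7514011201013 (-29) 15120, w 7601050102034 1 1890,
  z 7601050102134 7 5184 (-3) 8, z 7601050112034 1 5760 (-1) 16, w 7601050112134 5 18144,
  z 7601150102034 28481 2903040 (-213) 32, z 7601150102134 41 181440 (-5) 8,
  z 7601150112034 (-1357) 96768 291 32, z 7604150112013 (-157) 181440 1 4,
  z 7614050112013 (-521) 241920 13 16, z 7614150102013 191 181440 (-1) 2]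

/-- The rows of a linear combination of Leibniz graphs with `k` wedges. The digits of the code are
the targets of the wedges, and the three targets of the trident. The rational parts and the
`ζ(3)² / π⁶`-parts of the coefficients are the two linear combinations in the theorem. -/
def leibnizRows : ℕ → List Row
  | 1 => leibnizRows1
  | 2 => leibnizRows2
  | 3 => leibnizRows3
  | 4 => leibnizRows4
  | 5 => leibnizRows5
  | _ => []

/-! ### Computations with the lists of graphs -/

def digit (c e : ℕ) : ℕ := Nat.mod (Nat.div c (Nat.pow 10 e)) 10

/-- The packed form of a graph from its code. -/
def packCode (n c : ℕ) : ℕ :=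
  packBytes (fun v => digit c (Nat.sub (Nat.mul 2 n) (Nat.add 1 (Nat.mul 2 v))))
    (fun v => digit c (Nat.sub (Nat.mul 2 n) (Nat.add 2 (Nat.mul 2 v)))) n

def arrivals (g n t : ℕ) : ℕ := loopSum (fun u => Nat.add (ind (lf g u) t) (ind (rt g u) t)) n

/-- The properties of a packed affine Kontsevich graph without odd automorphisms. -/
def isGood (n g : ℕ) : Bool :=
  force (colors n g 6) fun C => loopAll (fun v => force (lf g v) fun l => force (rt g v) fun r =>
    sel (Nat.ble l (Nat.add n 1)) (sel (Nat.ble r (Nat.add n 1))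
      (sel (Nat.beq l (Nat.add v 2)) false (sel (Nat.beq r (Nat.add v 2)) false
        (sel (Nat.beq (cell C l) (cell C r)) false
          (Nat.ble (arrivals g n (Nat.add v 2)) 1)))) false) false) n

def packedKey (n g : ℕ) : ℕ :=
  force (colors n g 6) fun C => loopSum (fun v => cell C (Nat.add v 2)) n

def packedKeys (n : ℕ) (L : List Row) : List ℕ :=
  List.rec [] (fun r _ ih => force (force (packCode n r.graph) (packedKey n)) fun N => N :: ih) L

def areDistinct (n : ℕ) (L : List Row) : Bool :=
  -- The hash is less than 1000000007, which is below 2 ^ 30; this explains the fuel.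
  sel (allOf (fun r => force (packCode n r.graph) (isGood n)) L) (distinct 30 (packedKeys n L)) false

/-- The term number `i` of the expansion of the Leibniz graph with the code `c`. -/
def packTerm (k c i : ℕ) : ℕ :=
  packBytes (fun v => digit c (sel (Nat.ble k v) (sel (Nat.beq v k) (Nat.sub 2 i)
      (Nat.sub 2 (Nat.mod (Nat.add i 1) 3))) (Nat.sub (Nat.add (Nat.mul 2 k) 2) (Nat.mul 2 v))))
    (fun v => sel (Nat.beq v k) (Nat.add k 3) (digit c (sel (Nat.ble k v)
      (Nat.sub 2 (Nat.mod (Nat.add i 2) 3)) (Nat.sub (Nat.add (Nat.mul 2 k) 1) (Nat.mul 2 v)))))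
    (Nat.add k 2)

/-- Whether a code is the code of an affine Leibniz graph. -/
def isLeibniz (k c : ℕ) : Bool :=
  force (packCode k (Nat.div c 1000)) fun g => force (digit c 2) fun t₀ => force (digit c 1) fun t₁ =>
  force (digit c 0) fun t₂ =>
    sel (loopAll (fun v => force (lf g v) fun l => force (rt g v) fun r =>
      sel (Nat.ble l (Nat.add k 2)) (sel (Nat.ble r (Nat.add k 2))
        (sel (Nat.beq l r) false (sel (Nat.beq l (Nat.add v 2)) false
        (sel (Nat.beq r (Nat.add v 2)) false
          (Nat.ble (Nat.add (arrivals g k (Nat.add v 2)) (Nat.add (ind t₀ (Nat.add v 2))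
            (Nat.add (ind t₁ (Nat.add v 2)) (ind t₂ (Nat.add v 2))))) 1)))) false) false) k)
    (sel (Nat.ble t₀ (Nat.add k 1)) (sel (Nat.ble t₁ (Nat.add k 1)) (sel (Nat.ble t₂ (Nat.add k 1))
      (sel (Nat.beq t₀ t₁) false (sel (Nat.beq t₁ t₂) false (sel (Nat.beq t₀ t₂) false
        (Nat.ble (arrivals g k (Nat.add k 2)) 2)))) false) false) false) false

def areLeibniz (k : ℕ) (L : List Row) : Bool := allOf (fun r => isLeibniz k r.graph) L

/-- The numerator of a rational number over a common denominator. -/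
def scaled (q : ℚ) : ℤ := Int.mul q.num (Int.ofNat (Nat.div 2903040 q.den))

/-- The number 2903040 = 2^10 · 3^4 · 5 · 7 has to be a multiple of every denominator; otherwise the
integer quotient in `scaled` would round. -/
def areScaled (L : List Row) : Bool :=
  allOf (fun r => sel (Nat.beq (Nat.mod 2903040 r.rat.den) 0)
    (Nat.beq (Nat.mod 2903040 r.zeta.den) 0) false) L

/-- The terms of the `⋆_aff`, with the opposite of the terms of `⋆_aff^red` and of the expansion of
the Leibniz graphs. -/
def allItems (n : ℕ) : List Item :=
  List.rec
    (List.rec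
      (List.rec [] (fun r _ ih =>
        force (force (packTerm (Nat.sub n 2) r.graph 0) (normal n)) fun X =>
        force (force (packTerm (Nat.sub n 2) r.graph 1) (normal n)) fun Y =>
        force (force (packTerm (Nat.sub n 2) r.graph 2) (normal n)) fun Z =>
          (X, Int.neg (scaled r.rat), Int.neg (scaled r.zeta)) ::
          (Y, Int.neg (scaled r.rat), Int.neg (scaled r.zeta)) ::
          (Z, Int.neg (scaled r.rat), Int.neg (scaled r.zeta)) :: ih) (leibnizRows (Nat.sub n 2)))
      (fun r _ ih => force (force (packCode n r.graph) (normal n)) fun X =>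
        (X, Int.neg (scaled r.rat), 0) :: ih) (redRows n))
    (fun r _ ih => force (force (packCode n r.graph) (normal n)) fun X =>
      (X, scaled r.rat, scaled r.zeta) :: ih) (affRows n)

/-! ### Soundness of the tests for affine Kontsevich graphs -/

section Packed

theorem digit_lt (c e : ℕ) : digit c e < 10 := Nat.mod_lt _ (by norm_num)

theorem ofPacked_packCode (n c : ℕ) : ofPacked n (packCode n c) = KGraph.ofCode n c := by
  rw [packCode, ofPacked_packBytes (fun v => (digit_lt _ _).trans (by norm_num))
    (fun v => (digit_lt _ _).trans (by norm_num))]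
  funext v s
  have h (e e' : ℕ) (h : e = e') : digit c e = c / 10 ^ e' % 10 := by rw [h]; rfl
  fin_cases s
  · simp only [KGraph.ofCode, Fin.zero_eta, if_pos]
    rw [h _ (2 * n - 1 - (2 * v.val + 0)) (by simp only [Nat.sub_eq, Nat.add_eq, Nat.mul_eq]; omega)]
  · simp only [KGraph.ofCode, Fin.mk_one, one_ne_zero, if_false]
    rw [h _ (2 * n - 1 - (2 * v.val + 1)) (by simp only [Nat.sub_eq, Nat.add_eq, Nat.mul_eq]; omega)]

namespace KGraph

theorem inDegree_eq_sum {n : ℕ} (Γ : KGraph n) (t : Fin (n + 2)) :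
    Γ.inDegree t = ∑ v, ∑ s, if Γ v s = t then 1 else 0 := by
  rw [inDegree, ← List.toFinset_card_of_nodup (nodup_inEdges Γ t), ← Fintype.sum_prod_type',
    Finset.sum_boole]
  refine congrArg Finset.card ?_
  ext e
  simp [mem_inEdges]

end KGraph

variable {n : ℕ}

theorem arrivals_eq {g : ℕ} (h : ValidPacked n g) (t : Fin (n + 2)) :
    arrivals g n t = (ofPacked n g).inDegree t := by
  rw [arrivals, loopSum_eq, KGraph.inDegree_eq_sum, Finset.sum_range]
  refine Finset.sum_congr rfl fun v _ => ?_
  simp only [Fin.sum_univ_two, Fin.ext_iff, h.val_zero, h.val_one, ind_eq, Nat.add_eq]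

/-- Different colors of the two targets at each vertex exclude double edges and at the same time
make every factor of the orientation nonzero. -/
theorem isGood_spec {g : ℕ} (h : isGood n g = true) : (ofPacked n g).IsKontsevich ∧
    (ofPacked n g).IsAffine ∧ (ofPacked n g).orientation ≠ 0 ∧ ValidPacked n g := by
  simp only [isGood, force_eq, sel_eq, loopAll_eq_true, Bool.if_false_right, Bool.if_false_left,
    Bool.and_eq_true, Bool.not_eq_true', Nat.ble_eq, Nat.add_eq, decide_eq_true_eq,
    decide_eq_false_iff_not, Nat.beq_eq] at h
  have hval : ValidPacked n g := fun v hv => by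
    obtain ⟨h1, h2, -⟩ := h v hv
    omega
  have hcolor (v : Fin n) : (ofPacked n g).color 6 (ofPacked n g v 0) ≠
      (ofPacked n g).color 6 (ofPacked n g v 1) := by
    rw [← cell_colors hval, ← cell_colors hval, hval.val_zero, hval.val_one]
    exact (h v v.isLt).2.2.2.2.1
  refine ⟨fun v => ⟨fun hv => hcolor v (by rw [hv]), fun hv => ?_, fun hv => ?_⟩, fun v => ?_, ?_,
    hval⟩
  · refine (h v v.isLt).2.2.1 ?_
    rw [← hval.val_zero, hv, KGraph.val_aerial]
  · refine (h v v.isLt).2.2.2.1 ?_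
    rw [← hval.val_one, hv, KGraph.val_aerial]
  · rw [← arrivals_eq hval, KGraph.val_aerial]
    exact (h v v.isLt).2.2.2.2.2
  · refine Finset.prod_ne_zero_iff.2 fun v _ => ?_
    have : (((ofPacked n g).color 6 (ofPacked n g v 1) : ℤ) -
        (ofPacked n g).color 6 (ofPacked n g v 0)) ≠ 0 :=
      sub_ne_zero.2 fun h => hcolor v (by exact_mod_cast h.symm)
    rcases lt_or_gt_of_ne this with h | h
    · simp [sign_neg h]
    · simp [sign_pos h]

theorem packedKey_eq {g : ℕ} (h : ValidPacked n g) : packedKey n g = (ofPacked n g).key := by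
  rw [packedKey, force_eq, loopSum_eq, KGraph.key, Finset.sum_range]
  refine Finset.sum_congr rfl fun v _ => ?_
  rw [← cell_colors h, KGraph.val_aerial]

theorem packedKeys_eq (n : ℕ) (L : List Row) :
    packedKeys n L = L.map fun r => packedKey n (packCode n r.graph) := by
  induction L with
  | nil => rfl
  | cons r L ih =>
    have : packedKeys n (r :: L) = force (force (packCode n r.graph) (packedKey n))
      fun N => N :: packedKeys n L := rfl
    rw [this, force_eq, force_eq, ih, List.map_cons]

/-- The graphs in a list that passes the test are different affine Kontsevich graphs. -/
theorem areDistinctAffineGraphs_of_areDistinct {L : List Row} (h : areDistinct n L = true) :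
    AreDistinctAffineGraphs (L.map fun r => KGraph.ofCode n r.graph) := by
  simp only [areDistinct, sel_eq, Bool.if_false_right, Bool.and_eq_true, decide_eq_true_eq,
    allOf_eq_true, force_eq] at h
  have hgood (r : Row) (hr : r ∈ L) := isGood_spec (h.1 r hr)
  simp only [ofPacked_packCode] at hgood
  refine ⟨?_, linearIndependent_graphClass ?_ ?_ ?_⟩
  · simp only [List.forall_mem_map]
    exact fun r hr => ⟨(hgood r hr).1, (hgood r hr).2.1⟩
  · simp only [List.forall_mem_map]
    exact fun r hr => (hgood r hr).2.1
  · simp only [List.forall_mem_map]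
    exact fun r hr => (hgood r hr).2.2.1
  · have := nodup_of_distinct h.2
    rw [packedKeys_eq] at this
    rw [List.map_map]
    convert this using 1
    refine List.map_congr_left fun r hr => ?_
    rw [packedKey_eq (hgood r hr).2.2.2, ofPacked_packCode]
    rfl

/-! ### Leibniz graphs -/

/-- Only one distribution of the arrows gives affine graphs. -/
theorem LeibnizGraph.expand_eq {k : ℕ} (L : LeibnizGraph k) :
    L.expand = ∑ r, graphClass (L.expandTerm ∅ r) := by
  refine Finset.sum_congr rfl fun r _ => Finset.sum_eq_single_of_mem ∅ (by simp) fun S hS hne => ?_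
  refine graphClass_eq_zero fun haff => ?_
  obtain ⟨e, he⟩ := Finset.nonempty_iff_ne_empty.2 hne
  have h := haff (Fin.last (k + 1))
  rw [KGraph.inDegree, Nat.le_one_iff_eq_zero_or_eq_one] at h
  -- An arrow in `S` and the arrow from the upper wedge are two different edges into the lower
  -- wedge, which contradicts affinity.
  have h1 : (e.1.castSucc.castSucc, e.2) ∈
      (L.expandTerm S r).inEdges (KGraph.aerial (Fin.last (k + 1))) := by
    rw [KGraph.mem_inEdges]
    have : (e.1, e.2) ∈ S := he
    simp only [LeibnizGraph.expandTerm, Fin.snoc_castSucc, if_pos this]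
    exact Fin.ext (by simp)
  have h2 : ((Fin.last k).castSucc, 1) ∈
      (L.expandTerm S r).inEdges (KGraph.aerial (Fin.last (k + 1))) := by
    rw [KGraph.mem_inEdges]
    simp only [LeibnizGraph.expandTerm, Fin.snoc_castSucc, Fin.snoc_last]
    exact Fin.ext (by simp)
  rcases h with h | h
  · rw [List.length_eq_zero_iff.1 h] at h1
    simp at h1
  · obtain ⟨a, ha⟩ := List.length_eq_one_iff.1 h
    rw [ha, List.mem_singleton] at h1 h2
    have := congrArg (fun x => x.1.val) (h1.trans h2.symm)
    have := e.1.isLt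
    simp at *
    omega

/-- The wedges occupy the digits 2k + 2, …, 3 of the code and the trident the digits 2, 1, 0. -/
def codeWedge (k c : ℕ) (v : Fin k) (s : Fin 2) : Fin (k + 3) :=
  Fin.ofNat (k + 3) (digit c (2 * k + 2 - (2 * v.val + s.val)))

def codeTrident (k c : ℕ) (s : Fin 3) : Fin (k + 3) := Fin.ofNat (k + 3) (digit c (2 - s.val))

/-- The code `c` is the code of a Leibniz graph. -/
structure IsLeibnizCode (k c : ℕ) : Prop where
  wedge_ne : ∀ v, codeWedge k c v 0 ≠ codeWedge k c v 1
  wedge_no_loop : ∀ v s, (codeWedge k c v s).val ≠ v.val + 2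
  trident_injective : Function.Injective (codeTrident k c)
  trident_no_loop : ∀ s, (codeTrident k c s).val ≠ k + 2

/-- The Leibniz graph with the code `c`. -/
def IsLeibnizCode.graph {k c : ℕ} (h : IsLeibnizCode k c) : LeibnizGraph k where
  wedge := codeWedge k c
  trident := codeTrident k c
  wedge_ne := h.wedge_ne
  wedge_no_loop := h.wedge_no_loop
  trident_injective := h.trident_injective
  trident_no_loop := h.trident_no_loop

/-- The bound on `k` is what makes the new vertex `k + 3` fit into four bits. -/
theorem packTerm_lt {k : ℕ} (hk : k ≤ 5) (c i : ℕ) :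
    (∀ v, digit c (sel (Nat.ble k v) (sel (Nat.beq v k) (Nat.sub 2 i)
      (Nat.sub 2 (Nat.mod (Nat.add i 1) 3))) (Nat.sub (Nat.add (Nat.mul 2 k) 2) (Nat.mul 2 v))) <
        16) ∧
    ∀ v, sel (Nat.beq v k) (Nat.add k 3) (digit c (sel (Nat.ble k v)
      (Nat.sub 2 (Nat.mod (Nat.add i 2) 3)) (Nat.sub (Nat.add (Nat.mul 2 k) 1) (Nat.mul 2 v)))) <
        16 := by
  refine ⟨fun v => (digit_lt _ _).trans (by norm_num), fun v => ?_⟩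
  rw [sel_eq]
  split_ifs
  · simp only [Nat.add_eq]
    omega
  · exact (digit_lt _ _).trans (by norm_num)

/-- The bounds on the digits are needed since a Leibniz code is read modulo `k + 3` whereas a packed
term of the expansion is read modulo `k + 4`. -/
theorem expandTerm_eq_ofPacked {k c : ℕ} (hk : k ≤ 5) (h : IsLeibnizCode k c)
    (hw : ∀ (v : Fin k) (s : Fin 2), digit c (2 * k + 2 - (2 * v.val + s.val)) < k + 3)
    (ht : ∀ s : Fin 3, digit c (2 - s.val) < k + 3) (r : Fin 3) :
    h.graph.expandTerm ∅ r = ofPacked (k + 2) (packTerm k c r) := by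
  have h3 (s : Fin 3) : (codeTrident k c s).castSucc = Fin.ofNat (k + 4) (digit c (2 - s.val)) := by
    apply Fin.ext
    have := ht s
    simp only [codeTrident, Fin.val_castSucc, Fin.val_ofNat]
    rw [Nat.mod_eq_of_lt this, Nat.mod_eq_of_lt (by omega)]
  rw [packTerm, Nat.add_eq, ofPacked_packBytes (packTerm_lt hk c r).1 (packTerm_lt hk c r).2]
  funext v s
  induction v using Fin.lastCases with
  | last =>
    simp only [LeibnizGraph.expandTerm, Fin.snoc_last]
    fin_cases s
    · simp [IsLeibnizCode.graph, h3, sel_eq, Fin.val_add]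
      rfl
    · simp [IsLeibnizCode.graph, h3, sel_eq, Fin.val_add]
      rfl
  | cast v =>
    induction v using Fin.lastCases with
    | last =>
      simp only [LeibnizGraph.expandTerm, Fin.snoc_castSucc, Fin.snoc_last]
      fin_cases s
      · simp [IsLeibnizCode.graph, h3, sel_eq]
      · simp [sel_eq]
    | cast v =>
      simp only [LeibnizGraph.expandTerm, Fin.snoc_castSucc]
      have h1 := hw v s
      have hv : ¬ k ≤ v.val := by omega
      have hv' : v.val ≠ k := by omega
      apply Fin.ext
      simp only [IsLeibnizCode.graph, codeWedge, Finset.notMem_empty, if_false, Fin.val_castSucc,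
        Fin.val_ofNat]
      rw [Nat.mod_eq_of_lt h1]
      fin_cases s
      · simp [sel_eq, hv] at h1 ⊢
        rw [Nat.mod_eq_of_lt (by omega)]
      · have : 2 * k + 2 - (2 * v.val + 1) = 2 * k + 1 - 2 * v.val := by omega
        simp [sel_eq, hv, hv', this] at h1 ⊢
        rw [Nat.mod_eq_of_lt (by omega)]

theorem digit_div_thousand (c e : ℕ) : digit (c / 1000) e = digit c (e + 3) := by
  change c / 1000 / 10 ^ e % 10 = c / 10 ^ (e + 3) % 10
  rw [Nat.div_div_eq_div_mul, pow_add, mul_comm (10 ^ e)]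
  norm_num

namespace LeibnizGraph

variable {k : ℕ} (L : LeibnizGraph k) (t : Fin (k + 3))

theorem mem_wedgeInEdges {e : Fin k × Fin 2} : e ∈ L.wedgeInEdges t ↔ L.wedge e.1 e.2 = t := by
  simp only [wedgeInEdges, List.mem_filter, decide_eq_true_eq, and_iff_right_iff_imp]
  exact fun _ => List.mem_product.2 ⟨List.mem_finRange _, List.mem_finRange _⟩

theorem mem_tridentInEdges {s : Fin 3} : s ∈ L.tridentInEdges t ↔ L.trident s = t := by
  simp [tridentInEdges]

theorem nodup_wedgeInEdges : (L.wedgeInEdges t).Nodup :=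
  ((List.nodup_finRange k).product (List.nodup_finRange 2)).filter _

theorem nodup_tridentInEdges : (L.tridentInEdges t).Nodup := (List.nodup_finRange 3).filter _

end LeibnizGraph

/-- The digit bounds are exported together with affinity because `expandTerm_eq_ofPacked` depends on
them. -/
theorem isLeibniz_spec {k c : ℕ} (h : isLeibniz k c = true) : ∃ h : IsLeibnizCode k c,
    h.graph.IsAffine ∧
      (∀ (v : Fin k) (s : Fin 2), digit c (2 * k + 2 - (2 * v.val + s.val)) < k + 3) ∧
      ∀ s : Fin 3, digit c (2 - s.val) < k + 3 := by
  have hdiv : c.div 1000 = c / 1000 := rfl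
  simp only [isLeibniz, hdiv, force_eq, sel_eq, loopAll_eq_true, Bool.if_false_right, Bool.if_false_left,
    Bool.and_eq_true, Bool.not_eq_true', Nat.ble_eq, Nat.add_eq, decide_eq_true_eq,
    decide_eq_false_iff_not, Nat.beq_eq] at h
  obtain ⟨hwedge, h0, h1, h2, h01, h12, h02, htri⟩ := h
  -- Division by 1000 removes the trident, after which the wedges are packed as if they formed a
  -- Kontsevich graph.
  have hlf (v : Fin k) : lf (packCode k (c / 1000)) v = digit c (2 * k + 2 - 2 * v.val) ∧
      rt (packCode k (c / 1000)) v = digit c (2 * k + 2 - (2 * v.val + 1)) := by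
    have := lf_rt_packBytes (n := k)
      (fun v => (digit_lt (c / 1000) (Nat.sub (Nat.mul 2 k) (Nat.add 1 (Nat.mul 2 v)))).trans (by norm_num))
      (fun v => (digit_lt (c / 1000) (Nat.sub (Nat.mul 2 k) (Nat.add 2 (Nat.mul 2 v)))).trans (by norm_num))
      v.isLt
    rw [packCode, this.1, this.2, digit_div_thousand, digit_div_thousand]
    have hv := v.isLt
    simp only [Nat.sub_eq, Nat.add_eq, Nat.mul_eq]
    exact ⟨congrArg _ (by omega), congrArg _ (by omega)⟩
  have hbound (v : Fin k) (s : Fin 2) : digit c (2 * k + 2 - (2 * v.val + s.val)) < k + 3 := by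
    obtain ⟨h1, h2, -⟩ := hwedge v v.isLt
    rw [(hlf v).1] at h1
    rw [(hlf v).2] at h2
    fin_cases s
    · exact Nat.lt_succ_of_le h1
    · exact Nat.lt_succ_of_le h2
  have hbound' (s : Fin 3) : digit c (2 - s.val) < k + 2 := by
    fin_cases s
    · exact Nat.lt_succ_of_le h0
    · exact Nat.lt_succ_of_le h1
    · exact Nat.lt_succ_of_le h2
  have hval (v : Fin k) (s : Fin 2) :
      (codeWedge k c v s).val = digit c (2 * k + 2 - (2 * v.val + s.val)) :=
    Nat.mod_eq_of_lt (hbound v s)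
  have hval' (s : Fin 3) : (codeTrident k c s).val = digit c (2 - s.val) :=
    Nat.mod_eq_of_lt ((hbound' s).trans (Nat.lt_succ_self _))
  have hval0 (v : Fin k) : (codeWedge k c v 0).val = lf (packCode k (c / 1000)) v := by
    rw [hval, (hlf v).1]; rfl
  have hval1 (v : Fin k) : (codeWedge k c v 1).val = rt (packCode k (c / 1000)) v := by
    rw [hval, (hlf v).2]; rfl
  have hcode : IsLeibnizCode k c := by
    refine ⟨fun v hv => ?_, fun v s hv => ?_, fun s s' hs => ?_, fun s => ?_⟩
    · refine (hwedge v v.isLt).2.2.1 ?_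
      rw [← hval0, ← hval1, hv]
    · obtain ⟨-, -, -, h3, h4, -⟩ := hwedge v v.isLt
      rw [← hval0] at h3
      rw [← hval1] at h4
      fin_cases s
      · exact h3 hv
      · exact h4 hv
    · have := congrArg Fin.val hs
      rw [hval', hval'] at this
      fin_cases s <;> fin_cases s' <;> first | rfl | (exfalso; simp at this; omega)
    · rw [hval']
      exact (hbound' s).ne
  -- `arrivals_eq` does not apply here: the trident `k + 2` is an admissible target of the wedges,
  -- but it is not a vertex of a Kontsevich graph with `k` wedges.
  have hdeg (t : Fin (k + 3)) :
      (hcode.graph.wedgeInEdges t).length = arrivals (packCode k (c / 1000)) k t := by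
    rw [arrivals, loopSum_eq, Finset.sum_range,
      ← List.toFinset_card_of_nodup (hcode.graph.nodup_wedgeInEdges t)]
    simp only [ind_eq, Nat.add_eq, ← hval0, ← hval1, ← Fin.ext_iff]
    rw [← Finset.sum_congr rfl fun v _ => Fin.sum_univ_two fun s =>
      if codeWedge k c v s = t then 1 else 0, ← Fintype.sum_prod_type', Finset.sum_boole]
    refine congrArg Finset.card ?_
    ext e
    rw [List.mem_toFinset, LeibnizGraph.mem_wedgeInEdges, Finset.mem_filter_univ]
    rfl
  have hdeg' (t : Fin (k + 3)) : (hcode.graph.tridentInEdges t).length =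
      ind (digit c 2) t + (ind (digit c 1) t + ind (digit c 0) t) := by
    rw [← List.toFinset_card_of_nodup (hcode.graph.nodup_tridentInEdges t)]
    have (s : Fin 3) : ind (digit c (2 - s.val)) t = if codeTrident k c s = t then 1 else 0 := by
      simp only [ind_eq, ← hval', ← Fin.ext_iff]
    have h3 := this 0
    have h4 := this 1
    have h5 := this 2
    simp only [Fin.val_zero, Fin.val_one, Fin.val_two, Nat.sub_zero, Nat.sub_self,
      Nat.reduceSub] at h3 h4 h5
    rw [h3, h4, h5, ← add_assoc, ← Fin.sum_univ_three fun s =>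
      if codeTrident k c s = t then 1 else 0, Finset.sum_boole]
    refine congrArg Finset.card ?_
    ext e
    rw [List.mem_toFinset, LeibnizGraph.mem_tridentInEdges, Finset.mem_filter_univ]
    rfl
  refine ⟨hcode, ⟨fun t ht ht' => ?_, ?_⟩, hbound, fun s => (hbound' s).trans (Nat.lt_succ_self _)⟩
  · have := (hwedge (t - 2) (by omega)).2.2.2.2.2
    rw [Nat.sub_add_cancel ht] at this
    rwa [LeibnizGraph.inDegree, hdeg, hdeg']
  · rw [LeibnizGraph.inDegree, hdeg, hdeg']
    have h3 := hbound' 0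
    have h4 := hbound' 1
    have h5 := hbound' 2
    simp only [Fin.val_zero, Fin.val_one, Fin.val_two, Nat.sub_zero, Nat.sub_self,
      Nat.reduceSub] at h3 h4 h5
    -- The trident has no loop, so only wedge edges count in its in-degree.
    simp only [ind_eq, Fin.val_last, h3.ne, h4.ne, h5.ne, if_false, add_zero]
    exact htri

end Packed

/-! ### From cancelling terms to identities in the graph space -/

section Packed

variable {n : ℕ}

/-- The sign stored in the normal form compensates the one from the isomorphism, so an item stands
for the original graph. -/
theorem itemClass_normal (n g : ℕ) (φ : Item → ℤ) (x : ℤ × ℤ) :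
    itemClass n φ (normal n g, x) = (φ (normal n g, x) : ℚ) • graphClass (ofPacked n g) := by
  rw [itemClass, graphClass_normal n g, smul_smul]

theorem allItems_eq (n : ℕ) : allItems n =
    ((affRows n).map fun r => (normal n (packCode n r.graph), scaled r.rat, scaled r.zeta)) ++
    (((redRows n).map fun r => (normal n (packCode n r.graph), -scaled r.rat, 0)) ++
    (leibnizRows (n - 2)).flatMap fun r => (List.range 3).map fun i =>
      (normal n (packTerm (n - 2) r.graph i), -scaled r.rat, -scaled r.zeta)) := by
  rw [allItems]
  induction affRows n with
  | cons r L ih =>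
    simp only [force_eq] at ih ⊢
    rw [ih]; rfl
  | nil =>
    induction redRows n with
    | cons r L ih =>
      simp only [force_eq] at ih ⊢
      rw [ih]; rfl
    | nil =>
      induction leibnizRows (n - 2) with
      | cons r L ih =>
        simp only [force_eq, List.map_nil, List.nil_append] at ih ⊢
        rw [List.flatMap_cons, ← ih]; rfl
      | nil => rfl

theorem cast_scaled {q : ℚ} (h : 2903040 % q.den = 0) : (scaled q : ℚ) = 2903040 * q := by
  obtain ⟨m, hm⟩ := Nat.dvd_of_mod_eq_zero h
  have h1 : scaled q = q.num * ((2903040 / q.den : ℕ) : ℤ) := rfl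
  have h2 : 2903040 / q.den = m := by rw [hm, Nat.mul_div_cancel_left _ q.den_pos]
  have h3 : (2903040 : ℚ) = q.den * m := by exact_mod_cast hm
  rw [h1, h2, h3]
  nth_rw 3 [← Rat.num_div_den q]
  have := q.den_nz
  push_cast
  field_simp

theorem areScaled_spec {L : List Row} (h : areScaled L = true) :
    ∀ r ∈ L, (scaled r.rat : ℚ) = 2903040 * r.rat ∧ (scaled r.zeta : ℚ) = 2903040 * r.zeta := by
  intro r hr
  rw [areScaled, allOf_eq_true] at h
  have := h r hr
  simp only [sel_eq, Bool.if_false_right, Bool.and_eq_true, decide_eq_true_eq, Nat.beq_eq] at this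
  exact ⟨cast_scaled this.1, cast_scaled this.2⟩

/-- The linear combination of Leibniz graphs with the coefficients `q`. -/
noncomputable def leibnizSum (q : Row → ℚ) : LeibnizSum := by
  classical exact fun k => ((leibnizRows k).map fun r =>
    if h : IsLeibnizCode k r.graph then Finsupp.single h.graph (q r) else 0).sum

/-- A nonzero coefficient can only come from a listed code, and all of these passed the test. -/
theorem isAffine_of_areLeibniz {q : Row → ℚ} {k : ℕ}
    (h : areLeibniz k (leibnizRows k) = true) {L : LeibnizGraph k} (hL : leibnizSum q k L ≠ 0) :
    L.IsAffine := by
  rw [areLeibniz, allOf_eq_true] at h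
  by_contra hne
  refine hL ?_
  rw [leibnizSum]
  generalize leibnizRows k = R at h
  induction R with
  | nil => rfl
  | cons r R ih =>
    obtain ⟨hr, haff, -⟩ := isLeibniz_spec (h r List.mem_cons_self)
    rw [List.map_cons, List.sum_cons, Finsupp.add_apply,
      ih fun r hr => h r (List.mem_cons_of_mem _ hr), dif_pos hr, add_zero]
    refine Finsupp.single_eq_of_ne fun e => hne ?_
    rwa [e]

theorem expand_leibnizSum (q : Row → ℚ) {k : ℕ} (hk : k ≤ 5)
    (h : areLeibniz k (leibnizRows k) = true) :
    (leibnizSum q).expand (k + 2) = ((leibnizRows k).map fun r => q r •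
      ((List.range 3).map fun i => graphClass (ofPacked (k + 2) (packTerm k r.graph i))).sum).sum := by
  have hexp : (leibnizSum q).expand (k + 2) =
      Finsupp.linearCombination ℚ LeibnizGraph.expand (leibnizSum q k) := rfl
  rw [areLeibniz, allOf_eq_true] at h
  rw [hexp, leibnizSum, map_list_sum, List.map_map]
  refine congrArg List.sum (List.map_congr_left fun r hr => ?_)
  obtain ⟨hr, -, hw, ht⟩ := isLeibniz_spec (h r hr)
  rw [Function.comp_apply, dif_pos hr, Finsupp.linearCombination_single, LeibnizGraph.expand_eq,
    Fin.sum_univ_three]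
  simp only [expandTerm_eq_ofPacked hk hr hw ht]
  simp [List.range_succ, add_assoc]

theorem sum_smul_eq {ι : Type*} {M : Type*} [AddCommGroup M] [Module ℚ M] {L : List ι}
    {x y : ι → ℚ} (c : ℚ) (v : ι → M) (h : ∀ r ∈ L, x r = c * y r) :
    (L.map fun r => x r • v r).sum = c • (L.map fun r => y r • v r).sum := by
  rw [List.smul_sum, List.map_map]
  refine congrArg List.sum (List.map_congr_left fun r hr => ?_)
  rw [Function.comp_apply, smul_smul, h r hr]

theorem sum_map_flatMap {α β M : Type*} [AddMonoid M] (L : List α) (f : α → List β) (g : β → M) :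
    ((L.flatMap f).map g).sum = (L.map fun r => ((f r).map g).sum).sum := by
  induction L with
  | nil => rfl
  | cons r L ih => rw [List.flatMap_cons, List.map_append, List.sum_append, ih, List.map_cons,
      List.sum_cons]

/-- The cancelling sum is 2903040 times the difference of the two sides. The reduced expansion
enters with second coefficient zero, whence its absence from the second identity. -/
theorem sumClass_rat_zeta {k : ℕ} (hk : k ≤ 5) (hL : areLeibniz k (leibnizRows k) = true)
    (h1 : areScaled (affRows (k + 2)) = true) (h2 : areScaled (redRows (k + 2)) = true)
    (h3 : areScaled (leibnizRows k) = true) (h : cancels (k + 2) 31 (allItems (k + 2)) = true) :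
    sumClass (starAffRat (k + 2)) =
      sumClass (starRed (k + 2)) + (leibnizSum Row.rat).expand (k + 2) ∧
    sumClass (starAffZeta (k + 2)) = (leibnizSum Row.zeta).expand (k + 2) := by
  have hD : (2903040 : ℚ) ≠ 0 := by norm_num
  have h4 := areScaled_spec h1
  have h5 := areScaled_spec h2
  have h6 := areScaled_spec h3
  have hneg {x y : ℚ} (h : x = 2903040 * y) : -x = -2903040 * y := by rw [h, neg_mul]
  have hsum (x : ℚ) (v : ℕ → GraphSpace (k + 2)) : ((List.range 3).map fun i => x • v i).sum =
      x • ((List.range 3).map v).sum := by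
    rw [List.smul_sum, List.map_map]
    rfl
  obtain ⟨e1, e2⟩ := sum_itemClass_eq_zero h
  rw [allItems_eq] at e1 e2
  simp only [List.map_append, List.sum_append, List.map_map, Function.comp_def, itemClass_normal,
    sum_map_flatMap, ofPacked_packCode, Nat.add_sub_cancel, hsum, Int.cast_neg] at e1 e2
  rw [expand_leibnizSum _ hk hL, expand_leibnizSum _ hk hL]
  simp only [sumClass, starAffRat, starAffZeta, starRed, starAff, List.map_map, Function.comp_def]
  constructor
  · rw [sum_smul_eq _ _ fun r hr => (h4 r hr).1, sum_smul_eq _ _ fun r hr => hneg (h5 r hr).1,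
      sum_smul_eq _ _ fun r hr => hneg (h6 r hr).1, neg_smul, neg_smul, ← neg_add, ← sub_eq_add_neg,
      sub_eq_zero, ← smul_add] at e1
    -- The common denominator is divided out.
    exact smul_right_injective _ hD e1
  · simp only [Int.cast_zero, zero_smul, List.map_const', List.sum_replicate, smul_zero,
      zero_add] at e2
    rw [sum_smul_eq _ _ fun r hr => (h4 r hr).2, sum_smul_eq _ _ fun r hr => hneg (h6 r hr).2,
      neg_smul, ← sub_eq_add_neg, sub_eq_zero] at e2
    exact smul_right_injective _ hD e2

end Packed

/-! ### The computations -/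

set_option maxRecDepth 100000

/-- That six rounds of refinement separate the listed graphs of each order is established here, by
evaluation. -/
theorem areDistinct_affRows : ∀ n ≤ 7, areDistinct n (affRows n) = true := by decide +kernel

theorem areDistinct_redRows : ∀ n ≤ 7, areDistinct n (redRows n) = true := by decide +kernel

theorem areLeibniz_leibnizRows : ∀ k ≤ 5, areLeibniz k (leibnizRows k) = true := by decide +kernel

theorem areScaled_affRows : ∀ n ≤ 7, areScaled (affRows n) = true := by decide +kernel

theorem areScaled_redRows : ∀ n ≤ 7, areScaled (redRows n) = true := by decide +kernel

theorem areScaled_leibnizRows : ∀ k ≤ 5, areScaled (leibnizRows k) = true := by decide +kernel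

/-- This evaluation carries the factorization. For n ≤ 2 the truncated `n - 2` is 0, where the list
of Leibniz graphs is empty: the two expansions agree up to that order. -/
theorem cancels_allItems : ∀ n ≤ 7, cancels n 31 (allItems n) = true := by decide +kernel

theorem length_affRows : ∑ n ∈ Finset.range 8, (affRows n).length = 1423 := by decide +kernel

theorem length_redRows : ∑ n ∈ Finset.range 8, (redRows n).length = 326 := by decide +kernel

theorem affRows_ne_zero : ∀ n ≤ 7, ∀ r ∈ affRows n, (r.rat, r.zeta) ≠ 0 := by decide +kernel

theorem redRows_ne_zero : ∀ n ≤ 7, ∀ r ∈ redRows n, r.rat ≠ 0 := by decide +kernel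

theorem isAffine_of_leibnizSum_ne_zero {q : Row → ℚ} (k : ℕ) {L : LeibnizGraph k}
    (hL : leibnizSum q k L ≠ 0) : L.IsAffine := by
  refine isAffine_of_areLeibniz ?_ hL
  by_cases hk : k ≤ 5
  · exact areLeibniz_leibnizRows k hk
  · have : leibnizRows k = [] := by
      unfold leibnizRows
      split <;> first | omega | rfl
    rw [this]
    rfl

theorem sumClass_starAff {n : ℕ} (hn : n ≤ 7) :
    sumClass (starAffRat n) = sumClass (starRed n) + (leibnizSum Row.rat).expand n ∧
      sumClass (starAffZeta n) = (leibnizSum Row.zeta).expand n := by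
  match n, hn with
  | k + 2, hn =>
    have hk : k ≤ 5 := by omega
    exact sumClass_rat_zeta hk (areLeibniz_leibnizRows k hk) (areScaled_affRows _ hn)
      (areScaled_redRows _ hn) (areScaled_leibnizRows k hk) (cancels_allItems _ hn)
  -- At the orders 0 and 1 both lists consist of the same single rational term, and Leibniz graphs
  -- contribute zero by definition.
  | 0, _ => 
    constructor <;> simp [sumClass, starAffRat, starAffZeta, starAff, starRed, affRows, redRows,
      affRows0, redRows0, w, LeibnizSum.expand]
  | 1, _ => 
    constructor <;> simp [sumClass, starAffRat, starAffZeta, starAff, starRed, affRows, redRows,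
      affRows1, redRows1, w, LeibnizSum.expand]

/-! ### Iterated partial derivatives -/

section Analysis

open Set

variable {d : ℕ} {U : Set (Fin d → ℝ)} {h h' c : (Fin d → ℝ) → ℝ}

/-- A derivative at a point depends on the germ only, and on an open set equality of functions is
equality of germs. -/
theorem partialDeriv_congr (hU : IsOpen U) (i : Fin d) (hh : EqOn h h' U) :
    EqOn (partialDeriv i h) (partialDeriv i h') U := fun x hx => by
  rw [partialDeriv, partialDeriv, (hh.eventuallyEq_of_mem (hU.mem_nhds hx)).fderiv_eq]

theorem iterPartial_congr (hU : IsOpen U) (l : List (Fin d)) (hh : EqOn h h' U) :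
    EqOn (iterPartial l h) (iterPartial l h') U := by
  induction l with
  | nil => exact hh
  | cons i l ih => exact partialDeriv_congr hU i ih

theorem iterPartial_zero (l : List (Fin d)) : iterPartial l 0 = 0 := by
  induction l with
  | nil => rfl
  | cons i l ih => funext x; simp [iterPartial, ih, partialDeriv]

theorem contDiffOn_partialDeriv (hU : IsOpen U) (i : Fin d) (hh : ContDiffOn ℝ ∞ h U) :
    ContDiffOn ℝ ∞ (partialDeriv i h) U :=
  (hh.fderiv_of_isOpen hU (by simp)).clm_apply contDiffOn_const

theorem contDiffOn_iterPartial (hU : IsOpen U) (l : List (Fin d)) (hh : ContDiffOn ℝ ∞ h U) :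
    ContDiffOn ℝ ∞ (iterPartial l h) U := by
  induction l with
  | nil => exact hh
  | cons i l ih => exact contDiffOn_partialDeriv hU i ih

theorem differentiableAt_iterPartial (hU : IsOpen U) (l : List (Fin d)) (hh : ContDiffOn ℝ ∞ h U)
    {x : Fin d → ℝ} (hx : x ∈ U) : DifferentiableAt ℝ (iterPartial l h) x :=
  ((contDiffOn_iterPartial hU l hh).contDiffAt (hU.mem_nhds hx)).differentiableAt (by simp)

theorem partialDeriv_comm (hU : IsOpen U) (i j : Fin d) (hh : ContDiffOn ℝ ∞ h U) :
    EqOn (partialDeriv i (partialDeriv j h)) (partialDeriv j (partialDeriv i h)) U := by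
  intro x hx
  have hd : DifferentiableAt ℝ (fderiv ℝ h) x :=
    ((hh.fderiv_of_isOpen hU (m := ∞) (by simp)).contDiffAt (hU.mem_nhds hx)).differentiableAt
      (by simp)
  -- Symmetry of the second derivative, by smoothness.
  have hs : IsSymmSndFDerivAt ℝ h x := (hh.contDiffAt (hU.mem_nhds hx)).isSymmSndFDerivAt (by
    rw [minSmoothness_of_isRCLikeNormedField]
    exact WithTop.coe_le_coe.2 le_top)
  have key (i j : Fin d) : partialDeriv i (partialDeriv j h) x =
      fderiv ℝ (fderiv ℝ h) x (Pi.single i 1) (Pi.single j 1) := by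
    have : partialDeriv j h = fun y => fderiv ℝ h y (Pi.single j 1) := rfl
    rw [this, partialDeriv, fderiv_clm_apply hd (differentiableAt_const _)]
    simp
  rw [key, key, hs.eq]

/-- Partial derivatives of smooth functions commute. -/
theorem iterPartial_perm (hU : IsOpen U) {l l' : List (Fin d)} (hl : l.Perm l')
    (hh : ContDiffOn ℝ ∞ h U) : EqOn (iterPartial l h) (iterPartial l' h) U := by
  induction hl with
  | nil => exact fun _ _ => rfl
  | cons i _ ih => exact partialDeriv_congr hU i ih
  | swap i j l => exact partialDeriv_comm hU _ _ (contDiffOn_iterPartial hU l hh)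
  | trans _ _ ih ih' => exact ih.trans ih'

theorem iterPartial_neg (l : List (Fin d)) :
    iterPartial l (fun x => -h x) = fun x => -iterPartial l h x := by
  induction l with
  | nil => rfl
  | cons i l ih =>
    funext x
    simp only [iterPartial, ih, partialDeriv, fderiv_fun_neg]
    rfl

theorem iterPartial_add (hU : IsOpen U) (l : List (Fin d)) (hh : ContDiffOn ℝ ∞ h U)
    (hh' : ContDiffOn ℝ ∞ h' U) :
    EqOn (iterPartial l fun x => h x + h' x) (fun x => iterPartial l h x + iterPartial l h' x) U := by
  induction l with
  | nil => exact fun _ _ => rfl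
  | cons i l ih =>
    refine (partialDeriv_congr hU i ih).trans fun x hx => ?_
    simp only [iterPartial, partialDeriv]
    rw [fderiv_fun_add (differentiableAt_iterPartial hU l hh hx)
      (differentiableAt_iterPartial hU l hh' hx)]
    rfl

theorem iterPartial_sum (hU : IsOpen U) (l : List (Fin d)) {ι : Type*} (s : Finset ι)
    {F : ι → (Fin d → ℝ) → ℝ} (hF : ∀ a, ContDiffOn ℝ ∞ (F a) U) :
    EqOn (iterPartial l fun x => ∑ a ∈ s, F a x) (fun x => ∑ a ∈ s, iterPartial l (F a) x) U := by
  classical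
  induction s using Finset.induction_on with
  | empty =>
    intro x _
    simp only [Finset.sum_empty]
    exact congrFun (iterPartial_zero l) x
  | insert a s ha ih =>
    intro x hx
    simp only [Finset.sum_insert ha]
    rw [iterPartial_add hU l (hF a) (ContDiffOn.sum fun a _ => hF a) hx]
    exact congrArg _ (ih hx)

/-- The product with a locally constant function. -/
theorem iterPartial_mul (hU : IsOpen U) (l : List (Fin d)) (hh : ContDiffOn ℝ ∞ h U)
    (hc : ∀ x ∈ U, c =ᶠ[𝓝 x] fun _ => c x) :
    EqOn (iterPartial l fun x => h x * c x) (fun x => iterPartial l h x * c x) U := by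
  induction l with
  | nil => exact fun _ _ => rfl
  | cons i l ih =>
    refine (partialDeriv_congr hU i ih).trans fun x hx => ?_
    -- Near `x` the second factor is a constant, so the product rule produces no further term.
    have : (fun y => iterPartial l h y * c y) =ᶠ[𝓝 x] fun y => iterPartial l h y * c x := by
      filter_upwards [hc x hx] with y hy
      rw [hy]
    simp only [iterPartial, partialDeriv]
    rw [this.fderiv_eq, fderiv_mul_const (differentiableAt_iterPartial hU l hh hx)]
    simp [mul_comm]

theorem _root_.AffineMap.contDiff_of_pi (A : (Fin d → ℝ) →ᵃ[ℝ] ℝ) : ContDiff ℝ ∞ A :=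
  (⟨A, A.continuous_of_finiteDimensional⟩ : (Fin d → ℝ) →ᴬ[ℝ] ℝ).contDiff

theorem IsAffineFunOn.contDiffOn (hh : IsAffineFunOn h U) : ContDiffOn ℝ ∞ h U := fun x hx => by
  obtain ⟨A, hA⟩ := hh x hx
  exact (A.contDiff_of_pi.contDiffAt.congr_of_eventuallyEq hA).contDiffWithinAt

/-- The derivatives of an affine function are locally constant. -/
theorem IsAffineFunOn.partialDeriv (hh : IsAffineFunOn h U) (i : Fin d) {x : Fin d → ℝ}
    (hx : x ∈ U) : partialDeriv i h =ᶠ[𝓝 x] fun _ => partialDeriv i h x := by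
  obtain ⟨A, hA⟩ := hh x hx
  -- The derivative of an affine map is its linear part, at every point.
  have hA' (y : Fin d → ℝ) : fderiv ℝ A y = LinearMap.toContinuousLinearMap A.linear := by
    have : (A : (Fin d → ℝ) → ℝ) = fun y => LinearMap.toContinuousLinearMap A.linear y + A 0 :=
      A.decomp
    rw [this]
    exact ((LinearMap.toContinuousLinearMap A.linear).hasFDerivAt.add_const (A 0)).fderiv
  have h1 : AffStar.partialDeriv i h =ᶠ[𝓝 x] fun _ => A.linear (Pi.single i 1 : Fin d → ℝ) := by
    filter_upwards [hA.fderiv (𝕜 := ℝ)] with y hy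
    rw [AffStar.partialDeriv, hy, hA']
    rfl
  filter_upwards [h1] with y hy
  rw [hy, h1.self_of_nhds]

/-- The innermost derivative is locally constant, so the next one vanishes, and so do all later
ones. This is why graphs that are not affine may be discarded. -/
theorem IsAffineFunOn.iterPartial_eq_zero (hU : IsOpen U) (hh : IsAffineFunOn h U)
    {l : List (Fin d)} (hl : 2 ≤ l.length) : EqOn (iterPartial l h) 0 U := by
  induction l with
  | nil => simp at hl
  | cons i l ih =>
    by_cases hl' : 2 ≤ l.length
    · refine (partialDeriv_congr hU i (ih hl')).trans fun x _ => ?_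
      simp [AffStar.partialDeriv]
    · obtain ⟨j, rfl⟩ := List.length_eq_one_iff.1 (by
        rw [List.length_cons] at hl
        omega : l.length = 1)
      intro x hx
      have : iterPartial [i, j] h = AffStar.partialDeriv i (AffStar.partialDeriv j h) := rfl
      rw [this, AffStar.partialDeriv, (hh.partialDeriv j hx).fderiv_eq]
      simp

end Analysis

/-! ### Operators of graphs as functionals on the graph space -/

section Operators

open Set

variable {n k d : ℕ} {U : Set (Fin d → ℝ)} {P : BivectorField d} {f g : (Fin d → ℝ) → ℝ}
  {x : Fin d → ℝ}

namespace KGraph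

/-- The order in which incoming edges are listed depends on the encoding; since partial derivatives
commute, only the multiset of indices matters. -/
theorem iterPartial_inEdges (hU : IsOpen U) {h : (Fin d → ℝ) → ℝ} (hh : ContDiffOn ℝ ∞ h U)
    (hx : x ∈ U) {m : ℕ} {Γ : KGraph n} {Γ' : KGraph m} {t : Fin (n + 2)} {t' : Fin (m + 2)}
    (e : (Fin n × Fin 2) ≃ (Fin m × Fin 2)) (he : ∀ a, Γ' (e a).1 (e a).2 = t' ↔ Γ a.1 a.2 = t)
    {I : Fin n → Fin 2 → Fin d} {I' : Fin m → Fin 2 → Fin d}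
    (hI : ∀ a, I' (e a).1 (e a).2 = I a.1 a.2) :
    iterPartial ((Γ'.inEdges t').map fun e => I' e.1 e.2) h x =
      iterPartial ((Γ.inEdges t).map fun e => I e.1 e.2) h x := by
  refine iterPartial_perm hU (((inEdges_perm_map e he).map _).trans ?_) hh hx
  rw [List.map_map]
  exact .of_eq (List.map_congr_left fun a _ => hI a)

/-- The summation indices and the factors at the aerial vertices are permuted together; the sinks
are fixed. -/
theorem op_relabel (hU : IsOpen U) (hP : IsAffineBivectorOn P U) (hf : ContDiffOn ℝ ∞ f U)
    (hg : ContDiffOn ℝ ∞ g U) (hx : x ∈ U) (Γ : KGraph n) (σ : Equiv.Perm (Fin n)) :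
    (Γ.relabel σ).op P f g x = Γ.op P f g x := by
  refine (Fintype.sum_equiv (σ.arrowCongr (Equiv.refl (Fin 2 → Fin d))) _ _ fun I => ?_).symm
  have hI (a : Fin n × Fin 2) : σ.arrowCongr (Equiv.refl (Fin 2 → Fin d)) I (relabelEdges σ a).1
      (relabelEdges σ a).2 = I a.1 a.2 := by
    simp [relabelEdges]
  have h0 : vertexPerm σ 0 = 0 := vertexPerm_of_lt σ (by simp)
  have h1 : vertexPerm σ 1 = 1 := vertexPerm_of_lt σ (by simp)
  congr 1
  · congr 1
    · refine Fintype.prod_equiv σ _ _ fun v => ?_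
      rw [iterPartial_inEdges hU (hP.2 _ _).contDiffOn hx (relabelEdges σ)
        (fun a => (vertexPerm_aerial σ v) ▸ relabel_apply_relabelEdges σ Γ _ a) hI]
      simp
    · exact (iterPartial_inEdges hU hf hx (relabelEdges σ)
        (fun a => by rw [← relabel_apply_relabelEdges σ Γ _ a, h0]) hI).symm
  · exact (iterPartial_inEdges hU hg hx (relabelEdges σ)
      (fun a => by rw [← relabel_apply_relabelEdges σ Γ _ a, h1]) hI).symm

theorem op_swap (hU : IsOpen U) (hP : IsAffineBivectorOn P U) (hf : ContDiffOn ℝ ∞ f U)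
    (hg : ContDiffOn ℝ ∞ g U) (hx : x ∈ U) (Γ : KGraph n) (v : Fin n) :
    (Γ.swap v).op P f g x = - Γ.op P f g x := by
  -- Renaming the summation indices by the exchange of the two indices at `v` restores every factor
  -- except the one at `v`, whose indices become transposed.
  let τ (I : Fin n → Fin 2 → Fin d) : Fin n → Fin 2 → Fin d :=
    fun u s => if u = v then I u (1 - s) else I u s
  have hτ : Function.Involutive τ := fun I => by
    funext u s
    by_cases h : u = v <;> simp [τ, h]
  simp only [op]
  rw [← Finset.sum_neg_distrib]
  refine (Fintype.sum_equiv hτ.toPerm _ _ fun I => ?_).symm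
  have hI (a : Fin n × Fin 2) : hτ.toPerm τ I (swapEdges v a).1 (swapEdges v a).2 = I a.1 a.2 := by
    by_cases h : a.1 = v <;> simp [swapEdges, τ, h]
  rw [← neg_mul, ← neg_mul]
  congr 1
  · congr 1
    · rw [← Finset.mul_prod_erase _ _ (Finset.mem_univ v),
        ← Finset.mul_prod_erase Finset.univ (fun u => iterPartial (((Γ.swap v).inEdges _).map _) _ x)
          (Finset.mem_univ v), ← neg_mul]
      congr 1
      · rw [iterPartial_inEdges hU (hP.2 _ _).contDiffOn hx (swapEdges v)
          (swap_apply_swapEdges v Γ _) hI]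
        have h0 : hτ.toPerm τ I v 0 = I v 1 := by simp [τ]
        have h1 : hτ.toPerm τ I v 1 = I v 0 := by simp [τ]
        -- Skew-symmetry is only known on `U`, which suffices for the derivatives at a point of `U`.
        rw [h0, h1, iterPartial_congr hU _ (fun y hy => hP.1 (I v 0) (I v 1) y hy) hx,
          iterPartial_neg, neg_neg]
      · refine Finset.prod_congr rfl fun u hu => ?_
        rw [iterPartial_inEdges hU (hP.2 _ _).contDiffOn hx (swapEdges v)
          (swap_apply_swapEdges v Γ _) hI]
        have h (s : Fin 2) : hτ.toPerm τ I u s = I u s := by simp [τ, Finset.ne_of_mem_erase hu]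
        rw [h, h]
    · exact (iterPartial_inEdges hU hf hx (swapEdges v) (swap_apply_swapEdges v Γ _) hI).symm
  · exact (iterPartial_inEdges hU hg hx (swapEdges v) (swap_apply_swapEdges v Γ _) hI).symm

/-- At a vertex with two or more incoming edges an affine coefficient is differentiated at least
twice. -/
theorem op_eq_zero (hU : IsOpen U) (hP : IsAffineBivectorOn P U) (hx : x ∈ U) {Γ : KGraph n}
    (h : ¬ Γ.IsAffine) : Γ.op P f g x = 0 := by
  simp only [IsAffine, not_forall, not_le] at h
  obtain ⟨v, hv⟩ := h
  refine Finset.sum_eq_zero fun I _ => ?_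
  rw [Finset.prod_eq_zero (Finset.mem_univ v), zero_mul, zero_mul]
  exact (hP.2 _ _).iterPartial_eq_zero hU (by rwa [List.length_map]) hx

end KGraph

/-- The operators that graphs encode depend only on the classes of the graphs. -/
theorem exists_linearMap_op (hU : IsOpen U) (hP : IsAffineBivectorOn P U)
    (hf : ContDiffOn ℝ ∞ f U) (hg : ContDiffOn ℝ ∞ g U) (hx : x ∈ U) (n : ℕ) :
    ∃ Φ : GraphSpace n →ₗ[ℚ] ℝ, ∀ Γ, Φ (graphClass Γ) = Γ.op P f g x :=
  ⟨GraphSpace.lift (fun Γ => Γ.op P f g x) (KGraph.op_relabel hU hP hf hg hx)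
    (KGraph.op_swap hU hP hf hg hx) (fun _ => KGraph.op_eq_zero hU hP hx),
    GraphSpace.lift_graphClass _ _ _ _⟩

/-- The factors `∂P` are locally constant, so every further derivative acts on the undifferentiated
factor. This is the analytic counterpart of `LeibnizGraph.expand_eq`; the index `r` runs through the
cyclic permutations. -/
theorem iterPartial_jacobiator (hU : IsOpen U) (hP : IsAffineBivectorOn P U) (hx : x ∈ U)
    (A : List (Fin d)) (T : Fin 3 → Fin d) :
    iterPartial A (jacobiator P (T 0) (T 1) (T 2)) x = ∑ r, ∑ l,
      iterPartial A (P (T r) l) x * partialDeriv l (P (T (r + 1)) (T (r + 2))) x := by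
  have hS (i j : Fin d) := (hP.2 i j).contDiffOn
  have hD (i j l : Fin d) := contDiffOn_partialDeriv hU l (hS i j)
  have hM (i l j k : Fin d) := (hS i l).mul (hD j k l)
  have hmul (i l j k : Fin d) :=
    iterPartial_mul hU A (hS i l) (fun y hy => (hP.2 j k).partialDeriv l hy) hx
  unfold jacobiator
  rw [Finset.sum_comm]
  refine (iterPartial_sum hU A Finset.univ (fun l => ((hM _ l _ _).add (hM _ l _ _)).add
    (hM _ l _ _)) hx).trans (Finset.sum_congr rfl fun l _ => ?_)
  refine (iterPartial_add hU A ((hM _ l _ _).add (hM _ l _ _)) (hM _ l _ _) hx).trans ?_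
  rw [Fin.sum_univ_three]
  refine congrArg₂ _ ((iterPartial_add hU A (hM _ l _ _) (hM _ l _ _) hx).trans ?_) (hmul _ _ _ _)
  exact congrArg₂ _ (hmul _ _ _ _) (hmul _ _ _ _)

end Operators

/-! ### The operator of a Leibniz graph against the operators of its expansion -/

section Expansion

open Set

variable {n k d : ℕ} {U : Set (Fin d → ℝ)} {P : BivectorField d} {f g : (Fin d → ℝ) → ℝ}
  {x : Fin d → ℝ}

/-- The indices on the edges of the graph in which two wedges replace the trident, from the indices
on the edges of the Leibniz graph and the index on the edge between the two wedges. -/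
def splitIndices (r : Fin 3) :
    (Fin k → Fin 2 → Fin d) × (Fin 3 → Fin d) × Fin d ≃ (Fin (k + 2) → Fin 2 → Fin d) where
  toFun p := Fin.snoc (α := fun _ => Fin 2 → Fin d) (Fin.snoc (α := fun _ => Fin 2 → Fin d) p.1
    ![p.2.1 r, p.2.2]) ![p.2.1 (r + 1), p.2.1 (r + 2)]
  invFun I := (fun v => I v.castSucc.castSucc,
    -- Subtraction is in `Fin 3`: the edge `s = r` of the trident becomes the Left edge of the upper
    -- wedge, `r + 1` and `r + 2` become Left and Right of the lower one.
    fun s => ![I (Fin.last k).castSucc 0, I (Fin.last (k + 1)) 0, I (Fin.last (k + 1)) 1] (s - r),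
    I (Fin.last k).castSucc 1)
  left_inv p := by
    refine Prod.ext ?_ (Prod.ext ?_ ?_)
    · simp
    · funext s
      obtain ⟨u, rfl⟩ : ∃ u, s = r + u := ⟨s - r, by simp⟩
      fin_cases u <;> simp
    · simp
  right_inv I := by
    funext v s
    induction v using Fin.lastCases with
    | last => fin_cases s <;> simp
    | cast v =>
      induction v using Fin.lastCases with
      | last => fin_cases s <;> simp
      | cast v => simp

/-- The edge that replaces the edge `s` of the trident. -/
def splitEdge (k : ℕ) (r s : Fin 3) : Fin (k + 2) × Fin 2 :=
  ![((Fin.last k).castSucc, 0), (Fin.last (k + 1), 0), (Fin.last (k + 1), 1)] (s - r)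

theorem splitEdge_injective (k : ℕ) (r : Fin 3) : Function.Injective (splitEdge k r) := by
  intro s s' h
  obtain ⟨u, rfl⟩ : ∃ u, s = r + u := ⟨s - r, by simp⟩
  obtain ⟨u', rfl⟩ : ∃ u', s' = r + u' := ⟨s' - r, by simp⟩
  have hne : (Fin.last k).castSucc ≠ Fin.last (k + 1) := (Fin.castSucc_lt_last _).ne
  fin_cases u <;> fin_cases u' <;> first | rfl | simp [splitEdge, hne, hne.symm] at h

theorem splitIndices_splitEdge (r s : Fin 3)
    (p : (Fin k → Fin 2 → Fin d) × (Fin 3 → Fin d) × Fin d) :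
    splitIndices r p (splitEdge k r s).1 (splitEdge k r s).2 = p.2.1 s := by
  obtain ⟨u, rfl⟩ : ∃ u, s = r + u := ⟨s - r, by simp⟩
  fin_cases u <;> simp [splitEdge, splitIndices]

namespace LeibnizGraph

variable (L : LeibnizGraph k) (r : Fin 3)

theorem expandTerm_wedge (v : Fin k) (s : Fin 2) :
    L.expandTerm ∅ r v.castSucc.castSucc s = (L.wedge v s).castSucc := by
  simp [expandTerm]

theorem expandTerm_splitEdge (s : Fin 3) :
    L.expandTerm ∅ r (splitEdge k r s).1 (splitEdge k r s).2 = (L.trident s).castSucc := by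
  obtain ⟨u, rfl⟩ : ∃ u, s = r + u := ⟨s - r, by simp⟩
  fin_cases u <;> simp [splitEdge, expandTerm]

theorem expandTerm_last : L.expandTerm ∅ r (Fin.last k).castSucc 1 = Fin.last (k + 3) := by
  simp [expandTerm]

/-- An edge of an expansion term is inherited from a wedge, inherited from the trident, or is the
new edge between the two wedges. -/
theorem edge_cases (e : Fin (k + 2) × Fin 2) :
    (∃ v s, e = (Fin.castSucc (Fin.castSucc v), s)) ∨ (∃ s, e = splitEdge k r s) ∨
      e = ((Fin.last k).castSucc, 1) := by
  obtain ⟨v, s⟩ := e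
  induction v using Fin.lastCases with
  | last =>
    refine .inr (.inl ?_)
    fin_cases s
    · exact ⟨r + 1, by simp [splitEdge]⟩
    · exact ⟨r + 2, by simp [splitEdge]⟩
  | cast v =>
    induction v using Fin.lastCases with
    | last =>
      fin_cases s
      · exact .inr (.inl ⟨r, by simp [splitEdge]⟩)
      · exact .inr (.inr rfl)
    | cast v => exact .inl ⟨v, s, rfl⟩

/-- As no old arrow is sent to the lower wedge, its content is differentiated once, along the new
edge; this is the factor `∂P` of the Jacobiator. -/
theorem inEdges_expandTerm_last :
    (L.expandTerm ∅ r).inEdges (Fin.last (k + 3)) = [((Fin.last k).castSucc, 1)] := by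
  refine List.perm_singleton.1 ((List.perm_ext_iff_of_nodup (KGraph.nodup_inEdges _ _)
    (List.nodup_singleton _)).2 fun e => ?_)
  rw [KGraph.mem_inEdges, List.mem_singleton]
  refine ⟨fun h => ?_, fun h => h ▸ L.expandTerm_last r⟩
  rcases edge_cases r e with ⟨v, s, rfl⟩ | ⟨s, rfl⟩ | rfl
  · exact absurd ((L.expandTerm_wedge r v s).symm.trans h) (Fin.castSucc_lt_last _).ne
  · exact absurd ((L.expandTerm_splitEdge r s).symm.trans h) (Fin.castSucc_lt_last _).ne
  · rfl

/-- Every other vertex keeps its arrows. In particular the upper wedge, which bears the label of the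
trident, inherits all the arrows that came to the trident. -/
theorem inEdges_expandTerm_castSucc (t : Fin (k + 3)) :
    ((L.expandTerm ∅ r).inEdges t.castSucc).Perm
      ((L.wedgeInEdges t).map (fun e => (e.1.castSucc.castSucc, e.2)) ++
        (L.tridentInEdges t).map (splitEdge k r)) := by
  have hne (v : Fin k) (s : Fin 2) (s' : Fin 3) :
      splitEdge k r s' ≠ (v.castSucc.castSucc, s) := by
    obtain ⟨u, rfl⟩ : ∃ u, s' = r + u := ⟨s' - r, by simp⟩
    have h1 : Fin.last k ≠ v.castSucc := (Fin.castSucc_lt_last _).ne'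
    have h2 : Fin.last (k + 1) ≠ v.castSucc.castSucc := (Fin.castSucc_lt_last _).ne'
    fin_cases u <;> simp [splitEdge, h1, h2]
  refine (List.perm_ext_iff_of_nodup (KGraph.nodup_inEdges _ _) ?_).2 fun e => ?_
  · refine List.nodup_append'.2 ⟨(L.nodup_wedgeInEdges t).map fun a b h => ?_,
      (L.nodup_tridentInEdges t).map (splitEdge_injective k r), ?_⟩
    · simp only [Prod.mk.injEq, Fin.castSucc_inj] at h
      exact Prod.ext h.1 h.2
    · rw [List.disjoint_left]
      intro a ha hb
      obtain ⟨e, -, rfl⟩ := List.mem_map.1 ha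
      obtain ⟨s, -, hs⟩ := List.mem_map.1 hb
      exact hne _ _ _ hs
  · rw [KGraph.mem_inEdges, List.mem_append, List.mem_map, List.mem_map]
    simp only [mem_wedgeInEdges, mem_tridentInEdges]
    rcases edge_cases r e with ⟨v, s, rfl⟩ | ⟨s, rfl⟩ | rfl
    · rw [L.expandTerm_wedge, Fin.castSucc_inj]
      refine ⟨fun h => .inl ⟨(v, s), h, rfl⟩, ?_⟩
      rintro (⟨e, he, h⟩ | ⟨s', -, h⟩)
      · simp only [Prod.mk.injEq, Fin.castSucc_inj] at h
        rwa [← h.1, ← h.2]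
      · exact absurd h (hne _ _ _)
    · rw [L.expandTerm_splitEdge, Fin.castSucc_inj]
      refine ⟨fun h => .inr ⟨s, h, rfl⟩, ?_⟩
      rintro (⟨e, -, h⟩ | ⟨s', hs', h⟩)
      · exact absurd h.symm (hne _ _ _)
      · rwa [← splitEdge_injective k r h]
    · rw [L.expandTerm_last]
      refine ⟨fun h => absurd h (Fin.castSucc_lt_last _).ne', ?_⟩
      rintro (⟨e, -, h⟩ | ⟨s, hs, h⟩)
      · simp only [Prod.mk.injEq, Fin.castSucc_inj] at h
        exact absurd h.1 (Fin.castSucc_lt_last _).ne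
      · have h1 := L.expandTerm_splitEdge r s
        rw [h, L.expandTerm_last] at h1
        exact absurd h1 (Fin.castSucc_lt_last _).ne'

theorem iterPartial_expandTerm (hU : IsOpen U) {h : (Fin d → ℝ) → ℝ} (hh : ContDiffOn ℝ ∞ h U)
    (hx : x ∈ U) (t : Fin (k + 3)) (p : (Fin k → Fin 2 → Fin d) × (Fin 3 → Fin d) × Fin d) :
    iterPartial (((L.expandTerm ∅ r).inEdges t.castSucc).map fun e => splitIndices r p e.1 e.2) h x =
      iterPartial (L.inIndices p.1 p.2.1 t) h x := by
  refine iterPartial_perm hU (((L.inEdges_expandTerm_castSucc r t).map _).trans ?_) hh hx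
  rw [List.map_append, List.map_map, List.map_map, inIndices]
  refine .of_eq (congrArg₂ _ (List.map_congr_left fun e _ => ?_)
    (List.map_congr_left fun s _ => splitIndices_splitEdge r s p))
  simp [splitIndices]

/-- The operator of a Leibniz graph with the Jacobiator is the operator of its expansion. -/
theorem sum_op_expandTerm (hU : IsOpen U) (hP : IsAffineBivectorOn P U) (hf : ContDiffOn ℝ ∞ f U)
    (hg : ContDiffOn ℝ ∞ g U) (hx : x ∈ U) :
    ∑ r, (L.expandTerm ∅ r).op P f g x = L.op P (jacobiator P) f g x := by
  have hterm (r : Fin 3) : (L.expandTerm ∅ r).op P f g x =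
      ∑ I : Fin k → Fin 2 → Fin d, ∑ T : Fin 3 → Fin d, ∑ l : Fin d,
        (∏ v : Fin k,
          iterPartial (L.inIndices I T ⟨v.val + 2, by omega⟩) (P (I v 0) (I v 1)) x) *
        (iterPartial (L.inIndices I T (Fin.last (k + 2))) (P (T r) l) x *
          partialDeriv l (P (T (r + 1)) (T (r + 2))) x) *
        iterPartial (L.inIndices I T 0) f x * iterPartial (L.inIndices I T 1) g x := by
    -- The sum over the indices of the expansion term is split into the indices of the Leibniz graph
    -- and the index `l` on the new edge.
    rw [KGraph.op, ← (splitIndices r).sum_comp]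
    simp only [Fintype.sum_prod_type]
    refine Finset.sum_congr rfl fun I _ => Finset.sum_congr rfl fun T _ =>
      Finset.sum_congr rfl fun l _ => ?_
    have hv (v : Fin k) : KGraph.aerial v.castSucc.castSucc =
        (⟨v.val + 2, by omega⟩ : Fin (k + 3)).castSucc := Fin.ext (by simp)
    have ha : KGraph.aerial (Fin.last k).castSucc = (Fin.last (k + 2)).castSucc :=
      Fin.ext (by simp)
    have hb : KGraph.aerial (Fin.last (k + 1)) = Fin.last (k + 3) := Fin.ext (by simp)
    have hS (i j : Fin d) := (hP.2 i j).contDiffOn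
    rw [Fin.prod_univ_castSucc, Fin.prod_univ_castSucc, hb, ha, inEdges_expandTerm_last]
    simp only [hv]
    have h0 := L.iterPartial_expandTerm r hU hf hx 0 (I, T, l)
    have h1 := L.iterPartial_expandTerm r hU hg hx 1 (I, T, l)
    rw [Fin.castSucc_zero] at h0
    rw [Fin.castSucc_one] at h1
    rw [L.iterPartial_expandTerm r hU (hS _ _) hx, h0, h1]
    simp only [L.iterPartial_expandTerm r hU (hS _ _) hx]
    simp [splitIndices, iterPartial, mul_assoc]
  simp only [hterm, op]
  rw [Finset.sum_comm]
  refine Finset.sum_congr rfl fun I _ => ?_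
  rw [Finset.sum_comm]
  refine Finset.sum_congr rfl fun T _ => ?_
  -- The common factors are taken out; what remains, summed over `r` and `l`, is the differentiated
  -- Jacobiator.
  simp only [← Finset.sum_mul, ← Finset.mul_sum]
  rw [iterPartial_jacobiator hU hP hx]

/-- The operators of Leibniz graphs vanish by the Jacobi identity. -/
theorem op_jacobiator_eq_zero (hU : IsOpen U) (hP : IsAffinePoissonOn P U) (hx : x ∈ U) :
    L.op P (jacobiator P) f g x = 0 := by
  refine Finset.sum_eq_zero fun I _ => Finset.sum_eq_zero fun T _ => ?_
  -- The Jacobiator vanishes on the whole open set and not just at `x`, so its derivatives vanish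
  -- too.
  have h : EqOn (jacobiator P (T 0) (T 1) (T 2)) 0 U := fun y hy => hP.2 _ _ _ y hy
  rw [iterPartial_congr hU _ h hx, iterPartial_zero]
  simp

end LeibnizGraph

end Expansion

/-! ### The operators of the star-products -/

section Operators

variable {d : ℕ} {U : Set (Fin d → ℝ)} {P : BivectorField d}

theorem map_sumClass {n : ℕ} (Φ : GraphSpace n →ₗ[ℚ] ℝ) (S : List (KGraph n × ℚ)) :
    Φ (sumClass S) = (S.map fun t => (t.2 : ℝ) * Φ (graphClass t.1)).sum := by
  rw [sumClass, map_list_sum, List.map_map]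
  refine congrArg List.sum (List.map_congr_left fun t _ => ?_)
  rw [Function.comp_apply, map_smul, Rat.smul_def]

/-- The functional on graphs determines the operators of Leibniz graphs with the Jacobiator, through
their expansions. -/
theorem map_expand (hU : IsOpen U) (hP : IsAffineBivectorOn P U) {f g : (Fin d → ℝ) → ℝ}
    (hf : ContDiffOn ℝ ∞ f U) (hg : ContDiffOn ℝ ∞ g U) {x : Fin d → ℝ} (hx : x ∈ U) {n : ℕ}
    {Φ : GraphSpace n →ₗ[ℚ] ℝ} (hΦ : ∀ Γ, Φ (graphClass Γ) = Γ.op P f g x) (c : LeibnizSum) :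
    Φ (c.expand n) = c.ops P (jacobiator P) n f g x := by
  match n with
  | 0 => exact map_zero Φ
  | 1 => exact map_zero Φ
  | k + 2 =>
    rw [LeibnizSum.expand, LeibnizSum.ops, map_finsuppSum]
    refine Finsupp.sum_congr fun L _ => ?_
    rw [map_smul, Rat.smul_def, LeibnizGraph.expand_eq, map_sum,
      ← L.sum_op_expandTerm hU hP hf hg hx]
    simp only [hΦ]

/-- Both identities in the graph space are evaluated by one functional at the point `x`. They are
identities over ℚ; the number `zetaConst` enters only when the two parts are assembled, and no
arithmetic property of it is used. -/
theorem starOps_apply (hU : IsOpen U) (hP : IsAffineBivectorOn P U) {f g : (Fin d → ℝ) → ℝ}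
    (hf : ContDiffOn ℝ ∞ f U) (hg : ContDiffOn ℝ ∞ g U) {x : Fin d → ℝ} (hx : x ∈ U) {n : ℕ}
    (hn : n ≤ 7) :
    starAffZetaOps P n f g x = (leibnizSum Row.zeta).ops P (jacobiator P) n f g x ∧
    starAffOps P n f g x = starRedOps P n f g x +
      ((leibnizSum Row.rat).ops P (jacobiator P) n f g x +
        zetaConst * (leibnizSum Row.zeta).ops P (jacobiator P) n f g x) := by
  obtain ⟨Φ, hΦ⟩ := exists_linearMap_op hU hP hf hg hx n
  obtain ⟨h1, h2⟩ := sumClass_starAff hn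
  have h3 := congrArg Φ h1
  have h4 := congrArg Φ h2
  rw [map_add, map_sumClass, map_sumClass, map_expand hU hP hf hg hx hΦ] at h3
  rw [map_sumClass, map_expand hU hP hf hg hx hΦ] at h4
  simp only [hΦ] at h3 h4
  have hsum : starAffOps P n f g x =
      ((starAffRat n).map fun t => (t.2 : ℝ) * t.1.op P f g x).sum +
        zetaConst * ((starAffZeta n).map fun t => (t.2 : ℝ) * t.1.op P f g x).sum := by
    simp only [starAffOps, graphOps, starAffRat, starAffZeta, List.map_map]
    rw [← List.sum_map_mul_left, ← List.sum_map_add]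
    refine congrArg List.sum (List.map_congr_left fun t _ => ?_)
    simp only [Function.comp_apply]
    ring
  have hred : starRedOps P n f g x =
      ((starRed n).map fun t => (t.2 : ℝ) * t.1.op P f g x).sum := by
    simp only [starRedOps, graphOps, List.map_map, Function.comp_def]
  have hzeta : starAffZetaOps P n f g x =
      ((starAffZeta n).map fun t => (t.2 : ℝ) * t.1.op P f g x).sum := by
    simp only [starAffZetaOps, graphOps, List.map_map, Function.comp_def]
  refine ⟨hzeta.trans h4, ?_⟩
  rw [hsum, hred, h3, h4, add_assoc]

theorem coeff_product (B : BidiffSeries d) (f g : PowerSeries ((Fin d → ℝ) → ℝ)) (N : ℕ)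
    (x : Fin d → ℝ) : PowerSeries.coeff N (B.product f g) x =
      ∑ p ∈ Finset.HasAntidiagonal.antidiagonal N, ∑ q ∈ Finset.HasAntidiagonal.antidiagonal p.2,
        B p.1 (PowerSeries.coeff q.1 f) (PowerSeries.coeff q.2 g) x := by
  simp only [BidiffSeries.product, PowerSeries.coeff_mk, Finset.sum_apply]

/-- A coefficient of the extended product is a finite sum of operators of orders at most `N`,
applied to smooth coefficients, so the identities add up. -/
theorem coeff_starAff (hU : IsOpen U) (hP : IsAffineBivectorOn P U)
    {f g : PowerSeries ((Fin d → ℝ) → ℝ)} (hf : IsSmoothOn f U) (hg : IsSmoothOn g U) {N : ℕ}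
    (hN : N ≤ 7) {x : Fin d → ℝ} (hx : x ∈ U) :
    PowerSeries.coeff N ((starAffZetaOps P).product f g) x =
        PowerSeries.coeff N (((leibnizSum Row.zeta).ops P (jacobiator P)).product f g) x ∧
      PowerSeries.coeff N ((starAffOps P).product f g) x -
          PowerSeries.coeff N ((starRedOps P).product f g) x =
        PowerSeries.coeff N (((leibnizSum Row.rat).ops P (jacobiator P)).product f g) x +
          zetaConst *
            PowerSeries.coeff N (((leibnizSum Row.zeta).ops P (jacobiator P)).product f g) x := by
  have hle (p : ℕ × ℕ) (hp : p ∈ Finset.HasAntidiagonal.antidiagonal N) : p.1 ≤ 7 :=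
    by
    have := Finset.HasAntidiagonal.mem_antidiagonal.1 hp
    omega
  simp only [coeff_product]
  constructor
  · exact Finset.sum_congr rfl fun p hp => Finset.sum_congr rfl fun q _ =>
      (starOps_apply hU hP (hf _) (hg _) hx (hle p hp)).1
  · rw [sub_eq_iff_eq_add', Finset.mul_sum, ← Finset.sum_add_distrib, ← Finset.sum_add_distrib]
    refine Finset.sum_congr rfl fun p hp => ?_
    rw [Finset.mul_sum, ← Finset.sum_add_distrib, ← Finset.sum_add_distrib]
    exact Finset.sum_congr rfl fun q _ => (starOps_apply hU hP (hf _) (hg _) hx (hle p hp)).2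

theorem LeibnizSum.coeff_product_eq_zero (c : LeibnizSum) (hU : IsOpen U)
    (hP : IsAffinePoissonOn P U) (f g : PowerSeries ((Fin d → ℝ) → ℝ)) (N : ℕ) {x : Fin d → ℝ}
    (hx : x ∈ U) : PowerSeries.coeff N ((c.ops P (jacobiator P)).product f g) x = 0 := by
  have h (n : ℕ) (f g : (Fin d → ℝ) → ℝ) : c.ops P (jacobiator P) n f g x = 0 := by
    match n with
    | 0 => rfl
    | 1 => rfl
    | k + 2 =>
      refine Finset.sum_eq_zero fun L _ => ?_
      simp only [L.op_jacobiator_eq_zero hU hP hx, mul_zero]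
  rw [coeff_product]
  exact Finset.sum_eq_zero fun p _ => Finset.sum_eq_zero fun q _ => h _ _ _

end Operators

end AffStar

theorem mainTheorem2 :
    -- the coefficients in the two graph expansions, orders `ħ^0, …, ħ^7`
    (∀ n ≤ 7, AffStar.AreDistinctAffineGraphs ((AffStar.starAff n).map Prod.fst) ∧
      ∀ t ∈ AffStar.starAff n, t.2 ≠ 0) ∧
    (∑ n ∈ Finset.range 8, (AffStar.starAff n).length) = 1423 ∧
    (∀ n ≤ 7, AffStar.AreDistinctAffineGraphs ((AffStar.starRed n).map Prod.fst) ∧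
      ∀ t ∈ AffStar.starRed n, t.2 ≠ 0) ∧
    (∑ n ∈ Finset.range 8, (AffStar.starRed n).length) = 326 ∧
    -- the Leibniz graphs `c₀ + c₁ ζ(3)² / π⁶` and the two parts of `⋆_aff - ⋆_aff^red`
    (∃ c₀ c₁ : AffStar.LeibnizSum,
      (∀ k L, c₀ k L ≠ 0 ∨ c₁ k L ≠ 0 → L.IsAffine) ∧
      (∀ n ≤ 7, AffStar.sumClass (AffStar.starAffZeta n) = c₁.expand n) ∧
      (∀ n ≤ 7, AffStar.sumClass (AffStar.starAffRat n) =
        AffStar.sumClass (AffStar.starRed n) + c₀.expand n) ∧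
      -- analytically, for all affine bi-vectors: differential operators acting on the Jacobiator
      ∀ (d : ℕ) (U : Set (Fin d → ℝ)) (P : AffStar.BivectorField d)
        (f g : PowerSeries ((Fin d → ℝ) → ℝ)),
        IsOpen U → AffStar.IsAffineBivectorOn P U →
        AffStar.IsSmoothOn f U → AffStar.IsSmoothOn g U →
        ∀ N ≤ 7, ∀ x ∈ U,
          PowerSeries.coeff N ((AffStar.starAffZetaOps P).product f g) x =
            PowerSeries.coeff N ((c₁.ops P (AffStar.jacobiator P)).product f g) x ∧
          PowerSeries.coeff N ((AffStar.starAffOps P).product f g) x -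
              PowerSeries.coeff N ((AffStar.starRedOps P).product f g) x =
            PowerSeries.coeff N ((c₀.ops P (AffStar.jacobiator P)).product f g) x +
              AffStar.zetaConst *
                PowerSeries.coeff N ((c₁.ops P (AffStar.jacobiator P)).product f g) x) ∧
    -- for affine Poisson structures: vanishing by the Jacobi identity, and the same formula
    (∀ (d : ℕ) (U : Set (Fin d → ℝ)) (P : AffStar.BivectorField d),
      IsOpen U → AffStar.IsAffinePoissonOn P U →
      (∀ (k : ℕ) (L : AffStar.LeibnizGraph k) (f g : (Fin d → ℝ) → ℝ),
        ContDiffOn ℝ (⊤ : ℕ∞) f U → ContDiffOn ℝ (⊤ : ℕ∞) g U →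
        ∀ x ∈ U, L.op P (AffStar.jacobiator P) f g x = 0) ∧
      ∀ f g : PowerSeries ((Fin d → ℝ) → ℝ),
        AffStar.IsSmoothOn f U → AffStar.IsSmoothOn g U →
        ∀ N ≤ 7, ∀ x ∈ U,
          PowerSeries.coeff N ((AffStar.starAffZetaOps P).product f g) x = 0 ∧
          PowerSeries.coeff N ((AffStar.starAffOps P).product f g) x =
            PowerSeries.coeff N ((AffStar.starRedOps P).product f g) x) := by
  refine ⟨fun n hn => ⟨?_, ?_⟩, ?_, fun n hn => ⟨?_, ?_⟩, ?_, ?_, ?_⟩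
  · rw [AffStar.starAff, List.map_map]
    exact AffStar.areDistinctAffineGraphs_of_areDistinct (AffStar.areDistinct_affRows n hn)
  · simp only [AffStar.starAff, List.forall_mem_map]
    exact AffStar.affRows_ne_zero n hn
  · simp only [AffStar.starAff, List.length_map]
    exact AffStar.length_affRows
  · rw [AffStar.starRed, List.map_map]
    exact AffStar.areDistinctAffineGraphs_of_areDistinct (AffStar.areDistinct_redRows n hn)
  · simp only [AffStar.starRed, List.forall_mem_map]
    exact AffStar.redRows_ne_zero n hn
  · simp only [AffStar.starRed, List.length_map]
    exact AffStar.length_redRows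
  · refine ⟨AffStar.leibnizSum AffStar.Row.rat, AffStar.leibnizSum AffStar.Row.zeta, ?_,
      fun n hn => (AffStar.sumClass_starAff hn).2, fun n hn => (AffStar.sumClass_starAff hn).1,
      fun d U P f g hU hP hf hg N hN x hx => AffStar.coeff_starAff hU hP hf hg hN hx⟩
    rintro k L (h | h) <;> exact AffStar.isAffine_of_leibnizSum_ne_zero k h
  -- For a Poisson structure the identities of the previous part hold with right-hand sides that
  -- vanish term by term.
  · refine fun d U P hU hP => ⟨fun k L f g _ _ x hx => L.op_jacobiator_eq_zero hU hP hx,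
      fun f g hf hg N hN x hx => ?_⟩
    have h := AffStar.coeff_starAff hU hP.1 hf hg hN hx
    rw [AffStar.LeibnizSum.coeff_product_eq_zero _ hU hP f g N hx,
      AffStar.LeibnizSum.coeff_product_eq_zero _ hU hP f g N hx, mul_zero, add_zero,
      sub_eq_zero] at h
    exact h
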